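/- \textbf{Corollary 9 (ChordalGen with ConnectingNodes).} For an integer $n\ge 1$ and a real $\lambda>0$, let Algorithm ChordalGen with the ConnectingNodes method be the following random process. (1) \emph{Host tree.} Start with a tree with a single node $r$, and repeat $n-1$ times: pick a uniformly random node of the current tree and attach a new node to it. Let $T$ be the resulting tree on $n$ nodes, rooted at $r$. Write $P(x)$ for the parent of a node $x\neq r$ and $l(x)$ for its level, that is, its distance from $r$. (2) \emph{Subtrees.} For $i=1,\dots,n$, independently: draw $k_i$ from the Poisson distribution with mean $\lambda$, and replace $k_i$ by $1$ if $k_i=0$ and by $n$ if $k_i>n$. Let $V(T_i)=L$ be a uniformly random set of $k_i$ nodes of $T$, and let $d$ be the largest level of a node of $L$. While $|L|>1$: for every $x\in L$ with $l(x)=d$, add $P(x)$ to $V(T_i)$ and replace $x$ by $P(x)$ in $L$; then decrease $d$ by $1$. (3) \emph{Output.} The graph $G$ is the intersection graph of $V(T_1),\dots,V(T_n)$: its vertices are $v_1,\dots,v_n$, and $v_i,v_j$ ($i\ne j$) are adjacent iff $V(T_i)\cap V(T_j)\ne\emptyset$. The output consists of the edge list of $T$, the node lists of $T_1,\dots,T_n$,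 and a clique tree of $G$, i.e. the list of all maximal cliques of $G$, each exactly once and as a list of its vertices, and the edges of a tree on these cliques in which, for every vertex $v$ of $G$, the cliques containing $v$ induce a connected subtree. This algorithm runs in time $O\bigl(\sum_{i=1}^n |V(T_i)|\bigr)$. That is, there are one program for a randomized unit-cost random access machine and one constant $C$, independent of $n$ and $\lambda$, such that for all $n\ge1$ and $\lambda>0$ the following holds. On input $(n,\lambda)$, the pair consisting of the tree $T$ and the family $(V(T_1),\dots,V(T_n))$ that the program outputs has exactly the joint distribution described in (1) and (2). In every run of positive probability the program halts with a correct output in the sense of (3), after at most $C\sum_{i=1}^n |V(T_i)|$ steps, where $T_1,\dots,T_n$ are the subtrees that this run outputs. The machine has integer registers, integer arrays and real registers. In one step it executes one instruction, evaluates one test (a comparison of two integer registers), or unfolds the sequential composition of two programs. The instructions are: storing a constant or a copy in an integer register; adding or subtracting $1$; reading or writing an array cell; drawing a uniformly random integer between two given ones; setting a real register to $1$; $+,-,\cdot,/$ and $\exp$ on real registers; and testing whether a fresh uniformly random number in $[0,1]$ is smaller than a given real register. -/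

import Mathlib

open scoped NNReal ENNReal

/-! ## Intersection graphs and clique trees -/

/-- The intersection graph of a family of finite sets: distinct indices are adjacent iff their sets
meet. -/
def intersectionGraph {ι α : Type} [DecidableEq α] (F : ι → Finset α) : SimpleGraph ι where
  Adj i j := i ≠ j ∧ (F i ∩ F j).Nonempty
  symm := ⟨fun _ _ h => ⟨h.1.symm, by rw [Finset.inter_comm]; exact h.2⟩⟩
  loopless := ⟨fun _ h => h.1 rfl⟩

/-- `H` (a graph on `Fin q`) with the bags `K` is a clique tree of `G`: `H` is a tree, `K` is a
bijection from its nodes onto the set of maximal cliques of `G`, and for every vertex `v` of `G`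
the nodes whose cliques contain `v` induce a connected subtree. -/
structure IsCliqueTree {V : Type} (G : SimpleGraph V) {q : ℕ} (H : SimpleGraph (Fin q))
    (K : Fin q → Finset V) : Prop where
  isTree : H.IsTree
  injective : Function.Injective K
  range_eq : ∀ S : Finset V, S ∈ Set.range K ↔ Maximal G.IsClique (S : Set V)
  connected : ∀ v : V, (H.induce {a | v ∈ K a}).Connected

/-! ## The random process -/

/-- The random host tree on `n` nodes: start with one node; then repeatedly pick a uniformly random
node of the current tree and attach a new node to it. (For `n = 0` there is no tree.) -/
noncomputable def hostTree : (n : ℕ) → PMF (SimpleGraph (Fin n))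
  | 0 => PMF.pure ⊥
  | 1 => PMF.pure ⊥
  | n + 2 =>
    (hostTree (n + 1)).bind fun T =>
      (PMF.uniformOfFintype (Fin (n + 1))).bind fun x =>
        PMF.pure (T.map (Fin.castSuccEmb : Fin (n + 1) ↪ Fin (n + 2)) ⊔
          SimpleGraph.edge x.castSucc (Fin.last (n + 1)))

open Classical in
/-- The BFS parent of `x` in the tree `T` rooted at `r`: the neighbour of `x` on the level above
(and `x` itself if there is none, i.e. for the root). The BFS level of `x` is `T.dist r x`. -/
noncomputable def bfsParent {n : ℕ} (T : SimpleGraph (Fin n)) (r x : Fin n) : Fin n :=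
  if h : ∃ y, T.Adj x y ∧ T.dist r y + 1 = T.dist r x then h.choose else x

/-- The `while` loop of ConnectingNodes. The arguments are the current level `d`, the nodes `S`
collected so far, and the set `L` of unprocessed nodes, all at level at most `d`. While `|L| > 1`,
the parents of all nodes of `L` at level `d` are added to `S`, these nodes are replaced by their
parents in `L`, and `d` is decremented. (At level `0` there is only the root, so `|L| ≤ 1`.) -/
noncomputable def connectLoop {n : ℕ} (T : SimpleGraph (Fin n)) (r : Fin n) :
    ℕ → Finset (Fin n) → Finset (Fin n) → Finset (Fin n)
  | 0, S, _ => S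
  | d + 1, S, L =>
    if 1 < L.card then
      let M := L.filter fun x => T.dist r x = d + 1
      connectLoop T r d (S ∪ M.image (bfsParent T r)) ((L \ M) ∪ M.image (bfsParent T r))
    else S

/-- The subtree that ConnectingNodes builds from the set `X` of selected nodes. -/
noncomputable def connectNodes {n : ℕ} (T : SimpleGraph (Fin n)) (r : Fin n)
    (X : Finset (Fin n)) : Finset (Fin n) :=
  connectLoop T r (X.sup fun x => T.dist r x) X X

/-- The number of nodes to select: `0` is replaced by `1`, and numbers above `n` by `n`. -/
def clampCount (n k : ℕ) : ℕ := if k = 0 then 1 else if n < k then n else k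

lemma clampCount_le (n k : ℕ) [NeZero n] : clampCount n k ≤ n := by
  have := NeZero.pos n
  unfold clampCount
  split_ifs <;> omega

/-- A uniformly random set of `clampCount n k` nodes. -/
noncomputable def selectNodes (n k : ℕ) [NeZero n] : PMF (Finset (Fin n)) :=
  PMF.uniformOfFinset (Finset.powersetCard (clampCount n k) Finset.univ)
    (Finset.powersetCard_nonempty.2 (by simpa using clampCount_le n k))

/-- One random subtree: draw `k` from the Poisson distribution with mean `lam`, select nodes, and
connect them. -/
noncomputable def randomSubtree {n : ℕ} [NeZero n] (lam : ℝ≥0) (T : SimpleGraph (Fin n))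
    (r : Fin n) : PMF (Finset (Fin n)) :=
  (ProbabilityTheory.poissonMeasure lam).toPMF.bind fun k =>
    (selectNodes n k).bind fun X => PMF.pure (connectNodes T r X)

/-- `m` independent samples of `p`. -/
noncomputable def iidSamples {α : Type} (p : PMF α) : (m : ℕ) → PMF (Fin m → α)
  | 0 => PMF.pure Fin.elim0
  | m + 1 => (iidSamples p m).bind fun f => p.bind fun a => PMF.pure (Fin.snoc f a)

/-- The joint law of the host tree `T` and the node sets of the subtrees `T_1, …, T_n` in ChordalGen
with ConnectingNodes on input `n`, `lam`; the root is the first node of the tree. The graph that is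
generated is the intersection graph of the second component. -/
noncomputable def chordalGen (n : ℕ) [NeZero n] (lam : ℝ≥0) :
    PMF (SimpleGraph (Fin n) × (Fin n → Finset (Fin n))) :=
  (hostTree n).bind fun T =>
    (iidSamples (randomSubtree lam T 0) n).bind fun F => PMF.pure (T, F)

/-! ## The machine model

A unit-cost random access machine with a structured control. It has integer registers `nat i`,
integer arrays `arr a`, and real registers `real i`. Integers are changed only by storing a constant
of the program, by `± 1`, or by drawing a random integer between two stored ones, so they can grow
by at most one per step. -/

/-- The memory of the machine. -/
structure Mem where
  nat : ℕ → ℕ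
  arr : ℕ → ℕ → ℕ
  real : ℕ → ℝ

/-- Binary operations on real registers. -/
inductive ROp
  | add | sub | mul | div

/-- The value of a real operation. -/
noncomputable def ROp.eval : ROp → ℝ → ℝ → ℝ
  | .add, a, b => a + b
  | .sub, a, b => a - b
  | .mul, a, b => a * b
  | .div, a, b => a / b

/-- Comparisons of two integer registers. -/
inductive Test
  | eq (x y : ℕ) | lt (x y : ℕ) | ne (x y : ℕ) | le (x y : ℕ)

/-- The truth value of a test. -/
def Test.holds (m : Mem) : Test → Bool
  | .eq x y => decide (m.nat x = m.nat y)
  | .lt x y => decide (m.nat x < m.nat y)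
  | .ne x y => decide (m.nat x ≠ m.nat y)
  | .le x y => decide (m.nat x ≤ m.nat y)

/-- Elementary instructions; register and array names are constants of the program. -/
inductive Instr
  /-- `nat x := c` -/
  | const (x c : ℕ)
  /-- `nat x := nat y` -/
  | copy (x y : ℕ)
  /-- `nat x := nat y + 1` -/
  | succ (x y : ℕ)
  /-- `nat x := nat y - 1` (and `0` if `nat y = 0`) -/
  | pred (x y : ℕ)
  /-- `nat x := arr a [nat y]` -/
  | load (x a y : ℕ)
  /-- `arr a [nat x] := nat y` -/
  | store (a x y : ℕ)
  /-- `nat x :=` a uniformly random integer `v` with `nat y ≤ v < nat z`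
  (and `nat y` if there is none) -/
  | rand (x y z : ℕ)
  /-- `real x := 1` -/
  | rone (x : ℕ)
  /-- `real x := op (real y) (real z)` -/
  | rop (op : ROp) (x y z : ℕ)
  /-- `real x := exp (real y)` -/
  | rexp (x y : ℕ)
  /-- `nat x := 1` if `U < real y` and `nat x := 0` otherwise, for a fresh random number `U`,
  uniformly distributed on `[0, 1]` -/
  | coin (x y : ℕ)

/-- Programs. -/
inductive Prog
  | instr (i : Instr)
  | seq (p q : Prog)
  | ite (t : Test) (p q : Prog)
  | while (t : Test) (p : Prog)

/-- Assignment to an integer register. -/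
def Mem.setNat (m : Mem) (x v : ℕ) : Mem := { m with nat := Function.update m.nat x v }

/-- Assignment to an array cell. -/
def Mem.setArr (m : Mem) (a i v : ℕ) : Mem :=
  { m with arr := Function.update m.arr a (Function.update (m.arr a) i v) }

/-- Assignment to a real register. -/
noncomputable def Mem.setReal (m : Mem) (x : ℕ) (v : ℝ) : Mem :=
  { m with real := Function.update m.real x v }

/-- A uniformly random integer `v` with `a ≤ v < b`, and `a` if there is none. -/
noncomputable def uniformBetween (a b : ℕ) : PMF ℕ :=
  if h : a < b then PMF.uniformOfFinset (Finset.Ico a b) (Finset.nonempty_Ico.2 h) else PMF.pure a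

/-- `1` with probability `p` clamped to `[0, 1]`, and `0` otherwise: the law of the indicator of
`U < p` for `U` uniformly distributed on `[0, 1]`. -/
noncomputable def coinFlip (p : ℝ) : PMF ℕ :=
  (PMF.ofFintype (fun b : Bool => bif b then min (ENNReal.ofReal p) 1
    else 1 - min (ENNReal.ofReal p) 1)
    (by simp)).map fun b => bif b then 1 else 0

/-- The effect of an instruction. -/
noncomputable def Instr.exec (m : Mem) : Instr → PMF Mem
  | .const x c => PMF.pure (m.setNat x c)
  | .copy x y => PMF.pure (m.setNat x (m.nat y))
  | .succ x y => PMF.pure (m.setNat x (m.nat y + 1))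
  | .pred x y => PMF.pure (m.setNat x (m.nat y - 1))
  | .load x a y => PMF.pure (m.setNat x (m.arr a (m.nat y)))
  | .store a x y => PMF.pure (m.setArr a (m.nat x) (m.nat y))
  | .rand x y z => (uniformBetween (m.nat y) (m.nat z)).map (m.setNat x)
  | .rone x => PMF.pure (m.setReal x 1)
  | .rop op x y z => PMF.pure (m.setReal x (op.eval (m.real y) (m.real z)))
  | .rexp x y => PMF.pure (m.setReal x (Real.exp (m.real y)))
  | .coin x y => (coinFlip (m.real y)).map (m.setNat x)

/-- A configuration: the stack of programs still to be executed, the memory, and the number of steps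
executed so far. -/
structure Config where
  todo : List Prog
  mem : Mem
  clock : ℕ

/-- One step of the machine. Every step takes one unit of time: each instruction, each evaluation of
a test, and also each unfolding of a sequence. A configuration with an empty stack has halted. -/
noncomputable def Config.step (c : Config) : PMF Config :=
  match c.todo with
  | [] => PMF.pure c
  | .instr i :: K => (i.exec c.mem).map fun m => ⟨K, m, c.clock + 1⟩
  | .seq p q :: K => PMF.pure ⟨p :: q :: K, c.mem, c.clock + 1⟩
  | .ite t p q :: K => PMF.pure ⟨(if t.holds c.mem then p else q) :: K, c.mem, c.clock + 1⟩
  | .while t p :: K =>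
    PMF.pure ⟨if t.holds c.mem then p :: .while t p :: K else K, c.mem, c.clock + 1⟩

/-- The law of the configuration that is reached after `t` steps. -/
noncomputable def Config.run (c : Config) : ℕ → PMF Config
  | 0 => PMF.pure c
  | t + 1 => (c.run t).bind Config.step

/-- The initial configuration of the program `P` on input `n`, `lam`: the integer register `0` holds
`n`, the real register `0` holds `lam`, and everything else is `0`. -/
noncomputable def Config.init (P : Prog) (n : ℕ) (lam : ℝ) : Config :=
  ⟨[P], ⟨Function.update 0 0 n, 0, Function.update 0 0 lam⟩, 0⟩

/-! ## Reading the output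

Families of lists are stored in two arrays: `off` and `data`; the `i`-th list consists of
`data j` for `off i ≤ j < off (i + 1)`. Graphs are stored as lists of edges in two arrays. -/

/-- The set of the elements of the `i`-th list. -/
def listAt (n : ℕ) (off data : ℕ → ℕ) (i : ℕ) : Finset (Fin n) :=
  Finset.univ.filter fun x => (x : ℕ) ∈ (Finset.Ico (off i) (off (i + 1))).image data

/-- The `i`-th list consists of distinct numbers below `n`. -/
def ListOK (n : ℕ) (off data : ℕ → ℕ) (i : ℕ) : Prop :=
  (∀ j ∈ Finset.Ico (off i) (off (i + 1)), data j < n) ∧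
    Set.InjOn data (Finset.Ico (off i) (off (i + 1)) : Set ℕ)

/-- The graph on `Fin n` with the `e` edges `{a j, b j}`, `j < e`. -/
def edgeListGraph (n e : ℕ) (a b : ℕ → ℕ) : SimpleGraph (Fin n) :=
  SimpleGraph.fromRel fun x y => ∃ j < e, a j = x ∧ b j = y

/-- The host tree in the output: its `n - 1` edges are listed in the arrays `0` and `1`. -/
def Mem.hostTree (m : Mem) (n : ℕ) : SimpleGraph (Fin n) :=
  edgeListGraph n (n - 1) (m.arr 0) (m.arr 1)

/-- The node set of the `i`-th subtree in the output, listed in the arrays `2` and `3`. -/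
def Mem.subtree (m : Mem) (n : ℕ) (i : Fin n) : Finset (Fin n) :=
  listAt n (m.arr 2) (m.arr 3) i

/-- The output is well-formed, and the graph `G` that is generated (the intersection graph of the
subtrees) is represented by a clique tree: the integer register `0` holds the number `q` of its
nodes, the arrays `4` and `5` list the maximal cliques, and the arrays `6` and `7` list
the `q - 1` edges. -/
def Mem.IsOutput (m : Mem) (n : ℕ) : Prop :=
  (∀ i < n, ListOK n (m.arr 2) (m.arr 3) i) ∧
  (∀ a < m.nat 0, ListOK n (m.arr 4) (m.arr 5) a) ∧
  IsCliqueTree (intersectionGraph (m.subtree n))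
    (edgeListGraph (m.nat 0) (m.nat 0 - 1) (m.arr 6) (m.arr 7))
    (fun a => listAt n (m.arr 4) (m.arr 5) a)

/-! ## A program logic for the machine -/

/-! Write `S` for the sum of the sizes of the subtrees. The running time is O(S) because no phase
spends time n on a single subtree.

Sampling. The clamped Poisson number is found by counting up from 1 and stopping at j with the
conditional probability of j given that j is reached. This costs O(k) for the outcome k
(`stopLaw_poissonHazard`). A uniform k-set comes from the first k swaps of a Fisher–Yates shuffle.
Its law does not depend on the initial permutation (`insertRandom_eq_map`, `draws_eq`), so the
permutation left by one subtree serves the next and is never reset. The selected nodes belong to the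
subtree, so both costs are linear in its size.

Connecting. Unprocessed nodes are kept in linked lists by level, and membership in subtree i is
marked by the stamp i + 1, which needs no clearing. Every level visited by the loop holds an
unprocessed node, so the walk through the levels is charged to nodes (`connectProg_spec`).

Clique tree. Parents have smaller numbers than their children. Let the bag B(x) be the set of the i
whose subtree contains x. By the Helly property (`exists_bag_of_isClique`) the maximal cliques are
the inclusion-maximal bags. The nodes are scanned in order. If x has the parent p, an element of
B(x) that occurs in any earlier bag lies in B(p) (`GenInv.mem_bag_parent`). So the clique tree of
the earlier bags changes only at the clique Z that is assigned to p: nothing happens if B(x) ⊆ B(p);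
Z grows to B(x) if Z ⊆ B(x); otherwise B(x) becomes a new leaf at Z (`PartialCliqueTree.skip`,
`PartialCliqueTree.replace`, `PartialCliqueTree.add`). Since B(x) ∩ Z = B(x) ∩ B(p), both inclusions
are decided by cardinalities, and the size of B(x) ∩ B(p) is the number of subtrees containing the
edge xp, which is counted while connecting. Thus a node costs O(1), and n ≤ S since no subtree is
empty. Distinct cliques are bags of distinct nodes, so listing them costs O(S) (`output_spec`).

The program is verified in a logic in continuation-passing style. `Sim` couples the runs of the
machine with an abstract law, which yields the exact distribution, the correctness of the output and
the time bound together. -/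

lemma PMF.bind_congr_support {α β : Type*} (p : PMF α) {f g : α → PMF β}
    (h : ∀ a ∈ p.support, f a = g a) : p.bind f = p.bind g := by
  ext b
  simp only [PMF.bind_apply]
  refine tsum_congr fun a => ?_
  by_cases ha : a ∈ p.support
  · rw [h a ha]
  · rw [PMF.mem_support_iff, not_not] at ha
    rw [ha, zero_mul, zero_mul]

lemma Config.run_succ' (c : Config) (t : ℕ) :
    c.run (t + 1) = c.step.bind fun c' => c'.run t := by
  induction t with
  | zero => simp [Config.run]
  | succ t ih =>
    rw [Config.run, ih, PMF.bind_bind]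
    rfl

/-- An empty stack is absorbing; this allows runs of different lengths to be padded to a common
length. -/
lemma Config.run_halted (m : Mem) (k t : ℕ) :
    (Config.mk [] m k).run t = PMF.pure ⟨[], m, k⟩ := by
  induction t with
  | zero => rfl
  | succ t ih => rw [Config.run, ih, PMF.pure_bind]; rfl

lemma Config.run_add (c : Config) (s t : ℕ) :
    c.run (s + t) = (c.run s).bind fun c' => c'.run t := by
  induction t with
  | zero => simp [Config.run]
  | succ t ih =>
    rw [← Nat.add_assoc, Config.run, ih, PMF.bind_bind]
    rfl

/-- From `c` the machine halts after boundedly many steps, and its final memory and clock can be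
coupled with the law `μ` so that the relation `R` holds almost surely. -/
def Halts {β : Type} (c : Config) (μ : PMF β) (R : β → Mem → ℕ → Prop) : Prop :=
  ∃ (t : ℕ) (ρ : PMF (β × Mem × ℕ)), ρ.map Prod.fst = μ ∧
    c.run t = ρ.map (fun x => ⟨[], x.2.1, x.2.2⟩) ∧ ∀ x ∈ ρ.support, R x.1 x.2.1 x.2.2

lemma Halts.done {β : Type} {b : β} {m : Mem} {t : ℕ} {R : β → Mem → ℕ → Prop} (h : R b m t) :
    Halts ⟨[], m, t⟩ (PMF.pure b) R :=
  ⟨0, PMF.pure (b, m, t), by simp [PMF.pure_map], by simp [PMF.pure_map, Config.run], by simpa⟩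

/-- The branches may need different numbers of steps. Finiteness of the support gives a maximum, the
shorter runs are padded, and the couplings of the branches are glued by `bind`. -/
lemma Halts.random {α β : Type} {c : Config} {ν : PMF α} {f : α → Config} {κ : α → PMF β}
    {R : β → Mem → ℕ → Prop} (hν : ν.support.Finite) (hstep : c.step = ν.map f)
    (h : ∀ a ∈ ν.support, Halts (f a) (κ a) R) : Halts c (ν.bind κ) R := by
  classical
  -- Outside the support nothing is known; an arbitrary coupling is supplied there to make the
  -- choice total.
  have h' : ∀ a, ∃ (t : ℕ) (ρ : PMF (β × Mem × ℕ)), a ∈ ν.support → ρ.map Prod.fst = κ a ∧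
      (f a).run t = ρ.map (fun x => ⟨[], x.2.1, x.2.2⟩) ∧
      ∀ x ∈ ρ.support, R x.1 x.2.1 x.2.2 := by
    intro a
    by_cases ha : a ∈ ν.support
    · obtain ⟨t, ρ, h⟩ := h a ha
      exact ⟨t, ρ, fun _ => h⟩
    · exact ⟨0, (κ a).map fun b => (b, ⟨0, 0, 0⟩, 0), fun h => absurd h ha⟩
  choose t ρ hρ using h'
  obtain ⟨N, hN⟩ : ∃ N, ∀ a ∈ ν.support, t a ≤ N := by
    obtain ⟨N, hN⟩ := (hν.image t).bddAbove
    exact ⟨N, fun a ha => hN ⟨a, ha, rfl⟩⟩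
  refine ⟨N + 1, ν.bind ρ, ?_, ?_, ?_⟩
  · rw [PMF.map_bind]
    exact PMF.bind_congr_support _ fun a ha => (hρ a ha).1
  · rw [Config.run_succ', hstep, PMF.bind_map, PMF.map_bind]
    refine PMF.bind_congr_support _ fun a ha => ?_
    rw [← (hρ a ha).2.1]
    change (f a).run N = _
    obtain ⟨s, rfl⟩ := Nat.exists_eq_add_of_le (hN a ha)
    rw [Config.run_add, (hρ a ha).2.1, PMF.bind_map, PMF.map]
    refine PMF.bind_congr_support _ fun x _ => ?_
    exact Config.run_halted _ _ _
  · intro x hx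
    obtain ⟨a, ha, hx⟩ := (PMF.mem_support_bind_iff _ _ _).1 hx
    exact (hρ a ha).2.2 x hx

lemma Halts.det {β : Type} {c c' : Config} {μ : PMF β} {R : β → Mem → ℕ → Prop}
    (hstep : c.step = PMF.pure c') (h : Halts c' μ R) : Halts c μ R := by
  have := Halts.random (c := c) (ν := PMF.pure ()) (f := fun _ => c') (κ := fun _ => μ) (R := R)
    (by simp) (by rw [hstep, PMF.pure_map]) (fun _ _ => h)
  rwa [PMF.pure_bind] at this

/-- Started with memory `m` and clock `t`, the program `P` simulates the law `μ`: if `a` is the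
outcome of the simulated random variable, then `P` ends with `Q a`. -/
def Sim (P : Prog) {α : Type} (μ : PMF α) (Q : α → Mem → ℕ → Prop) (m : Mem) (t : ℕ) : Prop :=
  ∀ (K : List Prog) (β : Type) (κ : α → PMF β) (R : β → Mem → ℕ → Prop),
    (∀ a m' t', Q a m' t' → Halts ⟨K, m', t'⟩ (κ a) R) → Halts ⟨P :: K, m, t⟩ (μ.bind κ) R

/-- Whatever the random choices, `P` ends with `Q` when started with memory `m` and clock `t`. -/
def WP (P : Prog) (Q : Mem → ℕ → Prop) (m : Mem) (t : ℕ) : Prop :=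
  Sim P (PMF.pure ()) (fun _ => Q) m t

/-! ### Proof rules for sequences, branches and loops -/

section rules

variable {α β : Type} {P P' : Prog} {μ : PMF α} {ν : α → PMF β} {m : Mem} {t : ℕ}

lemma Sim.mono {Q Q' : α → Mem → ℕ → Prop} (h : Sim P μ Q m t)
    (hQ : ∀ a m' t', Q a m' t' → Q' a m' t') : Sim P μ Q' m t :=
  fun K β κ R hK => h K β κ R fun a m' t' ha => hK a m' t' (hQ a m' t' ha)

lemma WP.mono {Q Q' : Mem → ℕ → Prop} (h : WP P Q m t)
    (hQ : ∀ m' t', Q m' t' → Q' m' t') : WP P Q' m t :=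
  Sim.mono h fun _ => hQ

lemma Sim.map {Q : β → Mem → ℕ → Prop} (f : α → β) (h : Sim P μ (fun a => Q (f a)) m t) :
    Sim P (μ.map f) Q m t := by
  intro K γ κ R hK
  rw [PMF.bind_map]
  exact h K γ _ R fun a m' t' ha => hK _ m' t' ha

/-- Since `Sim` quantifies over all continuations, this is associativity of `bind`. -/
lemma Sim.seq {Q' : α → Mem → ℕ → Prop} {Q : β → Mem → ℕ → Prop} (h : Sim P μ Q' m (t + 1))
    (h' : ∀ a m' t', Q' a m' t' → Sim P' (ν a) Q m' t') :
    Sim (.seq P P') (μ.bind ν) Q m t := by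
  intro K γ κ R hK
  refine Halts.det (c' := ⟨P :: P' :: K, m, t + 1⟩) rfl ?_
  rw [PMF.bind_bind]
  exact h _ γ _ R fun a m' t' ha => h' a m' t' ha K γ κ R hK

lemma WP.seq_sim {Q : α → Mem → ℕ → Prop} (h : WP P (Sim P' μ Q) m (t + 1)) :
    Sim (.seq P P') μ Q m t := by
  have := Sim.seq (ν := fun _ => μ) h (fun _ _ _ h => h)
  rwa [PMF.pure_bind] at this

lemma Sim.seq_wp {Q : α → Mem → ℕ → Prop} (h : Sim P μ (fun a => WP P' (Q a)) m (t + 1)) :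
    Sim (.seq P P') μ Q m t := by
  have := Sim.seq (Q := Q) (ν := fun a => PMF.pure a) h (fun a m' t' h K γ κ R hK => by
    have := h K γ (fun _ => κ a) R fun _ m' t' hQ => hK a m' t' hQ
    rwa [PMF.pure_bind] at this ⊢)
  rwa [PMF.bind_pure] at this

lemma WP.seq {Q : Mem → ℕ → Prop} (h : WP P (WP P' Q) m (t + 1)) : WP (.seq P P') Q m t :=
  WP.seq_sim h

lemma Sim.ite {Q : α → Mem → ℕ → Prop} {T : Test}
    (h : T.holds m = true → Sim P μ Q m (t + 1))
    (h' : T.holds m = false → Sim P' μ Q m (t + 1)) : Sim (.ite T P P') μ Q m t := by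
  intro K γ κ R hK
  refine Halts.det (c' := ⟨(if T.holds m then P else P') :: K, m, t + 1⟩) rfl ?_
  cases hT : T.holds m
  · exact h' hT K γ κ R hK
  · exact h hT K γ κ R hK

lemma WP.ite {Q : Mem → ℕ → Prop} {T : Test}
    (h : T.holds m = true → WP P Q m (t + 1))
    (h' : T.holds m = false → WP P' Q m (t + 1)) : WP (.ite T P P') Q m t :=
  Sim.ite h h'

lemma Sim.while_false {Q : α → Mem → ℕ → Prop} {T : Test} {a : α} (hT : T.holds m = false)
    (h : Q a m (t + 1)) : Sim (.while T P) (PMF.pure a) Q m t := by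
  intro K γ κ R hK
  refine Halts.det (c' := ⟨K, m, t + 1⟩) (by simp [Config.step, hT]) ?_
  rw [PMF.pure_bind]
  exact hK _ _ _ h

lemma Sim.while_true {Q' : α → Mem → ℕ → Prop} {Q : β → Mem → ℕ → Prop} {T : Test}
    (hT : T.holds m = true) (h : Sim P μ Q' m (t + 1))
    (h' : ∀ a m' t', Q' a m' t' → Sim (.while T P) (ν a) Q m' t') :
    Sim (.while T P) (μ.bind ν) Q m t := by
  intro K γ κ R hK
  refine Halts.det (c' := ⟨P :: .while T P :: K, m, t + 1⟩) (by simp [Config.step, hT]) ?_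
  rw [PMF.bind_bind]
  exact h _ γ _ R fun a m' t' ha => h' a m' t' ha K γ κ R hK

/-- For loops without a law to track, where only the variant `f` ensures halting. The ghost index
may be any data, such as the lists that the memory encodes. -/
lemma WP.while {ι : Type*} {T : Test} (I : ι → Mem → ℕ → Prop) (f : ι → ℕ)
    {Q : Mem → ℕ → Prop}
    (hI : ∀ i m t, I i m t → T.holds m = true →
      WP P (fun m' t' => ∃ i', f i' < f i ∧ I i' m' t') m (t + 1))
    (hQ : ∀ i m t, I i m t → T.holds m = false → Q m (t + 1)) {i : ι} (h : I i m t) :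
    WP (.while T P) Q m t := by
  induction hf : f i using Nat.strong_induction_on generalizing i m t with
  | _ k ih =>
    cases hT : T.holds m
    · exact Sim.while_false hT (hQ i m t h hT)
    · have := Sim.while_true (P := P) (ν := fun _ => PMF.pure ()) (Q := fun _ => Q) hT
        (hI i m t h hT) (fun _ m' t' ⟨i', hi', h'⟩ => ih (f i') (hf ▸ hi') h' rfl)
      rwa [PMF.pure_bind] at this

/-- For loops with a known number of rounds that build a random object whose type may change with
the round, such as a tree on `j + 1` nodes. -/
lemma Sim.iterate {A : ℕ → Type} {T : Test} (μ : ∀ j, PMF (A j)) (ν : ∀ j, A j → PMF (A (j + 1)))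
    (hμ : ∀ j, μ (j + 1) = (μ j).bind (ν j)) (I : ∀ j, A j → Mem → ℕ → Prop) (N : ℕ)
    {Q : A N → Mem → ℕ → Prop}
    (hI : ∀ j < N, ∀ a m t, I j a m t → T.holds m = true ∧ Sim P (ν j a) (I (j + 1)) m (t + 1))
    (hQ : ∀ a m t, I N a m t → T.holds m = false ∧ Q a m (t + 1))
    {a₀ : A 0} (h0 : μ 0 = PMF.pure a₀) (h : I 0 a₀ m t) : Sim (.while T P) (μ N) Q m t := by
  intro K γ κ R hK
  -- With `κ` general, the law of the last round is absorbed into the continuation. So rounds are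
  -- peeled off from the end, as in the recursion `hμ`.
  have key : ∀ j ≤ N, ∀ κ : A j → PMF γ,
      (∀ a m' t', I j a m' t' → Halts ⟨.while T P :: K, m', t'⟩ (κ a) R) →
      Halts ⟨.while T P :: K, m, t⟩ ((μ j).bind κ) R := by
    intro j
    induction j with
    | zero =>
      intro _ κ hκ
      rw [h0, PMF.pure_bind]
      exact hκ _ _ _ h
    | succ j ih =>
      intro hj κ hκ
      rw [hμ, PMF.bind_bind]
      refine ih (by omega) _ fun a m' t' ha => ?_
      obtain ⟨hT, hS⟩ := hI j (by omega) a m' t' ha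
      refine Halts.det (c' := ⟨P :: .while T P :: K, m', t' + 1⟩) (by simp [Config.step, hT]) ?_
      exact hS _ γ κ R hκ
  refine key N le_rfl κ fun a m' t' ha => ?_
  obtain ⟨hT, hS⟩ := hQ a m' t' ha
  exact Halts.det (c' := ⟨K, m', t' + 1⟩) (by simp [Config.step, hT]) (hK _ _ _ hS)

end rules

/-! ### Instructions -/

lemma uniformBetween_support_finite (a b : ℕ) : (uniformBetween a b).support.Finite := by
  unfold uniformBetween
  split_ifs with h
  · rw [PMF.support_uniformOfFinset]; exact Finset.finite_toSet _
  · simp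

lemma coinFlip_support_finite (p : ℝ) : (coinFlip p).support.Finite := by
  unfold coinFlip
  rw [PMF.support_map]
  exact (Set.toFinite _).image _

lemma Sim.rand (x y z : ℕ) (m : Mem) (t : ℕ) :
    Sim (.instr (.rand x y z)) (uniformBetween (m.nat y) (m.nat z))
      (fun v m' t' => v ∈ (uniformBetween (m.nat y) (m.nat z)).support ∧
        m' = m.setNat x v ∧ t' = t + 1) m t := by
  intro K γ κ R hK
  refine Halts.random (f := fun v => ⟨K, m.setNat x v, t + 1⟩)
    (uniformBetween_support_finite _ _) ?_ fun v hv => hK _ _ _ ⟨hv, rfl, rfl⟩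
  simp only [Config.step, Instr.exec, PMF.map_comp]
  rfl

lemma Sim.coin (x y : ℕ) (m : Mem) (t : ℕ) :
    Sim (.instr (.coin x y)) (coinFlip (m.real y))
      (fun v m' t' => m' = m.setNat x v ∧ t' = t + 1) m t := by
  intro K γ κ R hK
  refine Halts.random (f := fun v => ⟨K, m.setNat x v, t + 1⟩)
    (coinFlip_support_finite _) ?_ fun v hv => hK _ _ _ ⟨rfl, rfl⟩
  simp only [Config.step, Instr.exec, PMF.map_comp]
  rfl

/-- The effect of a deterministic instruction (`none` for the random ones). -/
noncomputable def Instr.act (m : Mem) : Instr → Option Mem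
  | .const x c => some (m.setNat x c)
  | .copy x y => some (m.setNat x (m.nat y))
  | .succ x y => some (m.setNat x (m.nat y + 1))
  | .pred x y => some (m.setNat x (m.nat y - 1))
  | .load x a y => some (m.setNat x (m.arr a (m.nat y)))
  | .store a x y => some (m.setArr a (m.nat x) (m.nat y))
  | .rone x => some (m.setReal x 1)
  | .rop op x y z => some (m.setReal x (op.eval (m.real y) (m.real z)))
  | .rexp x y => some (m.setReal x (Real.exp (m.real y)))
  | .rand _ _ _ => none
  | .coin _ _ => none

lemma Sim.of_wp {α : Type} {P : Prog} {a : α} {Q : α → Mem → ℕ → Prop} {m : Mem} {t : ℕ}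
    (h : WP P (Q a) m t) : Sim P (PMF.pure a) Q m t := by
  intro K γ κ R hK
  have := h K γ (fun _ => κ a) R fun _ m' t' hQ => hK a m' t' hQ
  rwa [PMF.pure_bind] at this ⊢

/-- A straight-line program. -/
def block : List Instr → Prog
  -- Copying a register to itself changes nothing. It costs the final `t + 1` in `After`; each
  -- listed instruction costs two steps, one of them for `seq`.
  | [] => .instr (.copy 0 0)
  | i :: l => .seq (.instr i) (block l)

/-- The property `Q` holds after the straight-line program given by a list of deterministic
instructions. -/
def After (Q : Mem → ℕ → Prop) : List Instr → Mem → ℕ → Prop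
  | [], m, t => Q m (t + 1)
  | i :: l, m, t => ∃ m', i.act m = some m' ∧ After Q l m' (t + 2)

lemma Instr.exec_of_act {m m' : Mem} {i : Instr} (h : i.act m = some m') :
    i.exec m = PMF.pure m' := by
  cases i <;> simp_all [Instr.act, Instr.exec]

lemma WP.instr {m m' : Mem} {t : ℕ} {i : Instr} {Q : Mem → ℕ → Prop} (h : i.act m = some m')
    (hQ : Q m' (t + 1)) : WP (.instr i) Q m t := by
  intro K γ κ R hK
  rw [PMF.pure_bind]
  refine Halts.det (c' := ⟨K, m', t + 1⟩) ?_ (hK _ _ _ hQ)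
  simp [Config.step, Instr.exec_of_act h, PMF.pure_map]

lemma WP.block {Q : Mem → ℕ → Prop} {l : List Instr} {m : Mem} {t : ℕ} (h : After Q l m t) :
    WP (block l) Q m t := by
  induction l generalizing m t with
  | nil =>
    refine WP.instr (m' := m) ?_ h
    simp [Instr.act, Mem.setNat]
  | cons i l ih =>
    obtain ⟨m', hm, h⟩ := h
    exact WP.seq (WP.instr hm (ih h))

/-! ### Symbolic execution of straight-line code -/

section after

variable (Q : Mem → ℕ → Prop) (l : List Instr) (m : Mem) (t : ℕ)

@[simp]
lemma after_nil : After Q [] m t ↔ Q m (t + 1) := Iff.rfl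

@[simp]
lemma after_const (x c : ℕ) :
    After Q (.const x c :: l) m t ↔ After Q l (m.setNat x c) (t + 2) := by
  simp [After, Instr.act]

@[simp]
lemma after_copy (x y : ℕ) :
    After Q (.copy x y :: l) m t ↔ After Q l (m.setNat x (m.nat y)) (t + 2) := by
  simp [After, Instr.act]

@[simp]
lemma after_succ (x y : ℕ) :
    After Q (.succ x y :: l) m t ↔ After Q l (m.setNat x (m.nat y + 1)) (t + 2) := by
  simp [After, Instr.act]

@[simp]
lemma after_pred (x y : ℕ) :
    After Q (.pred x y :: l) m t ↔ After Q l (m.setNat x (m.nat y - 1)) (t + 2) := by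
  simp [After, Instr.act]

@[simp]
lemma after_load (x a y : ℕ) :
    After Q (.load x a y :: l) m t ↔ After Q l (m.setNat x (m.arr a (m.nat y))) (t + 2) := by
  simp [After, Instr.act]

@[simp]
lemma after_store (a x y : ℕ) :
    After Q (.store a x y :: l) m t ↔ After Q l (m.setArr a (m.nat x) (m.nat y)) (t + 2) := by
  simp [After, Instr.act]

@[simp]
lemma after_rone (x : ℕ) :
    After Q (.rone x :: l) m t ↔ After Q l (m.setReal x 1) (t + 2) := by
  simp [After, Instr.act]

@[simp]
lemma after_rop (op : ROp) (x y z : ℕ) :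
    After Q (.rop op x y z :: l) m t ↔
      After Q l (m.setReal x (op.eval (m.real y) (m.real z))) (t + 2) := by
  simp [After, Instr.act]

@[simp]
lemma after_rexp (x y : ℕ) :
    After Q (.rexp x y :: l) m t ↔ After Q l (m.setReal x (Real.exp (m.real y))) (t + 2) := by
  simp [After, Instr.act]

end after

/-! ### Reading the memory after an assignment -/

namespace Mem

variable (m : Mem) (x y a b i v : ℕ) (r : ℝ)

@[simp]
lemma setNat_nat : (m.setNat x v).nat x = v := by simp [setNat]

@[simp]
lemma setNat_nat_of_ne (h : y ≠ x) : (m.setNat x v).nat y = m.nat y := by simp [setNat, h]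

@[simp]
lemma setNat_arr : (m.setNat x v).arr = m.arr := rfl

@[simp]
lemma setNat_real : (m.setNat x v).real = m.real := rfl

@[simp]
lemma setArr_nat : (m.setArr a i v).nat = m.nat := rfl

@[simp]
lemma setArr_arr : (m.setArr a i v).arr a = Function.update (m.arr a) i v := by simp [setArr]

@[simp]
lemma setArr_arr_of_ne (h : b ≠ a) : (m.setArr a i v).arr b = m.arr b := by simp [setArr, h]

@[simp]
lemma setArr_real : (m.setArr a i v).real = m.real := rfl

@[simp]
lemma setReal_nat : (m.setReal x r).nat = m.nat := rfl

@[simp]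
lemma setReal_arr : (m.setReal x r).arr = m.arr := rfl

@[simp]
lemma setReal_real : (m.setReal x r).real x = r := by simp [setReal]

@[simp]
lemma setReal_real_of_ne (h : y ≠ x) : (m.setReal x r).real y = m.real y := by simp [setReal, h]

end Mem

/-! ## Trees given by parents -/

/-- Edge number `j` joins `j + 1` to its parent `b j`, so the parent of `x ≠ 0` is `b (x - 1)`.
Parents are smaller, hence no listed edge is a loop. -/
lemma edgeListGraph_adj {q : ℕ} {a b : ℕ → ℕ} (ha : ∀ j < q - 1, a j = j + 1)
    (hb : ∀ j < q - 1, b j ≤ j) (x y : Fin q) :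
    (edgeListGraph q (q - 1) a b).Adj x y ↔
      ((x : ℕ) ≠ 0 ∧ b (x - 1) = y) ∨ ((y : ℕ) ≠ 0 ∧ b (y - 1) = x) := by
  have key : ∀ x y : Fin q, (∃ j < q - 1, a j = x ∧ b j = y) ↔ ((x : ℕ) ≠ 0 ∧ b (x - 1) = y) := by
    intro x y
    have hx := x.2
    constructor
    · rintro ⟨j, hj, hja, hjb⟩
      rw [ha j hj] at hja
      have : (x : ℕ) - 1 = j := by omega
      exact ⟨by omega, by rw [this, hjb]⟩
    · rintro ⟨h0, h⟩
      exact ⟨x - 1, by omega, by rw [ha _ (by omega)]; omega, h⟩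
  rw [edgeListGraph, SimpleGraph.fromRel_adj, key, key]
  refine and_iff_right_of_imp ?_
  rintro h rfl
  have hx := x.2
  have : (x : ℕ) ≠ 0 ∧ b (x - 1) = x := by tauto
  have := hb (x - 1) (by omega)
  omega

/-- A set of nodes that, with each of its nodes except the first one, contains the parent. -/
def IsSubtree (par : ℕ → ℕ) (A : Set ℕ) : Prop :=
  ∀ x ∈ A, ∀ y ∈ A, y < x → par x ∈ A

/-- Following parents from a node of `A` stays in `A` and decreases until the least node of `A` is
reached. -/
lemma connected_induce_of_isSubtree {q : ℕ} {a b : ℕ → ℕ} (ha : ∀ j < q - 1, a j = j + 1)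
    (hb : ∀ j < q - 1, b j ≤ j) {A : Set ℕ} (hA : IsSubtree (fun x => b (x - 1)) A)
    (hne : ∃ x : Fin q, (x : ℕ) ∈ A) :
    ((edgeListGraph q (q - 1) a b).induce {x : Fin q | (x : ℕ) ∈ A}).Connected := by
  classical
  have hex : ∃ x, x < q ∧ x ∈ A := by
    obtain ⟨x, hx⟩ := hne
    exact ⟨x, x.2, hx⟩
  obtain ⟨hrq, hrA⟩ := Nat.find_spec hex
  set r := Nat.find hex with hr
  have key : ∀ x (hx : x < q) (hxA : x ∈ A),
      ((edgeListGraph q (q - 1) a b).induce {x : Fin q | (x : ℕ) ∈ A}).Reachable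
        ⟨⟨x, hx⟩, hxA⟩ ⟨⟨r, hrq⟩, hrA⟩ := by
    intro x
    induction x using Nat.strong_induction_on with
    | _ x ih =>
      intro hx hxA
      have hrx : r ≤ x := Nat.find_min' hex ⟨hx, hxA⟩
      rcases hrx.eq_or_lt with rfl | hlt
      · rfl
      · have hp := hA x hxA r hrA hlt
        have hle := hb (x - 1) (by omega)
        refine SimpleGraph.Reachable.trans (SimpleGraph.Adj.reachable ?_)
          (ih (b (x - 1)) (by omega) (by omega) hp)
        rw [SimpleGraph.comap_adj]
        exact (edgeListGraph_adj ha hb _ _).2 (Or.inl ⟨by simp; omega, rfl⟩)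
  have : Nonempty {x : Fin q | (x : ℕ) ∈ A} := ⟨⟨⟨r, hrq⟩, hrA⟩⟩
  refine ⟨fun u v => ?_⟩
  exact (key u.1 u.1.2 u.2).trans (key v.1 v.1.2 v.2).symm

/-- The graph is connected, by the preceding lemma for the set of all nodes, and it has at most `q -
1` edges. -/
lemma edgeListGraph_isTree {q : ℕ} (hq : 0 < q) {a b : ℕ → ℕ} (ha : ∀ j < q - 1, a j = j + 1)
    (hb : ∀ j < q - 1, b j ≤ j) : (edgeListGraph q (q - 1) a b).IsTree := by
  classical
  have hc : (edgeListGraph q (q - 1) a b).Connected := by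
    have h := connected_induce_of_isSubtree ha hb (A := Set.univ) (fun _ _ _ _ _ => trivial)
      ⟨⟨0, hq⟩, trivial⟩
    have : Nonempty (Fin q) := ⟨⟨0, hq⟩⟩
    refine ⟨fun x y => ?_⟩
    exact (h.preconnected ⟨x, trivial⟩ ⟨y, trivial⟩).map (SimpleGraph.Embedding.induce _).toHom
  rw [SimpleGraph.isTree_iff_connected_and_card]
  refine ⟨hc, le_antisymm ?_ ?_⟩
  -- The loop at `0` is a filler for indices out of range; only an upper bound on the size of the
  -- image is needed.
  · have hsub : (edgeListGraph q (q - 1) a b).edgeSet ⊆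
        (fun j : ℕ => if h : j + 1 < q ∧ b j < q then
          s((⟨j + 1, h.1⟩ : Fin q), ⟨b j, h.2⟩) else s(⟨0, hq⟩, ⟨0, hq⟩)) ''
          (Finset.range (q - 1) : Set ℕ) := by
      intro e
      induction e using Sym2.ind with
      | _ x y =>
        rw [SimpleGraph.mem_edgeSet, edgeListGraph_adj ha hb]
        have key : ∀ x y : Fin q, (x : ℕ) ≠ 0 → b (x - 1) = y → s(x, y) ∈
          (fun j : ℕ => if h : j + 1 < q ∧ b j < q then
            s((⟨j + 1, h.1⟩ : Fin q), ⟨b j, h.2⟩) else s(⟨0, hq⟩, ⟨0, hq⟩)) ''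
          (Finset.range (q - 1) : Set ℕ) := by
          intro x y hx hy
          have hx2 := x.2
          have hy2 := y.2
          refine ⟨x - 1, by simp; omega, ?_⟩
          have h1 : (x : ℕ) - 1 + 1 = x := by omega
          simp only [h1, hy]
          simp
        rintro (⟨h1, h2⟩ | ⟨h1, h2⟩)
        · exact key x y h1 h2
        · exact (Sym2.eq_swap : s(y, x) = s(x, y)) ▸ key y x h1 h2
    have h1 := Set.ncard_le_ncard hsub ((Finset.finite_toSet _).image _)
    have h2 := h1.trans (Set.ncard_image_le (Finset.finite_toSet _))
    rw [Set.ncard_coe_finset, Finset.card_range] at h2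
    rw [Nat.card_coe_set_eq, Nat.card_fin]
    omega
  · exact hc.card_vert_le_card_edgeSet_add_one

/-! ## Incremental construction of the clique tree -/

/-- The clique tree of the bags of the nodes below `x`: it has `q` nodes, `cls` maps each node to
the clique that contains its bag, `bot` maps each clique to a node with this bag, and `cp j` is the
parent of the clique `j + 1`. -/
structure PartialCliqueTree {V : Type} (B : ℕ → Finset V) (x q : ℕ) (cls bot cp : ℕ → ℕ) :
    Prop where
  cls_lt : ∀ y < x, cls y < q
  subset : ∀ y < x, B y ⊆ B (bot (cls y))
  bot_lt : ∀ a < q, bot a < x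
  antichain : ∀ a < q, ∀ b < q, B (bot a) ⊆ B (bot b) → a = b
  cp_le : ∀ j < q - 1, cp j ≤ j
  isSubtree : ∀ v, IsSubtree (fun a => cp (a - 1)) {a | a < q ∧ v ∈ B (bot a)}
  pos : 0 < q

/-! ### Extending a partial clique tree by one node -/

section

variable {V : Type} {B : ℕ → Finset V} {x q p : ℕ} {cls bot cp : ℕ → ℕ}

lemma partialCliqueTree_one (h1 : cls 0 = 0) (h2 : bot 0 = 0) :
    PartialCliqueTree B 1 1 cls bot cp where
  cls_lt y hy := by obtain rfl : y = 0 := by omega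
                    omega
  subset y hy := by obtain rfl : y = 0 := by omega
                    rw [h1, h2]
  bot_lt a ha := by obtain rfl : a = 0 := by omega
                    omega
  antichain a ha b hb _ := by omega
  cp_le j hj := by omega
  isSubtree v a ha b hb hab := by
    have := ha.1
    omega
  pos := by omega

lemma PartialCliqueTree.skip (h : PartialCliqueTree B x q cls bot cp) (hp : p < x)
    (hsub : B x ⊆ B p) :
    PartialCliqueTree B (x + 1) q (Function.update cls x (cls p)) bot cp where
  cls_lt y hy := by
    rcases Nat.lt_succ_iff_lt_or_eq.1 hy with hy | rfl
    · rw [Function.update_of_ne hy.ne]; exact h.cls_lt y hy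
    · rw [Function.update_self]; exact h.cls_lt p hp
  subset y hy := by
    rcases Nat.lt_succ_iff_lt_or_eq.1 hy with hy | rfl
    · rw [Function.update_of_ne hy.ne]; exact h.subset y hy
    · rw [Function.update_self]; exact hsub.trans (h.subset p hp)
  bot_lt a ha := (h.bot_lt a ha).trans (Nat.lt_succ_self x)
  antichain := h.antichain
  cp_le := h.cp_le
  isSubtree := h.isSubtree
  pos := h.pos

/-- The node `x` takes over as representative of the clique of `p`, and the tree keeps its shape. By
`hint`, the elements that this clique gains occur in no other clique, so connectivity is not
affected. -/
lemma PartialCliqueTree.replace (h : PartialCliqueTree B x q cls bot cp) (hp : p < x)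
    (hint : ∀ y < x, ∀ v, v ∈ B y → v ∈ B x → v ∈ B p)
    (hnot : ¬ B x ⊆ B p) (hsub : B (bot (cls p)) ⊆ B x) :
    PartialCliqueTree B (x + 1) q (Function.update cls x (cls p))
      (Function.update bot (cls p) x) cp := by
  have hpq := h.cls_lt p hp
  have hmem : ∀ b < q, ∀ v, v ∈ B (bot b) → v ∈ B x → v ∈ B (bot (cls p)) := fun b hb v h1 h2 =>
    h.subset p hp (hint _ (h.bot_lt b hb) v h1 h2)
  refine ⟨fun y hy => ?_, fun y hy => ?_, fun a ha => ?_, fun a ha b hb hab => ?_, h.cp_le,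
    fun v a ha b hb hab => ?_, h.pos⟩
  · rcases Nat.lt_succ_iff_lt_or_eq.1 hy with hy | rfl
    · rw [Function.update_of_ne hy.ne]; exact h.cls_lt y hy
    · rw [Function.update_self]; exact h.cls_lt p hp
  · have h1 : Function.update cls x (cls p) y = cls y ∧ y < x ∨
        Function.update cls x (cls p) y = cls p ∧ y = x := by
      rcases Nat.lt_succ_iff_lt_or_eq.1 hy with hy | rfl
      · left; rw [Function.update_of_ne hy.ne]; exact ⟨rfl, hy⟩
      · right; rw [Function.update_self]; exact ⟨rfl, rfl⟩
    rcases h1 with ⟨h1, h2⟩ | ⟨h1, rfl⟩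
    · rw [h1]
      by_cases hc : cls y = cls p
      · rw [hc, Function.update_self]
        exact (hc ▸ h.subset y h2).trans hsub
      · rw [Function.update_of_ne hc]; exact h.subset y h2
    · rw [h1, Function.update_self]
  · by_cases hc : a = cls p
    · rw [hc, Function.update_self]; omega
    · rw [Function.update_of_ne hc]; exact (h.bot_lt a ha).trans (Nat.lt_succ_self x)
  · by_cases hc : a = cls p <;> by_cases hd : b = cls p
    · rw [hc, hd]
    -- If the new bag were inside another clique, `hint` would put it inside the bag of `p`.
    · rw [hc, Function.update_self, Function.update_of_ne hd] at hab
      exact absurd (fun v hv => hint _ (h.bot_lt b hb) v (hab hv) hv) hnot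
    · rw [hd, Function.update_self, Function.update_of_ne hc] at hab
      rw [hd]
      exact h.antichain a ha _ hpq fun v hv => hmem a ha v hv (hab hv)
    · rw [Function.update_of_ne hc, Function.update_of_ne hd] at hab
      exact h.antichain a ha b hb hab
  · have key : ∀ c, c < q → v ∈ B (Function.update bot (cls p) x c) →
        c = cls p ∨ v ∈ B (bot c) := by
      intro c _ hc
      by_cases hd : c = cls p
      · exact Or.inl hd
      · rw [Function.update_of_ne hd] at hc; exact Or.inr hc
    have up : ∀ c, v ∈ B (bot c) → v ∈ B (Function.update bot (cls p) x c) := by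
      intro c hc
      by_cases hd : c = cls p
      · rw [hd, Function.update_self]; rw [hd] at hc; exact hsub hc
      · rwa [Function.update_of_ne hd]
    -- An element of two cliques after the replacement was in both of them before.
    have gen : ∀ c, c < q → v ∈ B (Function.update bot (cls p) x c) → ∀ c' < q,
        v ∈ B (Function.update bot (cls p) x c') → c ≠ c' → v ∈ B (bot c) := by
      intro c hc hvc c' hc' hvc' hne
      by_cases hd : c = cls p
      · rw [hd, Function.update_self] at hvc
        have hd' : c' ≠ cls p := fun h => hne (hd.trans h.symm)
        rw [Function.update_of_ne hd'] at hvc'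
        rw [hd]
        exact hmem c' hc' v hvc' hvc
      · rwa [Function.update_of_ne hd] at hvc
    have := h.isSubtree v a ⟨ha.1, gen a ha.1 ha.2 b hb.1 hb.2 hab.ne'⟩ b
      ⟨hb.1, gen b hb.1 hb.2 a ha.1 ha.2 hab.ne⟩ hab
    exact ⟨this.1, up _ this.2⟩

/-- By `hint`, an inclusion between the new bag and any earlier clique would imply one of those
excluded by `hnot` and `hnot'`. The new leaf hangs at the clique of `p`, which contains all that the
new bag shares with earlier ones. The parent of clique `q` is stored at index `q - 1`. -/
lemma PartialCliqueTree.add (h : PartialCliqueTree B x q cls bot cp) (hp : p < x)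
    (hint : ∀ y < x, ∀ v, v ∈ B y → v ∈ B x → v ∈ B p)
    (hnot : ¬ B x ⊆ B p) (hnot' : ¬ B (bot (cls p)) ⊆ B x) :
    PartialCliqueTree B (x + 1) (q + 1) (Function.update cls x q)
      (Function.update bot q x) (Function.update cp (q - 1) (cls p)) := by
  have hpq := h.cls_lt p hp
  have hq := h.pos
  have hmem : ∀ b < q, ∀ v, v ∈ B (bot b) → v ∈ B x → v ∈ B p := fun b hb v h1 h2 =>
    hint _ (h.bot_lt b hb) v h1 h2
  refine ⟨fun y hy => ?_, fun y hy => ?_, fun a ha => ?_, fun a ha b hb hab => ?_,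
    fun j hj => ?_, fun v a ha b hb hab => ?_, by omega⟩
  · rcases Nat.lt_succ_iff_lt_or_eq.1 hy with hy | rfl
    · rw [Function.update_of_ne hy.ne]; have := h.cls_lt y hy; omega
    · rw [Function.update_self]; omega
  · rcases Nat.lt_succ_iff_lt_or_eq.1 hy with hy | rfl
    · rw [Function.update_of_ne hy.ne, Function.update_of_ne (h.cls_lt y hy).ne]
      exact h.subset y hy
    · rw [Function.update_self, Function.update_self]
  · rcases Nat.lt_succ_iff_lt_or_eq.1 ha with ha | rfl
    · rw [Function.update_of_ne ha.ne]; have := h.bot_lt a ha; omega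
    · rw [Function.update_self]; omega
  · rcases Nat.lt_succ_iff_lt_or_eq.1 ha with ha | rfl <;>
      rcases Nat.lt_succ_iff_lt_or_eq.1 hb with hb | rfl
    · rw [Function.update_of_ne ha.ne, Function.update_of_ne hb.ne] at hab
      exact h.antichain a ha b hb hab
    · rw [Function.update_of_ne ha.ne, Function.update_self] at hab
      have h1 : B (bot a) ⊆ B (bot (cls p)) := fun v hv =>
        h.subset p hp (hmem a ha v hv (hab hv))
      have := h.antichain a ha _ hpq h1
      rw [this] at hab
      exact absurd hab hnot'
    · rw [Function.update_of_ne hb.ne, Function.update_self] at hab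
      exact absurd (fun v hv => hmem b hb v (hab hv) hv) hnot
    · rfl
  · by_cases hc : j = q - 1
    · rw [hc, Function.update_self]; omega
    · rw [Function.update_of_ne hc]; exact h.cp_le j (by omega)
  · obtain ⟨ha, hva⟩ := ha
    obtain ⟨hb, hvb⟩ := hb
    have hbq : b < q := by omega
    rw [Function.update_of_ne hbq.ne] at hvb
    rcases Nat.lt_succ_iff_lt_or_eq.1 ha with ha | rfl
    · rw [Function.update_of_ne ha.ne] at hva
      have := h.isSubtree v a ⟨ha, hva⟩ b ⟨hbq, hvb⟩ hab
      have hne : a - 1 ≠ q - 1 := by omega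
      simp only [Set.mem_ofPred_eq, Function.update_of_ne hne]
      rw [Function.update_of_ne (by have := this.1; exact this.ne)]
      exact ⟨this.1.trans (Nat.lt_succ_self q), this.2⟩
    · rw [Function.update_self] at hva
      simp only [Set.mem_ofPred_eq, Function.update_self]
      rw [Function.update_of_ne hpq.ne]
      exact ⟨by omega, h.subset p hp (hmem b hbq v hvb hva)⟩

end

/-- The Helly property. -/
lemma exists_bag_of_isClique {n : ℕ} [NeZero n] {par : ℕ → ℕ} {F : Fin n → Finset (Fin n)}
    (hpar : ∀ x < n, x ≠ 0 → par x < x) (hF : ∀ i, IsSubtree par {x | ∃ y ∈ F i, (y : ℕ) = x})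
    (hne : ∀ i, (F i).Nonempty) {S : Finset (Fin n)} (hS : (intersectionGraph F).IsClique S) :
    ∃ x : Fin n, ∀ i ∈ S, x ∈ F i := by
  rcases S.eq_empty_or_nonempty with rfl | hSne
  · exact ⟨0, by simp⟩
  -- Among the sets of the clique, take the one whose least node is largest; this node is common to
  -- all.
  obtain ⟨i₀, hi₀, hmax⟩ := S.exists_max_image (fun i => (F i).min' (hne i)) hSne
  refine ⟨(F i₀).min' (hne i₀), fun j hj => ?_⟩
  have hint : (F i₀ ∩ F j).Nonempty := by
    by_cases hij : i₀ = j
    · subst hij; simpa using hne i₀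
    · exact (hS hi₀ hj hij).2
  obtain ⟨h1, h2⟩ := Finset.mem_inter.1 ((F i₀ ∩ F j).min'_mem hint)
  -- If the least common node `y` were not the least node of `F i₀`, both sets would contain a node
  -- below `y`. Then both would contain the parent of `y`, a smaller common node.
  set y := (F i₀ ∩ F j).min' hint with hy
  have hle : (F i₀).min' (hne i₀) ≤ y := Finset.min'_le _ _ h1
  rcases hle.eq_or_lt with h | hlt
  · rw [h]; exact h2
  · exfalso
    have hlt' : (F j).min' (hne j) < y := (hmax j hj).trans_lt hlt
    obtain ⟨z, hz, hzy⟩ := hF i₀ y ⟨y, h1, rfl⟩ _ ⟨_, (F i₀).min'_mem _, rfl⟩ hlt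
    obtain ⟨z', hz', hzy'⟩ := hF j y ⟨y, h2, rfl⟩ _ ⟨_, (F j).min'_mem _, rfl⟩ hlt'
    obtain rfl : z = z' := Fin.ext (hzy.trans hzy'.symm)
    have hyz : y ≤ z := Finset.min'_le _ _ (Finset.mem_inter.2 ⟨hz, hz'⟩)
    have := hpar y y.2 (by have : (_ : ℕ) < y := hlt; omega)
    have : (y : ℕ) ≤ z := hyz
    omega

/-- Each clique lies in a bag by the Helly property, and each bag lies in a listed one. The listed
bags are cliques and form an antichain, so they are exactly the maximal cliques. -/
lemma PartialCliqueTree.isCliqueTree {n q : ℕ} [NeZero n] {par : ℕ → ℕ} {F : Fin n → Finset (Fin n)}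
    (hpar : ∀ x < n, x ≠ 0 → par x < x) (hF : ∀ i, IsSubtree par {x | ∃ y ∈ F i, (y : ℕ) = x})
    (hne : ∀ i, (F i).Nonempty) {B : ℕ → Finset (Fin n)}
    (hB : ∀ (x : Fin n) i, i ∈ B x ↔ x ∈ F i) {cls bot a b : ℕ → ℕ}
    (h : PartialCliqueTree B n q cls bot b) (ha : ∀ j < q - 1, a j = j + 1) :
    IsCliqueTree (intersectionGraph F) (edgeListGraph q (q - 1) a b) (fun k => B (bot k)) where
  isTree := edgeListGraph_isTree h.pos ha h.cp_le
  injective k l hkl := Fin.ext (h.antichain k k.2 l l.2 hkl.subset)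
  range_eq S := by
    have hcover : ∀ S : Finset (Fin n), (intersectionGraph F).IsClique S →
        ∃ k < q, S ⊆ B (bot k) := by
      intro S hS
      obtain ⟨x, hx⟩ := exists_bag_of_isClique hpar hF hne hS
      exact ⟨cls x, h.cls_lt x x.2, fun i hi => h.subset x x.2 ((hB x i).2 (hx i hi))⟩
    have hclique : ∀ k < q, (intersectionGraph F).IsClique (B (bot k) : Set (Fin n)) := by
      intro k hk i hi j hj hij
      have hx := h.bot_lt k hk
      have hi' := (hB ⟨bot k, hx⟩ i).1 hi
      have hj' := (hB ⟨bot k, hx⟩ j).1 hj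
      exact ⟨hij, ⟨⟨bot k, hx⟩, Finset.mem_inter.2 ⟨hi', hj'⟩⟩⟩
    constructor
    · rintro ⟨k, rfl⟩
      refine ⟨hclique k k.2, fun S' hS' hle => ?_⟩
      have hfin : S'.Finite := Set.toFinite _
      obtain ⟨l, hl, hsub⟩ := hcover hfin.toFinset (by simpa using hS')
      have : (k : ℕ) = l := h.antichain k k.2 l hl fun v hv => hsub (by simpa using hle hv)
      intro v hv
      change v ∈ B (bot k)
      rw [this]
      exact hsub (by simpa using hv)
    · intro hS
      obtain ⟨k, hk, hsub⟩ := hcover S hS.prop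
      refine ⟨⟨k, hk⟩, ?_⟩
      have := hS.eq_of_subset (hclique k hk) (by exact_mod_cast hsub)
      exact_mod_cast this.symm
  connected v := by
    have hv : ∃ k : Fin q, (k : ℕ) ∈ {a | a < q ∧ v ∈ B (bot a)} := by
      obtain ⟨x, hx⟩ := hne v
      exact ⟨⟨cls x, h.cls_lt x x.2⟩, h.cls_lt x x.2, h.subset x x.2 ((hB x v).2 hx)⟩
    have := connected_induce_of_isSubtree ha h.cp_le (h.isSubtree v) hv
    have heq : {a : Fin q | v ∈ B (bot a)} = {x : Fin q | (x : ℕ) ∈ {a | a < q ∧ v ∈ B (bot a)}} := by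
      ext k
      exact ⟨fun hk => ⟨k.2, hk⟩, fun hk => hk.2⟩
    rwa [← heq] at this

/-! ## Laws -/

/-- The total mass 1 determines the remaining value. This spares computing the probability of the
value at which a law is truncated. -/
lemma PMF.ext_of_ne {α : Type*} {p q : PMF α} (a : α) (h : ∀ b, b ≠ a → p b = q b) : p = q := by
  classical
  ext b
  by_cases hb : b = a
  · subst hb
    have hp := p.tsum_coe
    have hq := q.tsum_coe
    rw [ENNReal.tsum_eq_add_tsum_ite b] at hp hq
    have hs : (∑' x, if x = b then 0 else p x) = ∑' x, if x = b then 0 else q x :=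
      tsum_congr fun x => by split_ifs with hx; exacts [rfl, h x hx]
    rw [hs] at hp
    have hfin : (∑' x, if x = b then 0 else q x) ≠ ∞ := by
      refine ne_top_of_le_ne_top ENNReal.one_ne_top ?_
      rw [← hq]
      exact le_add_self
    exact (ENNReal.add_left_inj hfin).1 (hp.trans hq.symm)
  · exact h b hb

/-- The total mass forces the value of `c`, so uniformity only requires constancy on `s`. -/
lemma PMF.eq_uniformOfFinset {α : Type*} {p : PMF α} {s : Finset α} (hs : s.Nonempty)
    (c : ℝ≥0∞) (h : ∀ a ∈ s, p a = c) (h' : ∀ a ∉ s, p a = 0) :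
    p = PMF.uniformOfFinset s hs := by
  classical
  have hsum := p.tsum_coe
  rw [tsum_eq_sum (s := s) (fun a ha => h' a ha), Finset.sum_congr rfl h, Finset.sum_const,
    nsmul_eq_mul] at hsum
  have hc : c = (s.card : ℝ≥0∞)⁻¹ := ENNReal.eq_inv_of_mul_eq_one_left (by rwa [mul_comm])
  ext a
  by_cases ha : a ∈ s
  · rw [h a ha, PMF.uniformOfFinset_apply_of_mem hs ha, hc]
  · rw [h' a ha, PMF.uniformOfFinset_apply_of_notMem hs ha]

lemma PMF.map_uniformOfFinset {α β : Type*} [DecidableEq β] {s : Finset α} (hs : s.Nonempty)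
    {f : α → β} (hf : Set.InjOn f s) :
    (PMF.uniformOfFinset s hs).map f = PMF.uniformOfFinset (s.image f) (hs.image f) := by
  classical
  refine PMF.eq_uniformOfFinset _ (s.card : ℝ≥0∞)⁻¹ (fun b hb => ?_) fun b hb => ?_
  · obtain ⟨a, ha, rfl⟩ := Finset.mem_image.1 hb
    rw [PMF.map_apply, tsum_eq_single a]
    · rw [if_pos rfl, PMF.uniformOfFinset_apply_of_mem hs ha]
    · intro a' ha'
      split_ifs with h
      · exact PMF.uniformOfFinset_apply_of_notMem hs fun h' => ha' (hf h' ha h.symm)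
      · rfl
  · rw [PMF.map_apply, ENNReal.tsum_eq_zero]
    intro a
    split_ifs with h
    · exact PMF.uniformOfFinset_apply_of_notMem hs fun h' =>
        hb (Finset.mem_image.2 ⟨a, h', h.symm⟩)
    · rfl

lemma uniformBetween_zero (n : ℕ) :
    uniformBetween 0 (n + 1) = (PMF.uniformOfFintype (Fin (n + 1))).map Fin.val := by
  rw [uniformBetween, dif_pos n.succ_pos, PMF.uniformOfFintype,
    PMF.map_uniformOfFinset _ Fin.val_injective.injOn]
  congr 1
  ext x
  simp only [Finset.mem_Ico, Finset.mem_image, Finset.mem_univ, true_and]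
  exact ⟨fun h => ⟨⟨x, h.2⟩, rfl⟩, fun ⟨y, hy⟩ => ⟨Nat.zero_le _, hy ▸ y.2⟩⟩

lemma mem_support_uniformBetween {a b v : ℕ} (h : a < b) :
    v ∈ (uniformBetween a b).support ↔ a ≤ v ∧ v < b := by
  rw [uniformBetween, dif_pos h, PMF.mem_support_uniformOfFinset_iff, Finset.mem_Ico]

/-! ### Sampling without replacement -/

/-- Add a uniformly random new element to a set (if there is one). -/
noncomputable def insertRandom {n : ℕ} (S : Finset (Fin n)) : PMF (Finset (Fin n)) :=
  if h : Sᶜ.Nonempty then (PMF.uniformOfFinset Sᶜ h).map fun x => insert x S else PMF.pure S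

/-- Draw `j` random elements without replacement. -/
noncomputable def draws (n : ℕ) : ℕ → PMF (Finset (Fin n))
  | 0 => PMF.pure ∅
  | j + 1 => (draws n j).bind insertRandom

lemma insertRandom_apply {n : ℕ} (S A : Finset (Fin n)) (hS : S.card < n) :
    insertRandom S A =
      if S ⊆ A ∧ A.card = S.card + 1 then ((n - S.card : ℕ) : ℝ≥0∞)⁻¹ else 0 := by
  have hcard : Sᶜ.card = n - S.card := by rw [Finset.card_compl, Fintype.card_fin]
  have h : Sᶜ.Nonempty := Finset.card_pos.1 (by omega)
  rw [insertRandom, dif_pos h, PMF.map_apply]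
  split_ifs with hA
  · obtain ⟨a, ha, rfl⟩ := (Finset.covBy_iff_exists_insert.1
      (Finset.covBy_iff_card_sdiff_eq_one.2 ⟨hA.1, by
        rw [Finset.card_sdiff_of_subset hA.1]; omega⟩))
    rw [tsum_eq_single a, if_pos rfl, PMF.uniformOfFinset_apply_of_mem h (by simpa), hcard]
    intro x hx
    split_ifs with hxa
    · refine PMF.uniformOfFinset_apply_of_notMem h ?_
      have : a ∈ insert x S := hxa ▸ Finset.mem_insert_self a S
      rcases Finset.mem_insert.1 this with h | h
      · exact absurd h.symm hx
      · exact absurd h ha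
    · rfl
  · rw [ENNReal.tsum_eq_zero]
    intro x
    split_ifs with hxa
    · refine PMF.uniformOfFinset_apply_of_notMem h fun hx => hA ?_
      rw [hxa]
      exact ⟨Finset.subset_insert _ _, Finset.card_insert_of_notMem (by simpa using hx)⟩
    · rfl

/-- A set of size `j + 1` arises from each of its `j + 1` subsets of size `j`, and these are equally
likely by induction. So the probability is constant on sets of this size, and its value need not be
simplified. -/
lemma draws_eq (n j : ℕ) (hj : j ≤ n) :
    draws n j = PMF.uniformOfFinset (Finset.powersetCard j Finset.univ)
      (Finset.powersetCard_nonempty.2 (by simpa using hj)) := by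
  classical
  induction j with
  | zero =>
    refine PMF.eq_uniformOfFinset _ 1 (fun a ha => ?_) fun a ha => ?_
    · have : a = ∅ := by simpa using ha
      simp [draws, this]
    · have : a ≠ ∅ := by simpa using ha
      simp [draws, this]
  | succ j ih =>
    rw [draws, ih (by omega)]
    have hval : ∀ A : Finset (Fin n), ((PMF.uniformOfFinset (Finset.powersetCard j Finset.univ)
        (Finset.powersetCard_nonempty.2 (by simp; omega))).bind insertRandom) A =
        ∑ S ∈ Finset.powersetCard j (Finset.univ : Finset (Fin n)),
          (((Finset.powersetCard j (Finset.univ : Finset (Fin n))).card : ℝ≥0∞)⁻¹ *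
          if S ⊆ A ∧ A.card = j + 1 then ((n - j : ℕ) : ℝ≥0∞)⁻¹ else 0) := by
      intro A
      rw [PMF.bind_apply, tsum_eq_sum (s := Finset.powersetCard j Finset.univ)]
      · refine Finset.sum_congr rfl fun S hS => ?_
        have hSj : S.card = j := (Finset.mem_powersetCard.1 hS).2
        rw [PMF.uniformOfFinset_apply_of_mem _ hS, insertRandom_apply S A (by omega), hSj]
      · intro S hS
        rw [PMF.uniformOfFinset_apply_of_notMem _ hS, zero_mul]
    refine PMF.eq_uniformOfFinset _ (((j + 1).choose j : ℕ) *
      (((Finset.powersetCard j (Finset.univ : Finset (Fin n))).card : ℝ≥0∞)⁻¹ *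
        ((n - j : ℕ) : ℝ≥0∞)⁻¹)) (fun A hA => ?_) fun A hA => ?_
    · have hA : A.card = j + 1 := (Finset.mem_powersetCard.1 hA).2
      rw [hval]
      simp only [hA, and_true, mul_ite, mul_zero]
      rw [← Finset.sum_filter, Finset.sum_const, nsmul_eq_mul]
      congr 2
      rw [← hA, ← Finset.card_powersetCard]
      congr 1
      ext S
      simp [Finset.mem_powersetCard, and_comm]
    · have hA : A.card ≠ j + 1 := fun h => hA (Finset.mem_powersetCard.2 ⟨Finset.subset_univ _, h⟩)
      rw [hval]
      simp [hA]

/-- The entries of `σ` at the positions `j, …, n - 1` enumerate the complement of `S`, so a uniform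
position gives a uniform new element, in whatever order they are stored. -/
lemma insertRandom_eq_map {n j : ℕ} (hj : j < n) (σ : Equiv.Perm (Fin n)) (S : Finset (Fin n))
    (hS : ∀ x, x ∈ S ↔ (σ.symm x : ℕ) < j) :
    insertRandom S = (uniformBetween j n).map
      fun r => if h : r < n then insert (σ ⟨r, h⟩) S else S := by
  classical
  have h : Sᶜ.Nonempty := ⟨σ ⟨j, hj⟩, by simp [hS]⟩
  rw [insertRandom, dif_pos h, uniformBetween, dif_pos hj]
  set g : Fin n → ℕ := fun x => σ.symm x with hg
  have hinj : Set.InjOn g (Sᶜ : Finset (Fin n)) := fun x _ y _ hxy => by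
    simpa using Fin.ext (show ((σ.symm x : Fin n) : ℕ) = σ.symm y from hxy)
  have himage : Sᶜ.image g = Finset.Ico j n := by
    ext r
    simp only [Finset.mem_image, Finset.mem_compl, hS, Finset.mem_Ico, hg]
    constructor
    · rintro ⟨x, hx, rfl⟩
      exact ⟨by omega, (σ.symm x).2⟩
    · rintro ⟨h1, h2⟩
      exact ⟨σ ⟨r, h2⟩, by simp; omega, by simp⟩
  have := PMF.map_uniformOfFinset h hinj
  simp only [himage] at this
  rw [← this, PMF.map_comp]
  congr 1
  funext x
  simp [hg]

/-! ### Sampling by hazard rates -/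

lemma coinFlip_bind_apply {α : Type} (p : ℝ) (κ : ℕ → PMF α) (a : α) :
    ((coinFlip p).bind κ) a =
      min (ENNReal.ofReal p) 1 * κ 1 a + (1 - min (ENNReal.ofReal p) 1) * κ 0 a := by
  rw [coinFlip, PMF.bind_map, PMF.bind_apply, tsum_fintype, Fintype.sum_bool]
  simp [PMF.ofFintype_apply]

/-- Count from `j` on, stopping at `i` with probability `h i`, and after at most `f` increments. -/
noncomputable def stopLaw (h : ℕ → ℝ) : ℕ → ℕ → PMF ℕ
  | 0, j => PMF.pure j
  | f + 1, j => (coinFlip (h j)).bind fun b => if b = 0 then stopLaw h f (j + 1) else PMF.pure j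

/-- The probability of not stopping at `i` is `W (i + 1) / W i`, and the product of these
telescopes. The value `j + f` is excluded because it collects the remaining mass. -/
lemma stopLaw_apply {h w W : ℕ → ℝ} (hw : ∀ i, 1 ≤ i → 0 ≤ w i) (hW : ∀ i, 1 ≤ i → 0 < W i)
    (hWw : ∀ i, 1 ≤ i → W i = w i + W (i + 1)) (hh : ∀ i, 1 ≤ i → h i = w i / W i)
    (f j : ℕ) (hj : 1 ≤ j) (k : ℕ) (hk : k ≠ j + f) :
    stopLaw h f j k = if j ≤ k ∧ k < j + f then ENNReal.ofReal (w k / W j) else 0 := by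
  induction f generalizing j with
  | zero =>
    rw [if_neg (by omega)]
    simp only [stopLaw, PMF.pure_apply, ite_eq_right_iff, one_ne_zero, imp_false]
    exact hk
  | succ f ih =>
    have h1 : W (j + 1) = W j - w j := by linarith [hWw j hj]
    have hWj := hW j hj
    have hle : h j ≤ 1 := by
      rw [hh j hj, div_le_one hWj]
      linarith [hW (j + 1) (by omega)]
    have h0 : 0 ≤ h j := by
      rw [hh j hj]
      exact div_nonneg (hw j hj) hWj.le
    have hsub : 1 - h j = W (j + 1) / W j := by
      rw [h1, hh j hj, sub_div, div_self hWj.ne']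
    rw [stopLaw, coinFlip_bind_apply, min_eq_left (by simpa using hle)]
    simp only [one_ne_zero, if_false, if_true, PMF.pure_apply]
    rw [ih (j + 1) (by omega) (by omega)]
    by_cases hkj : k = j
    · subst hkj
      rw [if_pos rfl, if_neg (by omega), if_pos (by omega), mul_zero, add_zero, mul_one, hh k hj]
    · rw [if_neg hkj, mul_zero, zero_add]
      by_cases hk' : j ≤ k ∧ k < j + (f + 1)
      · rw [if_pos hk', if_pos (by omega)]
        rw [← ENNReal.ofReal_one, ← ENNReal.ofReal_sub _ h0, hsub,
          ← ENNReal.ofReal_mul (div_nonneg (hW _ (by omega)).le hWj.le)]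
        congr 1
        have := (hW (j + 1) (by omega)).ne'
        field_simp
      · rw [if_neg hk', if_neg (by omega), mul_zero]

/-- The Poisson probabilities. -/
noncomputable def poissonProb (lam : ℝ) (k : ℕ) : ℝ := Real.exp (-lam) * lam ^ k / k.factorial

/-- The Poisson tail. -/
noncomputable def poissonTail (lam : ℝ) (k : ℕ) : ℝ := 1 - ∑ i ∈ Finset.range k, poissonProb lam i

/-- The hazard rates of a Poisson number in which `0` has been replaced by `1`. -/
noncomputable def poissonHazard (lam : ℝ) (k : ℕ) : ℝ :=
  if k = 1 then poissonProb lam 0 + poissonProb lam 1 else poissonProb lam k / poissonTail lam k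

lemma poissonProb_pos {lam : ℝ} (h : 0 < lam) (k : ℕ) : 0 < poissonProb lam k := by
  unfold poissonProb
  positivity

lemma poissonProb_succ (lam : ℝ) (k : ℕ) :
    poissonProb lam (k + 1) = poissonProb lam k * lam / (k + 1 : ℕ) := by
  unfold poissonProb
  rw [Nat.factorial_succ]
  push_cast
  have : (k.factorial : ℝ) ≠ 0 := by positivity
  field_simp
  ring

lemma poissonTail_pos {lam : ℝ} (h : 0 < lam) (k : ℕ) : 0 < poissonTail lam k := by
  have hs := ProbabilityTheory.hasSum_one_poissonMeasure ⟨lam, h.le⟩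
  have := sum_le_hasSum (Finset.range (k + 1)) (fun i _ => (poissonProb_pos h i).le) hs
  have hle : ∑ i ∈ Finset.range (k + 1), poissonProb lam i ≤ 1 := this
  rw [Finset.sum_range_succ] at hle
  have := poissonProb_pos h k
  unfold poissonTail
  linarith

lemma poissonTail_succ (lam : ℝ) (k : ℕ) :
    poissonTail lam (k + 1) = poissonTail lam k - poissonProb lam k := by
  unfold poissonTail
  rw [Finset.sum_range_succ]
  ring

/-- After `n - 1` increments the count is `n`, where all values from `n` on are collected;
`PMF.ext_of_ne` takes care of this value. The weights `w` and tails `W` are Poisson with `0` merged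
into `1`, so `W 1 = 1`. -/
lemma stopLaw_poissonHazard (n : ℕ) [NeZero n] (lam : ℝ≥0) (hlam : 0 < lam) :
    stopLaw (poissonHazard lam) (n - 1) 1 =
      (ProbabilityTheory.poissonMeasure lam).toPMF.map (clampCount n) := by
  classical
  have hn := NeZero.pos n
  have hl : (0 : ℝ) < lam := by exact_mod_cast hlam
  have hone : ∀ k, (ProbabilityTheory.poissonMeasure lam).toPMF k =
      ENNReal.ofReal (poissonProb lam k) := fun k =>
    ProbabilityTheory.poissonMeasure_singleton lam k
  obtain ⟨w, hw⟩ : ∃ w : ℕ → ℝ, w = fun i =>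
    if i = 1 then poissonProb lam 0 + poissonProb lam 1 else poissonProb lam i := ⟨_, rfl⟩
  obtain ⟨W, hW⟩ : ∃ W : ℕ → ℝ, W = fun i => if i = 1 then 1 else poissonTail lam i := ⟨_, rfl⟩
  have hw1 : w 1 = poissonProb lam 0 + poissonProb lam 1 := by rw [hw]; exact if_pos rfl
  have hwk : ∀ i, i ≠ 1 → w i = poissonProb lam i := fun i hi => by rw [hw]; exact if_neg hi
  have hW1 : W 1 = 1 := by rw [hW]; exact if_pos rfl
  have hWk : ∀ i, i ≠ 1 → W i = poissonTail lam i := fun i hi => by rw [hW]; exact if_neg hi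
  clear hw hW
  refine PMF.ext_of_ne n fun k hk => ?_
  rw [stopLaw_apply (w := w) (W := W) _ _ _ _ _ _ le_rfl _ (by omega), hW1, div_one,
    PMF.map_apply]
  · by_cases hk1 : k = 1
    · subst hk1
      -- Both `0` and `1` are sent to `1`. Here `1 < n`, since the value `n` is excluded.
      rw [if_pos (by omega), tsum_eq_sum (s := {0, 1})]
      · rw [Finset.sum_pair (by simp), if_pos (by simp [clampCount]),
          if_pos (by unfold clampCount; split_ifs <;> omega), hone, hone, ← ENNReal.ofReal_add, hw1]
        · exact (poissonProb_pos hl 0).le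
        · exact (poissonProb_pos hl 1).le
      · intro i hi
        rw [if_neg]
        simp only [Finset.mem_insert, Finset.mem_singleton] at hi
        unfold clampCount
        split_ifs <;> omega
    · by_cases hk2 : 1 ≤ k ∧ k < n
      · rw [if_pos (by omega), tsum_eq_single k]
        · rw [if_pos (by unfold clampCount; split_ifs <;> omega), hone, hwk k hk1]
        · intro i hi
          rw [if_neg]
          unfold clampCount
          split_ifs <;> omega
      · rw [if_neg (by omega)]
        symm
        rw [ENNReal.tsum_eq_zero]
        intro i
        rw [if_neg]
        unfold clampCount
        split_ifs <;> omega
  · intro i _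
    by_cases h : i = 1
    · rw [h, hw1]
      exact (add_pos (poissonProb_pos hl 0) (poissonProb_pos hl 1)).le
    · rw [hwk i h]
      exact (poissonProb_pos hl i).le
  · intro i _
    by_cases h : i = 1
    · rw [h, hW1]
      exact one_pos
    · rw [hWk i h]
      exact poissonTail_pos hl i
  · intro i hi
    rw [hWk (i + 1) (by omega)]
    by_cases h : i = 1
    · rw [h, hW1, hw1]
      simp only [poissonTail, Finset.sum_range_succ, Finset.sum_range_zero]
      ring
    · rw [hWk i h, hwk i h, poissonTail_succ]
      ring
  · intro i _
    unfold poissonHazard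
    by_cases h : i = 1
    · rw [if_pos h, h, hW1, hw1, div_one]
    · rw [if_neg h, hWk i h, hwk i h]

/-! ## The host tree and the connecting subtrees -/

lemma edgeListGraph_succ {i : ℕ} {a b : ℕ → ℕ} (ha : ∀ j < i + 1, a j = j + 1)
    (hb : ∀ j < i, b j ≤ j) (x : Fin (i + 1)) (hx : b i = x) :
    (edgeListGraph (i + 1) i a b).map (Fin.castSuccEmb : Fin (i + 1) ↪ Fin (i + 2)) ⊔
      SimpleGraph.edge x.castSucc (Fin.last (i + 1)) = edgeListGraph (i + 2) (i + 1) a b := by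
  have hadj := edgeListGraph_adj (q := i + 1) (a := a) (b := b) (fun j hj => ha j (by omega)) hb
  have hadj' := edgeListGraph_adj (q := i + 2) (a := a) (b := b) (fun j hj => ha j (by omega))
    (fun j hj => by
      rcases Nat.lt_succ_iff_lt_or_eq.1 hj with h | rfl
      · exact hb j h
      · rw [hx]; omega)
  simp only [Nat.add_sub_cancel] at hadj hadj'
  change ∀ x y : Fin (i + 2), (edgeListGraph (i + 2) (i + 1) a b).Adj x y ↔ _ at hadj'
  ext u v
  rw [SimpleGraph.sup_adj, SimpleGraph.map_adj, SimpleGraph.edge_adj, hadj']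
  have hxi := x.2
  have hu := u.2
  have hv := v.2
  constructor
  · rintro (⟨y, z, hyz, rfl, rfl⟩ | ⟨h, -⟩)
    · rw [hadj] at hyz
      exact hyz
    · rcases h with ⟨rfl, rfl⟩ | ⟨rfl, rfl⟩
      · exact Or.inr ⟨by simp, by simp [hx]⟩
      · exact Or.inl ⟨by simp, by simp [hx]⟩
  · have key : ∀ u v : Fin (i + 2), (u : ℕ) ≠ 0 → b (u - 1) = v →
        (∃ y z, (edgeListGraph (i + 1) i a b).Adj y z ∧ Fin.castSuccEmb y = u ∧
          Fin.castSuccEmb z = v) ∨ (v = x.castSucc ∧ u = Fin.last (i + 1)) := by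
      intro u v h1 h2
      have hu := u.2
      by_cases hl : (u : ℕ) = i + 1
      · right
        rw [hl, Nat.add_sub_cancel, hx] at h2
        exact ⟨Fin.ext h2.symm, Fin.ext hl⟩
      · left
        have := hb (u - 1) (by omega)
        exact ⟨⟨u, by omega⟩, ⟨v, by omega⟩, (hadj _ _).2 (Or.inl ⟨h1, h2⟩), rfl, rfl⟩
    rintro (⟨h1, h2⟩ | ⟨h1, h2⟩)
    · rcases key u v h1 h2 with h | ⟨h, h'⟩
      · exact Or.inl h
      · exact Or.inr ⟨Or.inr ⟨h', h⟩, by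
          rintro rfl
          have := congrArg Fin.val (h.symm.trans h')
          simp only [Fin.val_castSucc, Fin.val_last] at this
          omega⟩
    · rcases key v u h1 h2 with ⟨y, z, h3, h4, h5⟩ | ⟨h, h'⟩
      · exact Or.inl ⟨z, y, h3.symm, h5, h4⟩
      · exact Or.inr ⟨Or.inl ⟨h, h'⟩, by
          rintro rfl
          have := congrArg Fin.val (h.symm.trans h')
          simp only [Fin.val_castSucc, Fin.val_last] at this
          omega⟩

/-- `T` is the tree on `n` nodes in which `j + 1` has the parent `b j`, and `lev` are the levels. -/
structure IsHost {n : ℕ} (T : SimpleGraph (Fin n)) (a b lev : ℕ → ℕ) : Prop where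
  eq : T = edgeListGraph n (n - 1) a b
  child : ∀ j < n - 1, a j = j + 1
  le : ∀ j < n - 1, b j ≤ j
  lev_zero : lev 0 = 0
  lev_succ : ∀ j < n - 1, lev (j + 1) = lev (b j) + 1

namespace IsHost

variable {n : ℕ} {T : SimpleGraph (Fin n)} {a b lev : ℕ → ℕ}

lemma adj (h : IsHost T a b lev) (x y : Fin n) :
    T.Adj x y ↔ ((x : ℕ) ≠ 0 ∧ b (x - 1) = y) ∨ ((y : ℕ) ≠ 0 ∧ b (y - 1) = x) := by
  rw [h.eq, edgeListGraph_adj h.child h.le]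

lemma lev_eq (h : IsHost T a b lev) {x : ℕ} (hx : x < n) (h0 : x ≠ 0) :
    lev x = lev (b (x - 1)) + 1 := by
  have := h.lev_succ (x - 1) (by omega)
  rwa [Nat.sub_add_cancel (by omega)] at this

lemma lev_pos (h : IsHost T a b lev) {x : ℕ} (hx : x < n) (h0 : x ≠ 0) : 0 < lev x := by
  rw [h.lev_eq hx h0]; omega

variable [NeZero n]

/-- The path of parents bounds the distance from above. Levels of adjacent nodes differ by one, so a
walk from the root to `x` has length at least `lev x`. -/
lemma dist_eq (h : IsHost T a b lev) (x : Fin n) : T.dist 0 x = lev x := by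
  have hconn : T.Connected := by
    rw [h.eq]
    exact (edgeListGraph_isTree (NeZero.pos n) h.child h.le).connected
  apply le_antisymm
  · obtain ⟨x, hx⟩ := x
    induction x using Nat.strong_induction_on with
    | _ x ih =>
      by_cases h0 : x = 0
      · subst h0
        have : (⟨0, hx⟩ : Fin n) = 0 := Fin.ext (by simp)
        rw [this, SimpleGraph.dist_self]
        omega
      · have hle := h.le (x - 1) (by omega)
        have h1 := ih (b (x - 1)) (by omega) (by omega)
        have hadj : T.Adj ⟨b (x - 1), by omega⟩ ⟨x, hx⟩ := (h.adj _ _).2 (Or.inr ⟨h0, rfl⟩)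
        have h2 := hconn.dist_triangle (u := 0) (v := ⟨b (x - 1), by omega⟩) (w := ⟨x, hx⟩)
        rw [SimpleGraph.dist_eq_one_iff_adj.2 hadj] at h2
        have h3 := h.lev_eq hx h0
        dsimp only at h1 ⊢
        omega
  · obtain ⟨w, hw⟩ := hconn.exists_walk_length_eq_dist 0 x
    rw [← hw]
    have key : ∀ (u v : Fin n) (w : T.Walk u v), lev v ≤ lev u + w.length := by
      intro u v w
      induction w with
      | nil => simp
      | @cons u v z huv w ih =>
        rw [SimpleGraph.Walk.length_cons]
        have : lev v ≤ lev u + 1 := by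
          rcases (h.adj u v).1 huv with ⟨h1, h2⟩ | ⟨h1, h2⟩
          · have := h.lev_eq u.2 h1
            rw [h2] at this
            omega
          · have := h.lev_eq v.2 h1
            rw [h2] at this
            omega
        omega
    have := key 0 x w
    have h0 := h.lev_zero
    simp only [Fin.val_zero] at this
    omega

/-- The definition chooses some neighbour one level up. The other neighbours of `x` are its
children, which are one level deeper, so the choice is forced. -/
lemma parent_eq (h : IsHost T a b lev) {x : Fin n} (h0 : (x : ℕ) ≠ 0) :
    (bfsParent T 0 x : ℕ) = b (x - 1) := by
  have hx := x.2
  have hle := h.le (x - 1) (by omega)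
  have hex : ∃ y, T.Adj x y ∧ T.dist 0 y + 1 = T.dist 0 x := by
    refine ⟨⟨b (x - 1), by omega⟩, (h.adj _ _).2 (Or.inl ⟨h0, rfl⟩), ?_⟩
    rw [h.dist_eq, h.dist_eq]
    exact (h.lev_eq hx h0).symm
  rw [bfsParent, dif_pos hex]
  obtain ⟨h1, h2⟩ := hex.choose_spec
  generalize hex.choose = y at h1 h2 ⊢
  rcases (h.adj _ _).1 h1 with ⟨-, h3⟩ | ⟨h3, h4⟩
  · exact h3.symm
  · exfalso
    rw [h.dist_eq, h.dist_eq] at h2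
    have := h.lev_eq y.2 h3
    rw [h4] at this
    omega

lemma parent_lt (h : IsHost T a b lev) {x : Fin n} (h0 : (x : ℕ) ≠ 0) : bfsParent T 0 x < x := by
  have hx := x.2
  have := h.le (x - 1) (by omega)
  have h2 := h.parent_eq h0
  exact Fin.lt_def.2 (by omega)

lemma dist_parent (h : IsHost T a b lev) {x : Fin n} (h0 : (x : ℕ) ≠ 0) :
    T.dist 0 (bfsParent T 0 x) + 1 = T.dist 0 x := by
  rw [h.dist_eq, h.dist_eq, h.parent_eq h0, ← h.lev_eq x.2 h0]

lemma dist_pos (h : IsHost T a b lev) {x : Fin n} : 0 < T.dist 0 x ↔ (x : ℕ) ≠ 0 := by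
  rw [h.dist_eq]
  refine ⟨fun hx h0 => ?_, h.lev_pos x.2⟩
  rw [h0, h.lev_zero] at hx
  omega

end IsHost

/-! ### The loop of ConnectingNodes on a host tree -/

section connect

variable {n : ℕ} (T : SimpleGraph (Fin n)) (r : Fin n)

lemma subset_connectLoop (d : ℕ) (S L : Finset (Fin n)) : S ⊆ connectLoop T r d S L := by
  induction d generalizing S L with
  | zero => exact subset_rfl
  | succ d ih =>
    rw [connectLoop]
    split_ifs
    · exact Finset.subset_union_left.trans (ih _ _)
    · exact subset_rfl

/-- The nodes of `S` on the levels up to `d`. -/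
noncomputable def upTo (d : ℕ) (S : Finset (Fin n)) : Finset (Fin n) :=
  S.filter fun x => T.dist r x ≤ d

lemma mem_upTo {d : ℕ} {S : Finset (Fin n)} {x : Fin n} :
    x ∈ upTo T r d S ↔ x ∈ S ∧ T.dist r x ≤ d := by simp [upTo]

lemma connectLoop_of_card_le {d : ℕ} {S L : Finset (Fin n)} (h : L.card ≤ 1) :
    connectLoop T r d S L = S := by
  cases d with
  | zero => rfl
  | succ d => rw [connectLoop, if_neg (by omega)]

end connect

section connectHost

variable {n : ℕ} [NeZero n] {T : SimpleGraph (Fin n)} {a b lev : ℕ → ℕ}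

/-- The unprocessed nodes are always the collected nodes on the levels up to `d`, so the set `L` of
the loop is determined by `S`. The form persists because the added parents are on level `d`. -/
lemma connectLoop_succ (h : IsHost T a b lev) {d : ℕ} {S S' : Finset (Fin n)}
    (hS : 1 < (upTo T 0 (d + 1) S).card)
    (hS' : S' = S ∪ (S.filter fun x => T.dist 0 x = d + 1).image (bfsParent T 0)) :
    connectLoop T 0 (d + 1) S (upTo T 0 (d + 1) S) = connectLoop T 0 d S' (upTo T 0 d S') := by
  rw [connectLoop, if_pos hS]
  have hM : (upTo T 0 (d + 1) S).filter (fun x => T.dist 0 x = d + 1) =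
      S.filter fun x => T.dist 0 x = d + 1 := by
    ext x
    simp only [upTo, Finset.mem_filter]
    exact ⟨fun h => ⟨h.1.1, h.2⟩, fun h => ⟨⟨h.1, h.2.le⟩, h.2⟩⟩
  simp only [hM]
  rw [← hS']
  congr 1
  ext x
  rw [mem_upTo, hS']
  simp only [upTo, Finset.mem_union, Finset.mem_sdiff, Finset.mem_filter, Finset.mem_image]
  constructor
  · rintro (⟨⟨h1, h2⟩, h3⟩ | ⟨y, ⟨hy, hyd⟩, rfl⟩)
    · refine ⟨Or.inl h1, ?_⟩
      by_contra hc
      exact h3 ⟨h1, by omega⟩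
    · refine ⟨Or.inr ⟨y, ⟨hy, hyd⟩, rfl⟩, ?_⟩
      have := h.dist_parent (h.dist_pos.1 (by omega : 0 < T.dist 0 y))
      omega
  · rintro ⟨h1 | ⟨y, ⟨hy, hyd⟩, rfl⟩, h2⟩
    · exact Or.inl ⟨⟨h1, by omega⟩, by omega⟩
    · exact Or.inr ⟨y, ⟨hy, hyd⟩, rfl⟩

/-- If the parents of the nodes of `V` below level `d` are in `V`, and `V` has at most one node on
the levels up to `d`, then `V` is a subtree, and the nodes below level `d` are those with a parent
in `V`. -/
lemma isSubtree_of_upTo (h : IsHost T a b lev) {d : ℕ} {V : Finset (Fin n)}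
    (hV : ∀ x ∈ V, d < T.dist 0 x → bfsParent T 0 x ∈ V) (hd : (upTo T 0 d V).card ≤ 1)
    {x y : Fin n} (hx : x ∈ V) (hy : y ∈ V) (hyx : y < x) : d < T.dist 0 x := by
  by_contra hxd
  have hxL : x ∈ upTo T 0 d V := (mem_upTo T 0).2 ⟨hx, by omega⟩
  -- Climbing from `y` along parents stays in `V`, decreases the index, and ends on a level up to
  -- `d`, where `x` is the only node of `V`.
  have key : ∀ (k : ℕ) (y : Fin n), (y : ℕ) = k → y ∈ V → x ≤ y := by
    intro k
    induction k using Nat.strong_induction_on with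
    | _ k ih =>
      rintro y rfl hy
      by_cases hyd : d < T.dist 0 y
      · have h0 : (y : ℕ) ≠ 0 := h.dist_pos.1 (by omega)
        exact (ih _ (h.parent_lt h0) _ rfl (hV y hy hyd)).trans (h.parent_lt h0).le
      · have hyL : y ∈ upTo T 0 d V := (mem_upTo T 0).2 ⟨hy, by omega⟩
        exact (Finset.card_le_one.1 hd x hxL y hyL).le
  exact absurd (key y y rfl hy) (not_le.2 hyx)

end connectHost

/-! ## Generating the host tree

In all programs below, the integer register `0` holds `n`, register `1` holds `0`, and register
`14` holds `1`. -/

/-- Generates the host tree in the arrays `0` (children) and `1` (parents), the levels in the array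
`9`, and the identity permutation in the array `8`. -/
def hostProg : Prog :=
  .seq (block [.const 14 1, .const 2 1])
    (.while (.lt 2 0) (.seq (.instr (.rand 12 1 2))
      (block [.pred 11 2, .store 0 11 2, .store 1 11 12, .load 13 9 12, .succ 13 13,
        .store 9 2 13, .store 8 2 2, .succ 2 2])))

/-- The memory after the first `k + 1` nodes of the host tree have been generated. -/
structure HostInv (n : ℕ) (lam : ℝ) (k : ℕ) (T : SimpleGraph (Fin (k + 1))) (m : Mem) (t : ℕ) :
    Prop where
  nat0 : m.nat 0 = n
  nat1 : m.nat 1 = 0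
  nat2 : m.nat 2 = k + 1
  nat4 : m.nat 4 = 0
  nat14 : m.nat 14 = 1
  real0 : m.real 0 = lam
  arr2 : m.arr 2 = 0
  arr10 : m.arr 10 = 0
  arr11 : m.arr 11 = 0
  arr14 : m.arr 14 = 0
  arr15 : m.arr 15 = 0
  arr17 : m.arr 17 = 0
  perm : ∀ x ≤ k, m.arr 8 x = x
  host : IsHost T (m.arr 0) (m.arr 1) (m.arr 9)
  time : t ≤ 20 * k + 8

lemma IsHost.add {k : ℕ} {T : SimpleGraph (Fin (k + 1))} {a b lev : ℕ → ℕ} (h : IsHost T a b lev)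
    (x : Fin (k + 1)) :
    IsHost (T.map (Fin.castSuccEmb : Fin (k + 1) ↪ Fin (k + 2)) ⊔
        SimpleGraph.edge x.castSucc (Fin.last (k + 1)))
      (Function.update a k (k + 1)) (Function.update b k x)
      (Function.update lev (k + 1) (lev x + 1)) := by
  have hx := x.2
  have ha : ∀ j < k + 1, Function.update a k (k + 1) j = j + 1 := by
    intro j hj
    by_cases hjk : j = k
    · rw [hjk, Function.update_self]
    · rw [Function.update_of_ne hjk]; exact h.child j (by omega)
  have hb : ∀ j < k, Function.update b k x j ≤ j := by
    intro j hj
    rw [Function.update_of_ne (by omega)]; exact h.le j (by omega)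
  refine ⟨?_, ha, ?_, ?_, ?_⟩
  · rw [h.eq, Nat.add_sub_cancel]
    have := edgeListGraph_succ ha hb x (by rw [Function.update_self])
    refine Eq.trans ?_ this
    congr 2
    unfold edgeListGraph
    congr 1
    funext u v
    refine propext (exists_congr fun j => and_congr_right fun hj => ?_)
    rw [Function.update_of_ne (by omega), Function.update_of_ne (by omega)]
  · intro j hj
    by_cases hjk : j = k
    · rw [hjk, Function.update_self]; omega
    · exact hb j (by omega)
  · rw [Function.update_of_ne (by omega)]; exact h.lev_zero
  · intro j hj
    by_cases hjk : j = k
    · rw [hjk, Function.update_self, Function.update_self, Function.update_of_ne (by omega)]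
    · have := h.le j (by omega)
      rw [Function.update_of_ne (by omega), Function.update_of_ne hjk,
        Function.update_of_ne (by omega)]
      exact h.lev_succ j (by omega)

lemma hostProg_spec (k : ℕ) (lam : ℝ) :
    Sim hostProg (hostTree (k + 1)) (HostInv (k + 1) lam k)
      ⟨Function.update 0 0 (k + 1), 0, Function.update 0 0 lam⟩ 1 := by
  refine WP.seq_sim (WP.block ?_)
  simp only [after_const, after_nil]
  refine Sim.iterate (A := fun j => SimpleGraph (Fin (j + 1))) (fun j => hostTree (j + 1))
    (fun j T => (PMF.uniformOfFintype (Fin (j + 1))).bind fun x =>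
        PMF.pure (T.map (Fin.castSuccEmb : Fin (j + 1) ↪ Fin (j + 2)) ⊔
          SimpleGraph.edge x.castSucc (Fin.last (j + 1)))) (fun j => rfl)
    (fun j T m t => HostInv (k + 1) lam j T m (t + 1)) k (a₀ := ⊥) ?_ ?_ rfl ?_
  · intro j hj T m t hI
    refine ⟨by simp [Test.holds, hI.nat0, hI.nat2, hj], ?_⟩
    -- The machine draws a natural number. On the support of the draw, `Fin.ofNat` involves no
    -- reduction.
    have hlaw : ((PMF.uniformOfFintype (Fin (j + 1))).bind fun x =>
        PMF.pure (T.map (Fin.castSuccEmb : Fin (j + 1) ↪ Fin (j + 2)) ⊔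
          SimpleGraph.edge x.castSucc (Fin.last (j + 1)))) =
        (uniformBetween (m.nat 1) (m.nat 2)).bind fun v => PMF.pure
          (T.map (Fin.castSuccEmb : Fin (j + 1) ↪ Fin (j + 2)) ⊔
          SimpleGraph.edge (Fin.ofNat (j + 1) v).castSucc (Fin.last (j + 1))) := by
      rw [hI.nat1, hI.nat2, uniformBetween_zero, PMF.bind_map]
      congr 1
      funext x
      simp
    rw [hlaw]
    refine Sim.seq (Sim.rand _ _ _ _ _) ?_
    rintro v m' t' ⟨hv, rfl, rfl⟩
    rw [hI.nat1, hI.nat2, mem_support_uniformBetween (by omega)] at hv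
    refine Sim.of_wp (WP.block ?_)
    have h1 := hI.host.add (Fin.ofNat (j + 1) v)
    have h2 : ((Fin.ofNat (j + 1) v : Fin (j + 1)) : ℕ) = v := by
      simp [Nat.mod_eq_of_lt hv.2]
    rw [h2] at h1
    have h3 := hI.nat2
    have h4 := hI.time
    simp only [after_pred, after_store, after_load, after_succ, after_nil]
    constructor <;> try simp [hI.nat0, hI.nat1, hI.nat4, hI.nat14, hI.real0, hI.arr2, hI.arr10,
      hI.arr11, hI.arr14, hI.arr15, hI.arr17, h3]
    · intro x hx
      by_cases hxj : x = j + 1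
      · simp [hxj]
      · rw [Function.update_of_ne hxj]; exact hI.perm x (by omega)
    · exact h1
    · omega
  · intro T m t hI
    exact ⟨by simp [Test.holds, hI.nat0, hI.nat2], hI⟩
  · constructor <;> try simp
    refine ⟨?_, ?_, ?_, ?_, ?_⟩
    · ext x y
      obtain rfl := Subsingleton.elim x y
      simp
    · intro j hj; omega
    · intro j hj; omega
    · rfl
    · intro j hj; omega

/-! ## Drawing a Poisson number -/

/-- While no number has been chosen, increment the candidate in register `5`; the candidate is
chosen with the probability in the real register `5`. Register `6` is the upper limit. -/
def poissonLoop : Prog :=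
  .while (.lt 5 6) (.seq (.instr (.coin 11 5)) (.ite (.eq 11 1)
    (block [.succ 5 5, .rop .add 4 4 1, .rop .mul 2 2 0, .rop .div 2 2 4, .rop .div 5 2 3,
      .rop .sub 3 3 2])
    (block [.copy 6 5])))

/-- Draws a Poisson number, clamped to the interval from `1` to `n`, into register `5`. -/
def poissonProg : Prog :=
  -- Real register `6` becomes `-lam`, `7` the probability of `0`, `2` that of `1`, `5` the hazard
  -- rate at `1`, and `3` the tail from `2` on.
  .seq (block [.rone 1, .rone 4, .rop .sub 6 1 1, .rop .sub 6 6 0, .rexp 7 6, .rop .mul 2 7 0,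
    .rop .add 5 7 2, .rop .sub 3 1 5, .const 5 1, .copy 6 0]) poissonLoop

/-- The memories `m` and `m'` agree, except for temporary registers of `poissonProg`. -/
structure PoissonFrame (m m' : Mem) : Prop where
  nat : ∀ r, r ≠ 5 → r ≠ 6 → r ≠ 11 → m'.nat r = m.nat r
  arr : m'.arr = m.arr
  real0 : m'.real 0 = m.real 0

lemma PoissonFrame.trans {m m' m'' : Mem} (h : PoissonFrame m m') (h' : PoissonFrame m' m'') :
    PoissonFrame m m'' where
  nat r h1 h2 h3 := (h'.nat r h1 h2 h3).trans (h.nat r h1 h2 h3)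
  arr := h'.arr.trans h.arr
  real0 := h'.real0.trans h.real0

/-- The next hazard rate follows from the current probability and tail by a constant number of
operations. An increment costs 17 steps and the end of the loop at most 8, so the time is linear in
the outcome. -/
lemma poissonLoop_spec (n : ℕ) (f j : ℕ) (hj : 1 ≤ j) (hf : j + f = n) (m : Mem) (t : ℕ)
    (h0 : m.nat 1 = 0) (h5 : m.nat 5 = j) (h6 : m.nat 6 = n) (r1 : m.real 1 = 1)
    (r2 : m.real 2 = poissonProb (m.real 0) j) (r3 : m.real 3 = poissonTail (m.real 0) (j + 1))
    (r4 : m.real 4 = j) (r5 : m.real 5 = poissonHazard (m.real 0) j) :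
    Sim poissonLoop (stopLaw (poissonHazard (m.real 0)) f j)
      (fun k m' t' => m'.nat 5 = k ∧ 1 ≤ k ∧ k ≤ n ∧ PoissonFrame m m' ∧ t' + 20 * j ≤ t + 20 * k + 20)
      m t := by
  induction f generalizing j m t with
  | zero =>
    refine Sim.while_false (by simp [Test.holds, h5, h6]; omega) ?_
    exact ⟨h5, hj, by omega, ⟨fun _ _ _ _ => rfl, rfl, rfl⟩, by omega⟩
  | succ f ih =>
    rw [stopLaw]
    have hlaw : (coinFlip (poissonHazard (m.real 0) j)) = (coinFlip (m.real 5)).bind PMF.pure := by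
      rw [PMF.bind_pure, r5]
    rw [hlaw]
    refine Sim.while_true (Q' := fun v m' t' => (v ≠ 0 → m' = (m.setNat 11 v).setNat 6 j ∧
        t' = t + 7) ∧ (v = 0 → m'.nat 1 = 0 ∧ m'.nat 5 = j + 1 ∧ m'.nat 6 = n ∧ m'.real 1 = 1 ∧
        m'.real 2 = poissonProb (m.real 0) (j + 1) ∧
        m'.real 3 = poissonTail (m.real 0) (j + 1 + 1) ∧ m'.real 4 = (j + 1 : ℕ) ∧
        m'.real 5 = poissonHazard (m.real 0) (j + 1) ∧ PoissonFrame m m' ∧ t' = t + 17))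
      (by simp [Test.holds, h5, h6]; omega) ?_ ?_
    · refine Sim.seq (Sim.coin _ _ _ _) ?_
      rintro v m' t' ⟨rfl, rfl⟩
      refine Sim.of_wp (WP.ite (fun hT => ?_) fun hT => ?_)
      · have hv : v = 0 := by simpa [Test.holds, h0] using hT
        refine WP.block ?_
        simp only [after_succ, after_rop, after_nil]
        refine ⟨fun h => absurd hv h, fun _ => ?_⟩
        refine ⟨by simp [h0], by simp [h5], by simp [h6], by simp [r1], ?_, ?_, by simp [r1, r4, ROp.eval], ?_,
          ⟨?_, by simp, by simp⟩, trivial⟩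
        · simp [poissonProb_succ, r1, r2, r4, ROp.eval]
        · rw [poissonTail_succ _ (j + 1), poissonProb_succ]
          simp [r1, r2, r3, r4, ROp.eval]
        · have hz : poissonHazard (m.real 0) (j + 1) = poissonProb (m.real 0) j * m.real 0 /
              (j + 1 : ℕ) / poissonTail (m.real 0) (j + 1) := by
            rw [poissonHazard, if_neg (by omega), poissonProb_succ]
          rw [hz]
          simp [r1, r2, r3, r4, ROp.eval]
        · intro r h1 h2 h3
          simp [h1, h3]
      · have hv : v ≠ 0 := by simpa [Test.holds, h0] using hT
        refine WP.block ?_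
        simp only [after_copy, after_nil]
        refine ⟨fun _ => ?_, fun h => absurd h hv⟩
        simp [h5]
    · intro v m' t' hQ
      by_cases hv : v = 0
      · obtain ⟨a1, a2, a3, a4, a5, a6, a7, a8, a9, rfl⟩ := hQ.2 hv
        rw [if_pos hv]
        rw [← a9.real0] at a5 a6 a8 ⊢
        refine (ih (j + 1) (by omega) (by omega) m' _ a1 a2 a3 a4 a5 a6 a7 a8).mono ?_
        rintro k m'' t'' ⟨b1, b2, b3, b4, b5⟩
        exact ⟨b1, b2, b3, a9.trans b4, by omega⟩
      -- Stopping lowers the limit in register `6` to `j`, so the next test of the loop fails.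
      · obtain ⟨rfl, rfl⟩ := hQ.1 hv
        rw [if_neg hv]
        refine Sim.while_false (by simp [Test.holds, h5]) ⟨by simp [h5], hj, by omega, ?_, by omega⟩
        exact ⟨fun r h1 h2 h3 => by simp [h2, h3], rfl, rfl⟩

lemma poissonProg_spec (n : ℕ) [NeZero n] (lam : ℝ≥0) (hlam : 0 < lam) (m : Mem) (t : ℕ)
    (h0 : m.nat 0 = n) (h1 : m.nat 1 = 0) (hr : m.real 0 = lam) :
    Sim poissonProg ((ProbabilityTheory.poissonMeasure lam).toPMF.map (clampCount n))
      (fun k m' t' => m'.nat 5 = k ∧ 1 ≤ k ∧ k ≤ n ∧ PoissonFrame m m' ∧ t' ≤ t + 20 * k + 22)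
      m t := by
  have hn := NeZero.pos n
  rw [← stopLaw_poissonHazard n lam hlam, ← hr]
  refine WP.seq_sim (WP.block ?_)
  simp only [after_rone, after_rop, after_rexp, after_const, after_copy, after_nil]
  have := poissonLoop_spec n (n - 1) 1 le_rfl (by omega)
  refine (this _ _ ?_ ?_ ?_ ?_ ?_ ?_ ?_ ?_).mono ?_
  · simp [h1]
  · simp
  · simp [h0]
  · simp
  · simp [ROp.eval, poissonProb]
  · simp [ROp.eval, poissonProb, poissonTail, Finset.sum_range_succ]
  · simp
  · simp [ROp.eval, poissonProb, poissonHazard]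
  · rintro k m' t' ⟨b1, b2, b3, b4, b5⟩
    refine ⟨b1, b2, b3, PoissonFrame.trans ⟨fun r h1 h2 h3 => ?_, ?_, ?_⟩ b4, by omega⟩
    · simp [h1, h2]
    · simp
    · simp

/-! ## Linked lists -/

/-- `l` is the linked list with head `h` (`u + 1` stands for a pointer to `u`, and `0` for the end
of the list). -/
def Chain (nxt : ℕ → ℕ) : ℕ → List ℕ → Prop
  | h, [] => h = 0
  | h, u :: l => h = u + 1 ∧ Chain nxt (nxt u) l

lemma Chain.update {nxt : ℕ → ℕ} {h : ℕ} {l : List ℕ} (hl : Chain nxt h l) {u v : ℕ}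
    (hu : u ∉ l) : Chain (Function.update nxt u v) h l := by
  induction l generalizing h with
  | nil => exact hl
  | cons x l ih =>
    rw [List.mem_cons, not_or] at hu
    exact ⟨hl.1, by rw [Function.update_of_ne (Ne.symm hu.1)]; exact ih hl.2 hu.2⟩

lemma Chain.push {nxt : ℕ → ℕ} {h : ℕ} {l : List ℕ} (hl : Chain nxt h l) {u : ℕ}
    (hu : u ∉ l) : Chain (Function.update nxt u h) (u + 1) (u :: l) :=
  ⟨rfl, by rw [Function.update_self]; exact hl.update hu⟩

/-- The positions of `x` in an array of length `ptr`, the last one first. -/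
def positions (data : ℕ → ℕ) (ptr x : ℕ) : List ℕ :=
  ((List.range ptr).filter fun u => data u = x).reverse

lemma mem_positions {data : ℕ → ℕ} {ptr x u : ℕ} :
    u ∈ positions data ptr x ↔ u < ptr ∧ data u = x := by simp [positions]

lemma nodup_positions (data : ℕ → ℕ) (ptr x : ℕ) : (positions data ptr x).Nodup := by
  rw [positions, List.nodup_reverse]
  exact List.nodup_range.filter _

lemma positions_update (data : ℕ → ℕ) (ptr x y : ℕ) :
    positions (Function.update data ptr y) (ptr + 1) x =
      if x = y then ptr :: positions data ptr x else positions data ptr x := by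
  have h : (List.range ptr).filter (fun u => Function.update data ptr y u = x) =
      (List.range ptr).filter fun u => data u = x := by
    refine List.filter_congr fun u hu => ?_
    rw [List.mem_range] at hu
    rw [Function.update_of_ne hu.ne]
  rw [positions, List.range_succ, List.filter_append, List.reverse_append, h]
  split_ifs with hxy
  · simp [hxy, positions]
  · simp [Ne.symm hxy, positions]

/-- Linked lists of the positions of all numbers in an array, and their lengths. -/
def Bags (ptr : ℕ) (data head nxt cnt : ℕ → ℕ) : Prop :=
  ∀ x, Chain nxt (head x) (positions data ptr x) ∧ cnt x = (positions data ptr x).length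

lemma Bags.push {ptr : ℕ} {data head nxt cnt : ℕ → ℕ} (h : Bags ptr data head nxt cnt) (y : ℕ) :
    Bags (ptr + 1) (Function.update data ptr y) (Function.update head y (ptr + 1))
      (Function.update nxt ptr (head y)) (Function.update cnt y (cnt y + 1)) := by
  intro x
  have hptr : ptr ∉ positions data ptr x := fun h => absurd (mem_positions.1 h).1 (lt_irrefl _)
  rw [positions_update]
  split_ifs with hxy
  · subst hxy
    rw [Function.update_self, Function.update_self, List.length_cons, (h x).2]
    exact ⟨(h x).1.push hptr, rfl⟩
  · rw [Function.update_of_ne hxy, Function.update_of_ne hxy]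
    exact ⟨(h x).1.update hptr, (h x).2⟩

lemma bags_zero {nxt : ℕ → ℕ} : Bags 0 0 0 nxt 0 := fun _ => ⟨rfl, rfl⟩

/-- The nodes of a list on each level form a linked list. -/
def Buckets {n : ℕ} (lev hd nx : ℕ → ℕ) (L : List (Fin n)) : Prop :=
  ∀ l, Chain nx (hd l) ((L.filter fun x : Fin n => lev x = l).reverse.map Fin.val)

lemma Buckets.push {n : ℕ} {lev hd nx : ℕ → ℕ} {L : List (Fin n)} (h : Buckets lev hd nx L)
    {x : Fin n} (hx : x ∉ L) :
    Buckets lev (Function.update hd (lev x) (x + 1)) (Function.update nx x (hd (lev x)))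
      (L ++ [x]) := by
  intro l
  have hx' : ∀ l, (x : ℕ) ∉ (L.filter fun x : Fin n => lev x = l).reverse.map Fin.val := by
    intro l hl
    obtain ⟨y, hy, hyx⟩ := List.mem_map.1 hl
    rw [Fin.ext hyx] at hy
    exact hx (List.mem_filter.1 (List.mem_reverse.1 hy)).1
  rw [List.filter_append, List.reverse_append]
  by_cases hl : l = lev x
  · subst hl
    rw [Function.update_self]
    simpa using (h (lev x)).push (hx' _)
  · rw [Function.update_of_ne hl]
    simpa [Ne.symm hl] using (h l).update (hx' l)

lemma buckets_nil {n : ℕ} {lev hd nx : ℕ → ℕ} (h : ∀ l, hd l = 0) :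
    Buckets lev hd nx ([] : List (Fin n)) := fun l => h l

/-! ## The nodes of one subtree -/

/-- Appends the node in register `10` to the node list of the current subtree, and enters it into
the linked lists of its bag and of its level. -/
def pushProg : Prog :=
  -- Array `10` holds the stamps, `13` the owners of positions, `11` and `12` the heads and
  -- successors of the bag lists, `14` the bag sizes, `15` and `16` the heads and successors of the
  -- level lists.
  block [.store 10 10 3, .store 3 4 10, .store 13 4 2, .load 11 11 10, .store 12 4 11, .succ 4 4,
    .store 11 10 4, .load 11 14 10, .succ 11 11, .store 14 10 11, .load 12 9 10, .load 11 15 12,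
    .store 16 10 11, .succ 11 10, .store 15 12 11]

/-- The nodes in the list `s` have been appended to the node list of the subtree `i`. -/
structure Pushed (n i base : ℕ) (m₀ m : Mem) (s : List (Fin n)) : Prop where
  nat0 : m.nat 0 = n
  nat1 : m.nat 1 = 0
  nat2 : m.nat 2 = i
  nat3 : m.nat 3 = i + 1
  ptr : m.nat 4 = base + s.length
  nat14 : m.nat 14 = 1
  real0 : m.real 0 = m₀.real 0
  arr0 : m.arr 0 = m₀.arr 0
  arr1 : m.arr 1 = m₀.arr 1
  arr2 : m.arr 2 = m₀.arr 2
  arr9 : m.arr 9 = m₀.arr 9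
  old3 : ∀ u < base, m.arr 3 u = m₀.arr 3 u
  old13 : ∀ u < base, m.arr 13 u = m₀.arr 13 u
  cur3 : ∀ j (h : j < s.length), m.arr 3 (base + j) = s[j]
  cur13 : ∀ j < s.length, m.arr 13 (base + j) = i
  nodup : s.Nodup
  stamp : ∀ x : Fin n, m.arr 10 x = i + 1 ↔ x ∈ s
  stamp_le : ∀ x, m.arr 10 x ≤ i + 1
  bags : Bags (m.nat 4) (m.arr 3) (m.arr 11) (m.arr 12) (m.arr 14)

/-- Equality of everything on which `Pushed` depends. -/
structure PushedFrame (m m' : Mem) : Prop where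
  nat : ∀ r ∈ [0, 1, 2, 3, 4, 14], m'.nat r = m.nat r
  arr : ∀ r ∈ [0, 1, 2, 3, 9, 10, 11, 12, 13, 14], m'.arr r = m.arr r
  real0 : m'.real 0 = m.real 0

lemma Pushed.congr {n i base : ℕ} {m₀ m m' : Mem} {s : List (Fin n)} (h : Pushed n i base m₀ m s)
    (hm : PushedFrame m m') : Pushed n i base m₀ m' s := by
  have e0 := hm.nat 0 (by simp)
  have e1 := hm.nat 1 (by simp)
  have e2 := hm.nat 2 (by simp)
  have e3 := hm.nat 3 (by simp)
  have e4 := hm.nat 4 (by simp)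
  have e14 := hm.nat 14 (by simp)
  have a0 := hm.arr 0 (by simp)
  have a1 := hm.arr 1 (by simp)
  have a2 := hm.arr 2 (by simp)
  have a3 := hm.arr 3 (by simp)
  have a9 := hm.arr 9 (by simp)
  have a10 := hm.arr 10 (by simp)
  have a11 := hm.arr 11 (by simp)
  have a12 := hm.arr 12 (by simp)
  have a13 := hm.arr 13 (by simp)
  have a14 := hm.arr 14 (by simp)
  have r0 := hm.real0
  obtain ⟨h1, h2, h3, h4, h5, h6, h7, h8, h9, h10, h11, h12, h13, h14, h15, h16, h17, h18, h19⟩ := h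
  rw [← e0] at h1
  rw [← e1] at h2
  rw [← e2] at h3
  rw [← e3] at h4
  rw [← e4] at h5 h19
  rw [← e14] at h6
  rw [← r0] at h7
  rw [← a0] at h8
  rw [← a1] at h9
  rw [← a2] at h10
  rw [← a9] at h11
  rw [← a3] at h12 h14 h19
  rw [← a13] at h13 h15
  rw [← a10] at h17 h18
  rw [← a11, ← a12, ← a14] at h19
  exact ⟨h1, h2, h3, h4, h5, h6, h7, h8, h9, h10, h11, h12, h13, h14, h15, h16, h17, h18, h19⟩

/-- The changes that `pushProg` makes besides those described by `Pushed`. -/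
structure PushFrame (m m' : Mem) (x : ℕ) : Prop where
  nat : ∀ r, r ≠ 4 → r ≠ 11 → r ≠ 12 → m'.nat r = m.nat r
  nat12 : m'.nat 12 = m.arr 9 x
  arr8 : m'.arr 8 = m.arr 8
  arr15 : m'.arr 15 = Function.update (m.arr 15) (m.arr 9 x) (x + 1)
  arr16 : m'.arr 16 = Function.update (m.arr 16) x (m.arr 15 (m.arr 9 x))
  arr17 : m'.arr 17 = m.arr 17

lemma pushProg_spec {n i base : ℕ} {m₀ m : Mem} {s : List (Fin n)} (h : Pushed n i base m₀ m s)
    {x : Fin n} (hx : x ∉ s) (h10 : m.nat 10 = x) (t : ℕ) :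
    WP pushProg (fun m' t' => Pushed n i base m₀ m' (s ++ [x]) ∧ PushFrame m m' x ∧ t' = t + 31)
      m t := by
  refine WP.block ?_
  simp only [after_store, after_load, after_succ, after_nil]
  refine ⟨?_, ⟨?_, ?_, ?_, ?_, ?_, ?_⟩, trivial⟩
  · constructor <;> try simp only [Mem.setNat_nat, Mem.setNat_nat_of_ne, Mem.setNat_arr,
      Mem.setNat_real, Mem.setArr_nat, Mem.setArr_arr, Mem.setArr_arr_of_ne, Mem.setArr_real, h10,
      h.nat0, h.nat1, h.nat2, h.nat3, h.ptr, h.nat14, h.real0, h.arr0, h.arr1, h.arr2, h.arr9, ne_eq,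
      OfNat.one_ne_ofNat, OfNat.zero_ne_ofNat, not_false_eq_true, Nat.reduceEqDiff]
    · simp; omega
    · intro u hu
      rw [Function.update_of_ne (by omega)]; exact h.old3 u hu
    · intro u hu
      rw [Function.update_of_ne (by omega)]; exact h.old13 u hu
    · intro j hj
      rw [List.length_append, List.length_singleton] at hj
      by_cases hjs : j = s.length
      · subst hjs
        simp
      · rw [Function.update_of_ne (by omega), h.cur3 j (by omega), List.getElem_append_left]
    · intro j hj
      rw [List.length_append, List.length_singleton] at hj
      by_cases hjs : j = s.length
      · subst hjs
        simp
      · rw [Function.update_of_ne (by omega), h.cur13 j (by omega)]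
    · exact h.nodup.append (List.nodup_singleton x) (List.disjoint_singleton.2 hx)
    · intro y
      rw [List.mem_append, List.mem_singleton]
      by_cases hyx : y = x
      · subst hyx; simp
      · rw [Function.update_of_ne (fun h => hyx (Fin.ext h)), h.stamp y]
        simp [hyx]
    · intro y
      by_cases hyx : y = x
      · subst hyx; simp
      · rw [Function.update_of_ne hyx]; exact h.stamp_le y
    · have := h.bags.push x
      rw [h.ptr] at this
      simpa using this
  · intro r h1 h2 h3
    simp [h1, h2, h3]
  · simp [h10]
  · simp
  · simp [h10]
  · simp [h10]
  · simp

/-! ## Selecting random nodes -/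

/-- One step of the selection: swap a random entry of the permutation to the position in register
`6`, append this node, and update the largest level in register `8`. -/
def drawStep : Prog :=
  .seq (.instr (.rand 12 6 0)) (.seq (block [.load 13 8 6, .load 10 8 12, .store 8 6 10,
    .store 8 12 13, .succ 6 6]) (.seq pushProg (.ite (.lt 8 12) (block [.copy 8 12]) (block []))))

/-- Selects as many random nodes as register `5` says. -/
def drawProg : Prog :=
  .seq (block [.const 6 0, .const 8 0]) (.seq (.while (.lt 6 5) drawStep) (block [.copy 7 5]))

/-- The nodes in the list `s` have been selected; they are the first entries of the permutation
`σ`. -/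
structure Drawn (n i base k : ℕ) (m₀ : Mem) (s : List (Fin n)) (σ : Equiv.Perm (Fin n)) (m : Mem) :
    Prop where
  pushed : Pushed n i base m₀ m s
  nat5 : m.nat 5 = k
  nat6 : m.nat 6 = s.length
  perm : ∀ x : Fin n, m.arr 8 x = σ x
  mem : ∀ x, x ∈ s ↔ (σ.symm x : ℕ) < s.length
  buckets : Buckets (m₀.arr 9) (m.arr 15) (m.arr 16) s
  arr17 : m.arr 17 = m₀.arr 17
  le_max : ∀ x ∈ s, m₀.arr 9 x ≤ m.nat 8
  max_mem : s ≠ [] → ∃ x ∈ s, m₀.arr 9 (x : Fin n) = m.nat 8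
  max_nil : s = [] → m.nat 8 = 0

/-- Swapping the entries at `s.length` and at the random position puts the new node right behind the
selected ones, so these remain an initial segment of the permutation. -/
lemma drawStep_spec {n i base k : ℕ} {m₀ : Mem} {s : List (Fin n)} {σ : Equiv.Perm (Fin n)}
    {m : Mem} (h : Drawn n i base k m₀ s σ m) (hs : s.length < n) (t : ℕ) :
    Sim drawStep (insertRandom s.toFinset) (fun S m' t' => ∃ s' σ', Drawn n i base k m₀ s' σ' m' ∧
      S = s'.toFinset ∧ s'.length = s.length + 1 ∧ t' ≤ t + 50) m t := by
  rw [insertRandom_eq_map hs σ s.toFinset (by simpa using h.mem)]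
  refine Sim.map _ (Sim.seq_wp (Sim.mono (Q := fun v m' t' => v ∈ (uniformBetween (m.nat 6)
    (m.nat 0)).support ∧ m' = m.setNat 12 v ∧ t' = t + 1 + 1) ?_ ?_))
  · have := Sim.rand 12 6 0 m (t + 1)
    rwa [h.nat6, h.pushed.nat0] at this ⊢
  rintro r m' t' ⟨hr, rfl, rfl⟩
  rw [h.nat6, h.pushed.nat0, mem_support_uniformBetween hs] at hr
  obtain ⟨hr1, hr2⟩ := hr
  simp only [dif_pos hr2]
  set ri : Fin n := ⟨r, hr2⟩ with hri
  set ji : Fin n := ⟨s.length, hs⟩ with hji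
  have hx : σ ri ∉ s := by simp [h.mem, hri, hr1]
  refine WP.seq (WP.block ?_)
  simp only [after_load, after_store, after_succ, after_nil]
  have hpj := h.perm ji
  have hpr := h.perm ri
  simp only [hri, hji] at hpj hpr
  set m1 : Mem := ((((((m.setNat 12 r).setNat 13 _).setNat 10 _).setArr 8 _ _).setArr 8 _ _).setNat
    6 _) with hm1
  have hnat : ∀ q, q ≠ 6 → q ≠ 10 → q ≠ 12 → q ≠ 13 → m1.nat q = m.nat q := by
    intro q h1 h2 h3 h4
    simp [hm1, h1, h2, h3, h4]
  have harr : ∀ q, q ≠ 8 → m1.arr q = m.arr q := by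
    intro q h1
    simp [hm1, h1]
  have hfr : PushedFrame m m1 := by
    refine ⟨fun q hq => hnat q ?_ ?_ ?_ ?_, fun q hq => harr q ?_, by simp [hm1]⟩ <;>
      (rintro rfl; simp at hq)
  have h10 : m1.nat 10 = σ ri := by simp [hm1, hpr, hri]
  have h6 : m1.nat 6 = s.length + 1 := by simp [hm1, h.nat6]
  have h8 : m1.arr 8 = Function.update (Function.update (m.arr 8) s.length (σ ri)) r (σ ji) := by
    simp [hm1, h.nat6, hpj, hpr, hri, hji]
  clear_value m1
  refine WP.seq ((pushProg_spec (h.pushed.congr hfr) hx h10 _).mono ?_)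
  rintro m2 t2 ⟨hpush, hf, rfl⟩
  have e9 : m1.arr 9 = m₀.arr 9 := (harr 9 (by simp)).trans h.pushed.arr9
  -- Both outcomes of the update of the largest level end in a memory of this kind.
  have key : ∀ m3 : Mem, PushedFrame m2 m3 → m3.nat 5 = m2.nat 5 → m3.nat 6 = m2.nat 6 →
      (∀ q ∈ [8, 15, 16, 17], m3.arr q = m2.arr q) →
      m3.nat 8 = max (m.nat 8) (m₀.arr 9 (σ ri)) →
      Drawn n i base k m₀ (s ++ [σ ri]) ((Equiv.swap ji ri).trans σ) m3 := by
    intro m3 hm3 c5 c6 ca c8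
    refine ⟨hpush.congr hm3, ?_, ?_, ?_, ?_, ?_, ?_, ?_, ?_, ?_⟩
    · rw [c5, hf.nat 5 (by simp) (by simp) (by simp), hnat 5 (by simp) (by simp) (by simp) (by simp),
        h.nat5]
    · rw [c6, hf.nat 6 (by simp) (by simp) (by simp), h6]
      simp
    · intro x
      rw [ca 8 (by simp), hf.arr8, h8, Equiv.trans_apply]
      by_cases hxr : x = ri
      · subst hxr
        rw [Equiv.swap_apply_right, Function.update_self]
      · rw [Function.update_of_ne (fun hc => hxr (Fin.ext hc))]
        by_cases hxj : x = ji
        · subst hxj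
          rw [Equiv.swap_apply_left, Function.update_self]
        · rw [Function.update_of_ne (fun hc => hxj (Fin.ext hc)), Equiv.swap_apply_of_ne_of_ne hxj hxr,
            h.perm]
    · intro x
      rw [List.mem_append, List.mem_singleton, h.mem, Equiv.symm_trans_apply, Equiv.symm_swap,
        List.length_append, List.length_singleton]
      have hxs : x = σ ri ↔ σ.symm x = ri := by rw [Equiv.symm_apply_eq]
      rw [hxs]
      generalize σ.symm x = y
      by_cases hyr : y = ri
      · rw [hyr, Equiv.swap_apply_right]
        simp [hji]
      · by_cases hyj : y = ji
        · rw [hyj, Equiv.swap_apply_left]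
          have hne : ri ≠ ji := fun hc => hyr (hyj.trans hc.symm)
          have : r ≠ s.length := fun hc => hne (Fin.ext hc)
          simp only [hji, hri, lt_irrefl, false_or]
          refine ⟨fun hc => absurd hc.symm hne, fun hc => absurd hc ?_⟩
          omega
        · rw [Equiv.swap_apply_of_ne_of_ne hyj hyr]
          have : (y : ℕ) ≠ s.length := fun hc => hyj (Fin.ext hc)
          constructor
          · rintro (hc | hc)
            · omega
            · exact absurd hc hyr
          · intro hc
            left
            omega
    · rw [ca 15 (by simp), ca 16 (by simp), hf.arr15, hf.arr16, e9, harr 15 (by simp),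
        harr 16 (by simp)]
      exact h.buckets.push hx
    · rw [ca 17 (by simp), hf.arr17, harr 17 (by simp), h.arr17]
    · intro x hxs
      rw [c8]
      rcases List.mem_append.1 hxs with hxs | hxs
      · exact (h.le_max x hxs).trans (le_max_left _ _)
      · rw [List.mem_singleton.1 hxs]
        exact le_max_right _ _
    · intro _
      rw [c8]
      by_cases hle : m₀.arr 9 (σ ri) ≤ m.nat 8
      · by_cases hnil : s = []
        · have := h.max_nil hnil
          exact ⟨σ ri, by simp, by omega⟩
        · obtain ⟨x, hx1, hx2⟩ := h.max_mem hnil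
          exact ⟨x, by simp [hx1], by omega⟩
      · exact ⟨σ ri, by simp, by omega⟩
    · intro hc
      simp at hc
  have c12 : m2.nat 12 = m₀.arr 9 (σ ri) := by rw [hf.nat12, e9]
  have c8 : m2.nat 8 = m.nat 8 := by
    rw [hf.nat 8 (by simp) (by simp) (by simp), hnat 8 (by simp) (by simp) (by simp) (by simp)]
  refine WP.ite (fun hT => WP.block ?_) fun hT => WP.block ?_
  · simp only [after_copy, after_nil]
    refine ⟨_, _, key _ ⟨?_, ?_, ?_⟩ ?_ ?_ ?_ ?_, by simp, by simp, by omega⟩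
    · intro q hq
      rw [Mem.setNat_nat_of_ne]
      rintro rfl; simp at hq
    · intro q hq
      simp
    · simp
    · simp
    · simp
    · simp
    · have : m2.nat 8 < m2.nat 12 := by simpa [Test.holds] using hT
      rw [Mem.setNat_nat]
      omega
  · simp only [after_nil]
    refine ⟨_, _, key _ ⟨fun _ _ => rfl, fun _ _ => rfl, rfl⟩ rfl rfl (fun _ _ => rfl) ?_,
      by simp, by simp, by omega⟩
    have : m2.nat 12 ≤ m2.nat 8 := by simpa [Test.holds] using hT
    omega

/-- The initial permutation `σ` is arbitrary: it is what the previous subtree has left behind. -/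
lemma drawProg_spec {n i base k : ℕ} {m₀ m : Mem} {σ : Equiv.Perm (Fin n)} (hk : k ≤ n)
    (hm : Pushed n i base m₀ m []) (h5 : m.nat 5 = k) (hσ : ∀ x : Fin n, m.arr 8 x = σ x)
    (h15 : ∀ l, m.arr 15 l = 0) (h17 : m.arr 17 = m₀.arr 17) (t : ℕ) :
    Sim drawProg (draws n k) (fun S m' t' => ∃ s σ', Drawn n i base k m₀ s σ' m' ∧
      S = s.toFinset ∧ s.length = k ∧ m'.nat 7 = k ∧ t' ≤ t + 51 * k + 11) m t := by
  refine WP.seq_sim (WP.block ?_)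
  simp only [after_const, after_nil]
  refine Sim.seq_wp ?_
  refine Sim.iterate (A := fun _ => Finset (Fin n)) (draws n) (fun _ => insertRandom)
    (fun _ => rfl) (fun j S m' t' => ∃ s σ', Drawn n i base k m₀ s σ' m' ∧
      S = s.toFinset ∧ s.length = j ∧ t' ≤ t + 51 * j + 7) k ?_ ?_ (a₀ := ∅) rfl ?_
  · rintro j hj S m' t' ⟨s, σ', hd, rfl, rfl, ht⟩
    refine ⟨by simp [Test.holds, hd.nat5, hd.nat6, hj], ?_⟩
    refine (drawStep_spec hd (by omega) _).mono ?_
    rintro S m'' t'' ⟨s', σ'', h1, h2, h3, h4⟩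
    exact ⟨s', σ'', h1, h2, h3, by omega⟩
  · rintro S m' t' ⟨s, σ', hd, rfl, hs, ht⟩
    refine ⟨by simp [Test.holds, hd.nat5, hd.nat6, hs], ?_⟩
    refine WP.block ?_
    simp only [after_copy, after_nil]
    refine ⟨s, σ', ?_, rfl, hs, by simp [hd.nat5], by omega⟩
    obtain ⟨h1, h2, h3, h4, h5, h6, h7, h8, h9, h10⟩ := hd
    refine ⟨h1.congr ⟨?_, by simp, by simp⟩, by simpa using h2, by simpa using h3, h4, h5, h6, h7,
      by simpa using h8, by simpa using h9, by simpa using h10⟩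
    intro q hq
    rw [Mem.setNat_nat_of_ne]
    rintro rfl; simp at hq
  · refine ⟨[], σ, ⟨hm.congr ⟨?_, by simp, by simp⟩, by simpa, by simp, by simpa, by simp,
      buckets_nil (by simpa), by simpa, by simp, by simp, by simp⟩, rfl, rfl, by omega⟩
    intro q hq
    rw [Mem.setNat_nat_of_ne, Mem.setNat_nat_of_ne]
    all_goals rintro rfl; simp at hq

/-! ## Connecting the selected nodes -/

/-- Replaces the nodes of the linked list in register `9` by their parents. -/
def popProg : Prog :=
  -- Array `17` counts the subtrees that contain both a node and its parent. If the parent already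
  -- bears the stamp in register `3`, one unprocessed node disappears; otherwise the parent takes
  -- the place of its child and their number is unchanged.
  .while (.ne 9 1) (.seq (block [.pred 13 9, .load 9 16 13, .load 11 17 13, .succ 11 11,
    .store 17 13 11, .pred 12 13, .load 10 1 12, .load 11 10 10])
    (.ite (.eq 11 3) (block [.pred 7 7]) pushProg))

/-- Connects the selected nodes. Register `7` holds the number of unprocessed nodes, and register
`8` holds the current level. -/
def connectProg : Prog :=
  .seq (.while (.lt 14 7) (.seq (block [.load 9 15 8, .store 15 8 1])
    (.seq popProg (block [.pred 8 8])))) (block [.store 15 8 1])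

/-- The nodes of a list on the levels up to `d`. -/
def lowNodes {n : ℕ} (lev : ℕ → ℕ) (d : ℕ) (s : List (Fin n)) : List (Fin n) :=
  s.filter fun x : Fin n => lev x ≤ d

lemma mem_lowNodes {n : ℕ} {lev : ℕ → ℕ} {d : ℕ} {s : List (Fin n)} {x : Fin n} :
    x ∈ lowNodes lev d s ↔ x ∈ s ∧ lev x ≤ d := by simp [lowNodes]

lemma nodup_lowNodes {n : ℕ} {lev : ℕ → ℕ} {d : ℕ} {s : List (Fin n)} (h : s.Nodup) :
    (lowNodes lev d s).Nodup := h.filter _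

/-- The state while the level `d + 1` is being processed: the nodes in `xs` still have to be
replaced by their parents. -/
structure PopInv {n : ℕ} [NeZero n] (i base : ℕ) (m₀ : Mem) (T : SimpleGraph (Fin n)) (d : ℕ)
    (S : Finset (Fin n)) (perm : ℕ → ℕ) (limit : ℕ) (s xs : List (Fin n)) (m : Mem) (t : ℕ) :
    Prop where
  pushed : Pushed n i base m₀ m s
  nat8 : m.nat 8 = d + 1
  nat7 : m.nat 7 = (lowNodes (m₀.arr 9) d s).length + xs.length
  chain : Chain (m.arr 16) (m.nat 9) (xs.map Fin.val)
  mem : ∀ x ∈ xs, x ∈ s ∧ m₀.arr 9 (x : Fin n) = d + 1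
  nodup : xs.Nodup
  buckets : Buckets (m₀.arr 9) (m.arr 15) (m.arr 16) (lowNodes (m₀.arr 9) d s)
  target : s.toFinset ∪ xs.toFinset.image (bfsParent T 0) = S
  parent : ∀ x ∈ s, d < m₀.arr 9 (x : Fin n) → x ∈ xs ∨ bfsParent T 0 x ∈ s
  count : ∀ x : Fin n, m.arr 17 x =
    m₀.arr 17 x + if x ∈ s ∧ d < m₀.arr 9 x ∧ x ∉ xs then 1 else 0
  perm : m.arr 8 = perm
  time : t + 51 * xs.length ≤ limit

/-- The parent is on level `d`, so it is never among the pending nodes of level `d + 1`. The facts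
`hcount'`, `htarget'` and `hparent'` depend only on the members of the new list and serve both
branches. -/
lemma popProg_step {n : ℕ} [NeZero n] {i base : ℕ} {m₀ : Mem} {T : SimpleGraph (Fin n)} {d : ℕ}
    (hT : IsHost T (m₀.arr 0) (m₀.arr 1) (m₀.arr 9)) {S : Finset (Fin n)} {perm : ℕ → ℕ}
    {limit : ℕ} {s xs : List (Fin n)} {x : Fin n} {m : Mem} {t : ℕ}
    (h : PopInv i base m₀ T d S perm limit s (x :: xs) m t) :
    WP (.seq (block [.pred 13 9, .load 9 16 13, .load 11 17 13, .succ 11 11,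
      .store 17 13 11, .pred 12 13, .load 10 1 12, .load 11 10 10])
      (.ite (.eq 11 3) (block [.pred 7 7]) pushProg))
      (fun m' t' => ∃ s', PopInv i base m₀ T d S perm limit s' xs m' t') m (t + 1) := by
  obtain ⟨hpushed, h8, h7, ⟨h9, hchain⟩, hmem, hnodup, hbuckets, htarget, hparent, hcount, hperm,
    htime⟩ := h
  obtain ⟨hxs, hlx⟩ := hmem x (by simp)
  have hx0 : (x : ℕ) ≠ 0 := by
    intro h0
    rw [h0, hT.lev_zero] at hlx
    omega
  set y := bfsParent T 0 x with hy
  have hyb : (y : ℕ) = m₀.arr 1 (x - 1) := hT.parent_eq hx0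
  have hly : m₀.arr 9 y = d := by
    have := hT.lev_eq x.2 hx0
    rw [← hyb] at this
    omega
  have hxne : x ∉ xs := (List.nodup_cons.1 hnodup).1
  have hnodup' := (List.nodup_cons.1 hnodup).2
  have hcount' : ∀ s' : List (Fin n), (∀ z, z ∈ s' ↔ z ∈ s ∨ z = y) → ∀ z : Fin n,
      Function.update (m.arr 17) x (m.arr 17 x + 1) z =
      m₀.arr 17 z + if z ∈ s' ∧ d < m₀.arr 9 z ∧ z ∉ xs then 1 else 0 := by
    intro s' hs' z
    by_cases hzx : z = x
    · subst hzx
      rw [Function.update_self, hcount, if_neg (by simp),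
        if_pos ⟨(hs' _).2 (Or.inl hxs), by omega, hxne⟩]
    · rw [Function.update_of_ne (fun hc => hzx (Fin.ext hc)), hcount]
      congr 1
      refine if_congr ?_ rfl rfl
      rw [hs', List.mem_cons, not_or]
      constructor
      · rintro ⟨h1, h2, -, h3⟩
        exact ⟨Or.inl h1, h2, h3⟩
      · rintro ⟨h1 | rfl, h2, h3⟩
        · exact ⟨h1, h2, hzx, h3⟩
        · omega
  have htarget' : ∀ s' : List (Fin n), (∀ z, z ∈ s' ↔ z ∈ s ∨ z = y) →
      s'.toFinset ∪ xs.toFinset.image (bfsParent T 0) = S := by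
    intro s' hs'
    rw [← htarget]
    ext z
    simp only [Finset.mem_union, List.mem_toFinset, Finset.mem_image, hs', List.mem_cons]
    constructor
    · rintro ((h1 | h1) | ⟨w, h1, h2⟩)
      · exact Or.inl h1
      · exact Or.inr ⟨x, Or.inl rfl, h1.symm⟩
      · exact Or.inr ⟨w, Or.inr h1, h2⟩
    · rintro (h1 | ⟨w, rfl | h1, h2⟩)
      · exact Or.inl (Or.inl h1)
      · exact Or.inl (Or.inr h2.symm)
      · exact Or.inr ⟨w, h1, h2⟩
  have hparent' : ∀ s' : List (Fin n), (∀ z, z ∈ s' ↔ z ∈ s ∨ z = y) → ∀ z ∈ s',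
      d < m₀.arr 9 (z : Fin n) → z ∈ xs ∨ bfsParent T 0 z ∈ s' := by
    intro s' hs' z hz hlz
    rcases (hs' z).1 hz with hz | rfl
    · rcases hparent z hz hlz with h1 | h1
      · rcases List.mem_cons.1 h1 with rfl | h1
        · exact Or.inr ((hs' _).2 (Or.inr rfl))
        · exact Or.inl h1
      · exact Or.inr ((hs' _).2 (Or.inl h1))
    · omega
  rw [List.length_cons] at h7 htime
  refine WP.seq (WP.block ?_)
  simp only [after_pred, after_load, after_succ, after_store, after_nil]
  set m1 : Mem := Mem.setNat (Mem.setNat _ 10 _) 11 _ with hm1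
  have hnat : ∀ q, q ≠ 9 → q ≠ 10 → q ≠ 11 → q ≠ 12 → q ≠ 13 → m1.nat q = m.nat q := by
    intro q h1 h2 h3 h4 h5
    simp [hm1, h1, h2, h3, h4, h5]
  have harr : ∀ q, q ≠ 17 → m1.arr q = m.arr q := by
    intro q h1
    simp [hm1, h1]
  have hfr : PushedFrame m m1 := by
    refine ⟨fun q hq => hnat q ?_ ?_ ?_ ?_ ?_, fun q hq => harr q ?_, by simp [hm1]⟩ <;>
      (rintro rfl; simp at hq)
  have g9 : m1.nat 9 = m.arr 16 x := by simp [hm1, h9]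
  have g10 : m1.nat 10 = y := by simp [hm1, h9, hpushed.arr1, hyb]
  have g11 : m1.nat 11 = m.arr 10 y := by simp [hm1, h9, hpushed.arr1, hyb]
  have g17 : m1.arr 17 = Function.update (m.arr 17) x (m.arr 17 x + 1) := by simp [hm1, h9]
  have g3 : m1.nat 3 = i + 1 := by
    rw [hnat 3 (by simp) (by simp) (by simp) (by simp) (by simp), hpushed.nat3]
  have g7 : m1.nat 7 = m.nat 7 := hnat 7 (by simp) (by simp) (by simp) (by simp) (by simp)
  have g8 : m1.nat 8 = m.nat 8 := hnat 8 (by simp) (by simp) (by simp) (by simp) (by simp)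
  clear_value m1
  have hp1 := hpushed.congr hfr
  refine WP.ite (fun hB => WP.block ?_) fun hB => ?_
  · have hys : y ∈ s := by
      rw [← hpushed.stamp, ← g11, ← g3]
      simpa [Test.holds] using hB
    have hs' : ∀ z, z ∈ s ↔ z ∈ s ∨ z = y :=
      fun z => ⟨Or.inl, fun hz => hz.elim id fun hz => hz ▸ hys⟩
    simp only [after_pred, after_nil]
    refine ⟨s, hp1.congr ⟨?_, by simp, by simp⟩, by simp [g8, h8], ?_, ?_,
      fun z hz => hmem z (List.mem_cons_of_mem _ hz), hnodup', ?_, htarget' s hs', hparent' s hs',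
      ?_, ?_, by omega⟩
    · intro q hq
      rw [Mem.setNat_nat_of_ne]
      rintro rfl; simp at hq
    · rw [Mem.setNat_nat, g7, h7]
      omega
    · simpa [g9, harr] using hchain
    · simpa [harr] using hbuckets
    · simpa [g17] using hcount' s hs'
    · simpa [harr] using hperm
  · have hys : y ∉ s := by
      rw [← hpushed.stamp, ← g11, ← g3]
      simpa [Test.holds] using hB
    have hs' : ∀ z, z ∈ s ++ [y] ↔ z ∈ s ∨ z = y := fun z => by simp
    have hlow : lowNodes (m₀.arr 9) d (s ++ [y]) = lowNodes (m₀.arr 9) d s ++ [y] := by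
      simp [lowNodes, List.filter_append, hly]
    refine (pushProg_spec hp1 hys g10 _).mono ?_
    rintro m2 t2 ⟨hp2, hf, rfl⟩
    have e9 : m1.arr 9 y = d := by rw [hp1.arr9, hly]
    refine ⟨s ++ [y], hp2, ?_, ?_, ?_, fun z hz => ?_, hnodup', ?_, htarget' _ hs', hparent' _ hs',
      ?_, ?_, by omega⟩
    · rw [hf.nat 8 (by simp) (by simp) (by simp), g8, h8]
    · rw [hf.nat 7 (by simp) (by simp) (by simp), g7, h7, hlow]
      simp
      omega
    · rw [hf.nat 9 (by simp) (by simp) (by simp), hf.arr16, g9, harr 16 (by simp)]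
      refine hchain.update ?_
      intro hc
      obtain ⟨z, hz, hzy⟩ := List.mem_map.1 hc
      have := (hmem z (List.mem_cons_of_mem _ hz)).2
      rw [hzy, hly] at this
      omega
    · obtain ⟨h1, h2⟩ := hmem z (List.mem_cons_of_mem _ hz)
      exact ⟨(hs' z).2 (Or.inl h1), h2⟩
    · rw [hf.arr15, hf.arr16, hlow, hp1.arr9, harr 15 (by simp), harr 16 (by simp)]
      exact hbuckets.push fun hc => hys (mem_lowNodes.1 hc).1
    · rw [hf.arr17, g17]
      exact hcount' _ hs'
    · rw [hf.arr8, harr 8 (by simp), hperm]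

lemma popProg_spec {n : ℕ} [NeZero n] {i base : ℕ} {m₀ : Mem} {T : SimpleGraph (Fin n)} {d : ℕ}
    (hT : IsHost T (m₀.arr 0) (m₀.arr 1) (m₀.arr 9)) {S : Finset (Fin n)} {perm : ℕ → ℕ}
    {limit : ℕ} {s xs : List (Fin n)} {m : Mem} {t : ℕ}
    (h : PopInv i base m₀ T d S perm limit s xs m t) :
    WP popProg (fun m' t' => ∃ s', PopInv i base m₀ T d S perm (limit + 1) s' [] m' t') m t := by
  refine WP.while (ι := List (Fin n) × List (Fin n))
    (fun p m t => PopInv i base m₀ T d S perm limit p.1 p.2 m t) (fun p => p.2.length) ?_ ?_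
    (i := (s, xs)) h
  · rintro ⟨s, xs⟩ m t h hB
    cases xs with
    | nil =>
      have h9 : m.nat 9 = 0 := h.chain
      simp [Test.holds, h9, h.pushed.nat1] at hB
    | cons x xs =>
      refine (popProg_step hT h).mono ?_
      rintro m' t' ⟨s', h'⟩
      exact ⟨(s', xs), by simp, h'⟩
  · rintro ⟨s, xs⟩ m t h hB
    cases xs with
    | nil =>
      obtain ⟨h1, h2, h3, h4, h5, h6, h7, h8, h9, h10, h11, h12⟩ := h
      exact ⟨s, h1, h2, h3, h4, h5, h6, h7, h8, h9, h10, h11,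
        by simp only [List.length_nil] at h12 ⊢; omega⟩
    | cons x xs =>
      have h9 := h.chain.1
      simp [Test.holds, h9, h.pushed.nat1] at hB

/-- The state between two levels: the levels above `d` have been processed. -/
structure ConnectInv {n : ℕ} [NeZero n] (i base : ℕ) (m₀ : Mem) (T : SimpleGraph (Fin n))
    (V : Finset (Fin n)) (perm : ℕ → ℕ) (limit : ℕ) (d : ℕ) (s : List (Fin n)) (m : Mem) (t : ℕ) :
    Prop where
  pushed : Pushed n i base m₀ m s
  nat8 : m.nat 8 = d
  nat7 : m.nat 7 = (lowNodes (m₀.arr 9) d s).length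
  buckets : Buckets (m₀.arr 9) (m.arr 15) (m.arr 16) (lowNodes (m₀.arr 9) d s)
  target : connectLoop T 0 d s.toFinset (upTo T 0 d s.toFinset) = V
  level : ∃ x ∈ s, m₀.arr 9 (x : Fin n) = d
  parent : ∀ x ∈ s, d < m₀.arr 9 (x : Fin n) → bfsParent T 0 x ∈ s
  count : ∀ x : Fin n, m.arr 17 x = m₀.arr 17 x + if x ∈ s ∧ d < m₀.arr 9 x then 1 else 0
  perm : m.arr 8 = perm
  time : t ≤ limit + 70 * (s.filter fun x : Fin n => d < m₀.arr 9 x).length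

/-- By `h.level` there is a node on level `d + 1`. Replacing the nodes costs 51 steps each, and the
other 19 of the 70 allotted to each absorb the overhead of the round. The parent of such a node
keeps level `d` occupied. -/
lemma connectProg_step {n : ℕ} [NeZero n] {i base : ℕ} {m₀ : Mem} {T : SimpleGraph (Fin n)}
    (hT : IsHost T (m₀.arr 0) (m₀.arr 1) (m₀.arr 9)) {V : Finset (Fin n)} {perm : ℕ → ℕ}
    {limit d : ℕ} {s : List (Fin n)} {m : Mem} {t : ℕ}
    (h : ConnectInv i base m₀ T V perm limit (d + 1) s m t)
    (hlow : 1 < (lowNodes (m₀.arr 9) (d + 1) s).length) :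
    WP (.seq (block [.load 9 15 8, .store 15 8 1]) (.seq popProg (block [.pred 8 8])))
      (fun m' t' => ∃ s', ConnectInv i base m₀ T V perm limit d s' m' t') m (t + 1) := by
  set xs := (s.filter fun x : Fin n => m₀.arr 9 x = d + 1).reverse with hxs
  have hmem : ∀ x : Fin n, x ∈ xs ↔ x ∈ s ∧ m₀.arr 9 x = d + 1 := by simp [hxs]
  have hlen : ((lowNodes (m₀.arr 9) (d + 1) s)).length =
      (lowNodes (m₀.arr 9) d s).length + xs.length := by
    rw [hxs, List.length_reverse]
    clear hmem hxs xs hlow h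
    induction s with
    | nil => rfl
    | cons x s ih =>
      simp only [lowNodes, List.filter_cons, decide_eq_true_eq] at ih ⊢
      by_cases h1 : m₀.arr 9 x = d + 1
      · rw [if_pos (by omega), if_neg (by omega), if_pos h1, List.length_cons, List.length_cons, ih]
        omega
      · by_cases h2 : m₀.arr 9 x ≤ d
        · rw [if_pos (by omega), if_pos h2, if_neg h1, List.length_cons, List.length_cons, ih]
          omega
        · rw [if_neg (by omega), if_neg h2, if_neg h1, ih]
  have hfil : (s.filter fun x : Fin n => d < m₀.arr 9 x).length =
      (s.filter fun x : Fin n => d + 1 < m₀.arr 9 x).length + xs.length := by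
    rw [hxs, List.length_reverse]
    clear hmem hxs xs hlow h hlen
    induction s with
    | nil => rfl
    | cons x s ih =>
      simp only [List.filter_cons, decide_eq_true_eq] at ih ⊢
      by_cases h1 : m₀.arr 9 x = d + 1
      · rw [if_pos (by omega), if_neg (by omega), if_pos h1, List.length_cons, List.length_cons, ih]
        omega
      · by_cases h2 : d < m₀.arr 9 x
        · rw [if_pos h2, if_pos (by omega), if_neg h1, List.length_cons, List.length_cons, ih]
          omega
        · rw [if_neg h2, if_neg (by omega), if_neg h1, ih]
  obtain ⟨z, hz, hlz⟩ := h.level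
  have hxpos : 0 < xs.length := List.length_pos_of_mem ((hmem z).2 ⟨hz, hlz⟩)
  have hlowlow : ∀ l, (lowNodes (m₀.arr 9) d s).filter (fun x : Fin n => m₀.arr 9 x = l) =
      if l ≤ d then (lowNodes (m₀.arr 9) (d + 1) s).filter (fun x : Fin n => m₀.arr 9 x = l)
      else [] := by
    intro l
    split_ifs with hl
    · simp only [lowNodes, List.filter_filter]
      refine List.filter_congr fun x _ => ?_
      by_cases hx : m₀.arr 9 x = l
      · simp [hx, hl, Nat.le_succ_of_le hl]
      · simp [hx]
    · rw [List.filter_eq_nil_iff]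
      intro x hx
      have := (mem_lowNodes.1 hx).2
      simp
      omega
  have htop : (lowNodes (m₀.arr 9) (d + 1) s).filter (fun x : Fin n => m₀.arr 9 x = d + 1) =
      s.filter fun x : Fin n => m₀.arr 9 x = d + 1 := by
    simp only [lowNodes, List.filter_filter]
    refine List.filter_congr fun x _ => ?_
    by_cases hx : m₀.arr 9 x = d + 1 <;> simp [hx]
  refine WP.seq (WP.block ?_)
  simp only [after_load, after_store, after_nil]
  refine WP.seq ((popProg_spec (S := s.toFinset ∪ xs.toFinset.image (bfsParent T 0)) (perm := perm)
    (d := d) (limit := t + 1 + 7 + 51 * xs.length) hT (s := s) (xs := xs)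
    ⟨h.pushed.congr ⟨?_, ?_, by simp⟩, by simp [h.nat8], by simp [h.nat7, hlen], ?_,
      fun x hx => (hmem x).1 hx, ?_, ?_, rfl, ?_, ?_, by simp [h.perm], by omega⟩).mono ?_)
  · intro q hq
    rw [Mem.setArr_nat, Mem.setNat_nat_of_ne]
    rintro rfl; simp at hq
  · intro q hq
    rw [Mem.setArr_arr_of_ne, Mem.setNat_arr]
    rintro rfl; simp at hq
  · have := h.buckets (d + 1)
    rw [htop] at this
    simpa [h.nat8, hxs] using this
  · rw [hxs, List.nodup_reverse]
    exact h.pushed.nodup.filter _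
  · intro l
    have := h.buckets l
    rw [hlowlow]
    by_cases hl : l = d + 1
    · subst hl
      simp [h.nat8, h.pushed.nat1, Chain]
    · split_ifs with hld
      · simpa [h.nat8, hl] using this
      · have hnil : (lowNodes (m₀.arr 9) (d + 1) s).filter
            (fun x : Fin n => m₀.arr 9 x = l) = [] := by
          rw [List.filter_eq_nil_iff]
          intro x hx
          have := (mem_lowNodes.1 hx).2
          simp
          omega
        rw [hnil] at this
        simpa [h.nat8, hl] using this
  · intro x hx hlx
    by_cases h1 : m₀.arr 9 x = d + 1
    · exact Or.inl ((hmem x).2 ⟨hx, h1⟩)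
    · exact Or.inr (h.parent x hx (by omega))
  · intro x
    simp only [Mem.setArr_arr_of_ne, Mem.setNat_arr, ne_eq, Nat.reduceEqDiff, not_false_eq_true,
      h.count, hmem]
    congr 1
    refine if_congr ?_ rfl rfl
    constructor
    · rintro ⟨h1, h2⟩
      exact ⟨h1, by omega, by omega⟩
    · rintro ⟨h1, h2, h3⟩
      refine ⟨h1, ?_⟩
      have : m₀.arr 9 x ≠ d + 1 := fun hc => h3 ⟨h1, hc⟩
      omega
  · rintro m' t' ⟨s', h'⟩
    refine WP.block ?_
    simp only [after_pred, after_nil]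
    have hsub : ∀ x ∈ s, x ∈ s' := by
      intro x hx
      have hS := h'.target
      simp only [List.toFinset_nil, Finset.image_empty, Finset.union_empty] at hS
      rw [← List.mem_toFinset, hS]
      simp [hx]
    have hS' : s'.toFinset = s.toFinset ∪
        (s.toFinset.filter fun x => T.dist 0 x = d + 1).image (bfsParent T 0) := by
      have hS := h'.target
      simp only [List.toFinset_nil, Finset.image_empty, Finset.union_empty] at hS
      rw [hS]
      congr 2
      ext x
      simp [hmem, hT.dist_eq]
    have hcard : 1 < (upTo T 0 (d + 1) s.toFinset).card := by
      have : upTo T 0 (d + 1) s.toFinset = (lowNodes (m₀.arr 9) (d + 1) s).toFinset := by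
        ext x
        simp [mem_upTo, mem_lowNodes, hT.dist_eq]
      rw [this, List.toFinset_card_of_nodup (nodup_lowNodes h.pushed.nodup)]
      exact hlow
    refine ⟨s', h'.pushed.congr ⟨?_, by simp, by simp⟩, by simp [h'.nat8], ?_, ?_, ?_, ?_, ?_, ?_, ?_,
      ?_⟩
    · intro q hq
      rw [Mem.setNat_nat_of_ne]
      rintro rfl; simp at hq
    · simpa using h'.nat7
    · simpa using h'.buckets
    · rw [← connectLoop_succ hT hcard hS']
      exact h.target
    · have hz0 : (z : ℕ) ≠ 0 := by
        intro hc
        rw [hc, hT.lev_zero] at hlz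
        omega
      refine ⟨bfsParent T 0 z, ?_, ?_⟩
      · rcases h'.parent z (hsub z hz) (by omega) with h1 | h1
        · simp at h1
        · exact h1
      · have := hT.lev_eq z.2 hz0
        rw [hT.parent_eq hz0]
        omega
    · intro x hx hlx
      rcases h'.parent x hx hlx with h1 | h1
      · simp at h1
      · exact h1
    · intro x
      have := h'.count x
      simpa using this
    · simpa using h'.perm
    · have h1 := h'.time
      have h2 := h.time
      have h3 : (s.filter fun x : Fin n => d < m₀.arr 9 x).length ≤
          (s'.filter fun x : Fin n => d < m₀.arr 9 x).length := by
        refine List.Subperm.length_le (List.subperm_of_subset (h.pushed.nodup.filter _) ?_)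
        intro x hx
        simp only [List.mem_filter] at hx ⊢
        exact ⟨hsub x hx.1, hx.2⟩
      rw [List.length_nil] at h1
      omega

/-- At the end at most one collected node is left on the levels up to `d`, the top of the subtree.
So the processed nodes are exactly those whose parent is in `V`, which is what array `17` records.
-/
lemma connectProg_spec {n : ℕ} [NeZero n] {i base : ℕ} {m₀ : Mem} {T : SimpleGraph (Fin n)}
    (hT : IsHost T (m₀.arr 0) (m₀.arr 1) (m₀.arr 9)) {V : Finset (Fin n)} {perm : ℕ → ℕ}
    {limit d : ℕ} {s : List (Fin n)} {m : Mem} {t : ℕ}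
    (h : ConnectInv i base m₀ T V perm limit d s m (t + 1)) :
    WP connectProg (fun m' t' => ∃ s, Pushed n i base m₀ m' s ∧ s.toFinset = V ∧
      (∀ l, m'.arr 15 l = 0) ∧ m'.arr 8 = perm ∧
      (∀ x ∈ V, ∀ y ∈ V, y < x → bfsParent T 0 x ∈ V) ∧
      (∀ x : Fin n, (x : ℕ) ≠ 0 →
        m'.arr 17 x = m₀.arr 17 x + if x ∈ V ∧ bfsParent T 0 x ∈ V then 1 else 0) ∧
      t' ≤ limit + 70 * s.length + 4) m t := by
  refine WP.seq (WP.while (ι := ℕ × List (Fin n))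
    (fun p m t => ConnectInv i base m₀ T V perm limit p.1 p.2 m t) (fun p => p.1) ?_ ?_
    (i := (d, s)) h)
  · rintro ⟨d, s⟩ m t h hB
    have hlow : 1 < (lowNodes (m₀.arr 9) d s).length := by
      have h7 := h.nat7
      have h14 := h.pushed.nat14
      simp only [Test.holds, decide_eq_true_eq] at hB
      dsimp only at h7
      omega
    cases d with
    -- Level `0` contains only the root, so the loop is never entered with `d = 0`.
    | zero =>
      exfalso
      have hsub : (lowNodes (m₀.arr 9) 0 s) ⊆ [0] := by
        intro x hx
        have hx := (mem_lowNodes.1 hx).2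
        rw [List.mem_singleton]
        by_contra hne
        have := hT.lev_pos x.2 (fun hc => hne (Fin.ext hc))
        omega
      have := (List.subperm_of_subset (nodup_lowNodes h.pushed.nodup) hsub).length_le
      simp only [List.length_singleton] at this
      omega
    | succ d =>
      refine (connectProg_step hT h hlow).mono ?_
      rintro m' t' ⟨s', h'⟩
      exact ⟨(d, s'), Nat.lt_succ_self d, h'⟩
  · rintro ⟨d, s⟩ m t h hB
    have hlow : (lowNodes (m₀.arr 9) d s).length ≤ 1 := by
      have h7 := h.nat7
      have h14 := h.pushed.nat14
      simp only [Test.holds, decide_eq_false_iff_not] at hB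
      dsimp only at h7
      omega
    have hupTo : upTo T 0 d s.toFinset = (lowNodes (m₀.arr 9) d s).toFinset := by
      ext x
      simp [mem_upTo, mem_lowNodes, hT.dist_eq]
    have hcard : (upTo T 0 d s.toFinset).card ≤ 1 := by
      rw [hupTo]
      exact (List.toFinset_card_le _).trans hlow
    have hV : s.toFinset = V := by
      rw [← h.target]
      exact (connectLoop_of_card_le T 0 hcard).symm
    have hmemV : ∀ x, x ∈ V ↔ x ∈ s := fun x => by rw [← hV, List.mem_toFinset]
    have hdist : ∀ x ∈ s.toFinset, d < T.dist 0 x → bfsParent T 0 x ∈ s.toFinset := by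
      intro x hx hd
      rw [List.mem_toFinset] at hx ⊢
      rw [hT.dist_eq] at hd
      exact h.parent x hx hd
    have hsubtree : ∀ x ∈ V, ∀ y ∈ V, y < x → d < m₀.arr 9 x := by
      intro x hx y hy hyx
      rw [← hT.dist_eq]
      rw [← hV] at hx hy
      exact isSubtree_of_upTo hT hdist hcard hx hy hyx
    refine WP.block ?_
    simp only [after_store, after_nil]
    refine ⟨s, h.pushed.congr ⟨by simp, ?_, by simp⟩, hV, ?_, by simpa using h.perm, ?_, ?_, ?_⟩
    · intro q hq
      rw [Mem.setArr_arr_of_ne]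
      rintro rfl; simp at hq
    -- Only the bucket of the last node, on level `d`, can still be occupied, and the final store
    -- empties it. So the next subtree starts with empty buckets.
    · intro l
      rw [Mem.setArr_arr, h.nat8, h.pushed.nat1]
      by_cases hl : l = d
      · rw [hl, Function.update_self]
      · rw [Function.update_of_ne hl]
        have hb := h.buckets l
        have hnil : (lowNodes (m₀.arr 9) d s).filter (fun x : Fin n => m₀.arr 9 x = l) = [] := by
          rw [List.filter_eq_nil_iff]
          intro x hx
          obtain ⟨z, hz, hlz⟩ := h.level
          have hz' : z ∈ lowNodes (m₀.arr 9) d s := mem_lowNodes.2 ⟨hz, hlz.le⟩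
          have hxz : x = z := by
            obtain ⟨w, hw⟩ := List.length_eq_one_iff.1
              (le_antisymm hlow (List.length_pos_of_mem hz'))
            rw [hw, List.mem_singleton] at hx hz'
            rw [hx, hz']
          rw [hxz, hlz]
          simpa using Ne.symm hl
        dsimp only at hb
        rw [hnil] at hb
        exact hb
    · intro x hx y hy hyx
      exact (hmemV _).2 (h.parent x ((hmemV x).1 hx) (hsubtree x hx y hy hyx))
    · intro x hx0
      rw [Mem.setArr_arr_of_ne _ _ _ _ _ (by simp), h.count]
      congr 1
      refine if_congr ?_ rfl rfl
      rw [hmemV, hmemV]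
      constructor
      · rintro ⟨h1, h2⟩
        exact ⟨h1, h.parent x h1 h2⟩
      · rintro ⟨h1, h2⟩
        exact ⟨h1, hsubtree x ((hmemV x).2 h1) _ ((hmemV _).2 h2) (hT.parent_lt hx0)⟩
    · have h1 := h.time
      have h2 := List.length_filter_le (fun x : Fin n => decide (d < m₀.arr 9 x)) s
      dsimp only at h1
      omega

/-! ## Generating the subtrees -/

/-- Generates one subtree. -/
def subtreeProg : Prog :=
  .seq (block [.succ 3 2]) (.seq poissonProg (.seq drawProg (.seq connectProg
    (block [.copy 2 3, .store 2 2 4]))))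

/-- Generates all subtrees. -/
def subtreesProg : Prog := .seq (block [.const 2 0]) (.while (.lt 2 0) subtreeProg)

/-! ### Lists stored as segments of an array -/

lemma listAt_congr {n i : ℕ} {off off' data data' : ℕ → ℕ} (h1 : off' i = off i)
    (h2 : off' (i + 1) = off (i + 1)) (h3 : ∀ u < off (i + 1), data' u = data u) :
    listAt n off' data' i = listAt n off data i := by
  unfold listAt
  rw [h1, h2, Finset.image_congr fun u hu => h3 u (Finset.mem_Ico.1 hu).2]

lemma listOK_congr {n i : ℕ} {off off' data data' : ℕ → ℕ} (h1 : off' i = off i)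
    (h2 : off' (i + 1) = off (i + 1)) (h3 : ∀ u < off (i + 1), data' u = data u)
    (h : ListOK n off data i) : ListOK n off' data' i := by
  unfold ListOK
  rw [h1, h2]
  refine ⟨fun u hu => ?_, fun u hu v hv huv => ?_⟩
  · rw [h3 u (Finset.mem_Ico.1 hu).2]
    exact h.1 u hu
  · rw [h3 u (Finset.mem_Ico.1 hu).2, h3 v (Finset.mem_Ico.1 hv).2] at huv
    exact h.2 hu hv huv

lemma listAt_eq_toFinset {n i : ℕ} {off data : ℕ → ℕ} {s : List (Fin n)}
    (h : off (i + 1) = off i + s.length) (hs : ∀ j (hj : j < s.length), data (off i + j) = s[j]) :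
    listAt n off data i = s.toFinset := by
  ext x
  simp only [listAt, Finset.mem_filter, Finset.mem_univ, true_and, Finset.mem_image, Finset.mem_Ico,
    List.mem_toFinset]
  constructor
  · rintro ⟨u, ⟨h1, h2⟩, h3⟩
    obtain ⟨j, rfl⟩ := Nat.exists_eq_add_of_le h1
    rw [hs j (by omega)] at h3
    rw [← Fin.ext h3]
    exact List.getElem_mem _
  · intro hx
    obtain ⟨j, hj, rfl⟩ := List.getElem_of_mem hx
    exact ⟨off i + j, ⟨by omega, by omega⟩, hs j hj⟩

lemma listOK_of_nodup {n i : ℕ} {off data : ℕ → ℕ} {s : List (Fin n)}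
    (h : off (i + 1) = off i + s.length) (hs : ∀ j (hj : j < s.length), data (off i + j) = s[j])
    (hn : s.Nodup) : ListOK n off data i := by
  refine ⟨fun u hu => ?_, fun u hu v hv huv => ?_⟩
  · obtain ⟨h1, h2⟩ := Finset.mem_Ico.1 hu
    obtain ⟨j, rfl⟩ := Nat.exists_eq_add_of_le h1
    rw [hs j (by omega)]
    exact Fin.is_lt _
  · obtain ⟨h1, h2⟩ := Finset.mem_Ico.1 hu
    obtain ⟨h3, h4⟩ := Finset.mem_Ico.1 hv
    obtain ⟨j, rfl⟩ := Nat.exists_eq_add_of_le h1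
    obtain ⟨k, rfl⟩ := Nat.exists_eq_add_of_le h3
    rw [hs j (by omega), hs k (by omega)] at huv
    rw [hn.getElem_inj_iff.1 (Fin.ext huv)]

/-- The state after the subtrees `0, …, i - 1` have been generated; their node sets are the values
of `f`. -/
structure GenInv {n : ℕ} [NeZero n] (lam : ℝ) (T : SimpleGraph (Fin n)) (limit i : ℕ)
    (f : Fin i → Finset (Fin n)) (m : Mem) (t : ℕ) : Prop where
  nat0 : m.nat 0 = n
  nat1 : m.nat 1 = 0
  nat2 : m.nat 2 = i
  nat14 : m.nat 14 = 1
  real0 : m.real 0 = lam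
  host : IsHost T (m.arr 0) (m.arr 1) (m.arr 9)
  perm : ∃ σ : Equiv.Perm (Fin n), ∀ x : Fin n, m.arr 8 x = σ x
  stamp : ∀ x, m.arr 10 x ≤ i
  buckets : ∀ l, m.arr 15 l = 0
  bags : Bags (m.nat 4) (m.arr 3) (m.arr 11) (m.arr 12) (m.arr 14)
  off : m.arr 2 i = m.nat 4
  off_le : ∀ j ≤ i, m.arr 2 j ≤ m.nat 4
  listOK : ∀ j < i, ListOK n (m.arr 2) (m.arr 3) j
  family : ∀ j : Fin i, f j = listAt n (m.arr 2) (m.arr 3) j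
  owner : ∀ u < m.nat 4, m.arr 13 u < i ∧ m.arr 2 (m.arr 13 u) ≤ u ∧ u < m.arr 2 (m.arr 13 u + 1)
  owner_eq : ∀ j < i, ∀ u, m.arr 2 j ≤ u → u < m.arr 2 (j + 1) → m.arr 13 u = j
  nonempty : ∀ j, (f j).Nonempty
  subtree : ∀ j, ∀ x ∈ f j, ∀ y ∈ f j, y < x → bfsParent T 0 x ∈ f j
  count : ∀ x : Fin n, (x : ℕ) ≠ 0 →
    m.arr 17 x = (Finset.univ.filter fun j => x ∈ f j ∧ bfsParent T 0 x ∈ f j).card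
  ptr : m.nat 4 = ∑ j, (f j).card
  time : t ≤ limit + 300 * m.nat 4

lemma selectNodes_eq_draws (n k : ℕ) [NeZero n] : selectNodes n k = draws n (clampCount n k) := by
  rw [draws_eq n _ (clampCount_le n k), selectNodes]

lemma randomSubtree_eq {n : ℕ} [NeZero n] (lam : ℝ≥0) (T : SimpleGraph (Fin n)) (r : Fin n) :
    randomSubtree lam T r =
      ((ProbabilityTheory.poissonMeasure lam).toPMF.map (clampCount n)).bind fun c =>
        (draws n c).bind fun X => PMF.pure (connectNodes T r X) := by
  rw [randomSubtree, PMF.bind_map]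
  congr 1
  funext k
  rw [selectNodes_eq_draws]
  rfl

lemma GenInv.snoc {n : ℕ} [NeZero n] {lam : ℝ} {T : SimpleGraph (Fin n)} {limit i : ℕ}
    {f : Fin i → Finset (Fin n)} {m : Mem} {t : ℕ} (h : GenInv lam T limit i f m t)
    {s : List (Fin n)} {m' m'' : Mem} {t' : ℕ} {σ : Equiv.Perm (Fin n)} {V : Finset (Fin n)}
    (hp : Pushed n i (m.nat 4) m m' s) (hV : s.toFinset = V) (hbuckets : ∀ l, m'.arr 15 l = 0)
    (hperm : ∀ x : Fin n, m'.arr 8 x = σ x) (hne : s ≠ [])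
    (hsubtree : ∀ x ∈ V, ∀ y ∈ V, y < x → bfsParent T 0 x ∈ V)
    (hcount : ∀ x : Fin n, (x : ℕ) ≠ 0 →
        m'.arr 17 x = m.arr 17 x + if x ∈ V ∧ bfsParent T 0 x ∈ V then 1 else 0)
    (hm'' : m'' = (m'.setNat 2 (i + 1)).setArr 2 (i + 1) (m.nat 4 + s.length))
    (ht : t' ≤ limit + 300 * (m.nat 4 + s.length)) :
    GenInv lam T limit (i + 1) (Fin.snoc f V : Fin (i + 1) → Finset (Fin n)) m'' t' := by
  have harr2 : m''.arr 2 = Function.update (m.arr 2) (i + 1) (m.nat 4 + s.length) := by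
    simp [hm'', hp.arr2]
  have harr : ∀ q, q ≠ 2 → m''.arr q = m'.arr q := by
    intro q hq
    simp [hm'', hq]
  have hnat : ∀ q, q ≠ 2 → m''.nat q = m'.nat q := by
    intro q hq
    simp [hm'', hq]
  have hoff : ∀ j ≤ i, m''.arr 2 j = m.arr 2 j := by
    intro j hj
    rw [harr2, Function.update_of_ne (by omega)]
  have hoff' : m''.arr 2 (i + 1) = m.nat 4 + s.length := by rw [harr2, Function.update_self]
  have hcur : ∀ j (hj : j < s.length), m''.arr 3 (m''.arr 2 i + j) = s[j] := by
    intro j hj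
    rw [hoff i le_rfl, h.off, harr 3 (by simp)]
    exact hp.cur3 j hj
  have hseg : m''.arr 2 (i + 1) = m''.arr 2 i + s.length := by
    rw [hoff', hoff i le_rfl, h.off]
  have hold : ∀ j < i, ∀ u < m.arr 2 (j + 1), m''.arr 3 u = m.arr 3 u := by
    intro j hj u hu
    rw [harr 3 (by simp)]
    exact hp.old3 u (hu.trans_le (h.off_le _ hj))
  have hlist : listAt n (m''.arr 2) (m''.arr 3) i = V := by
    rw [← hV]
    exact listAt_eq_toFinset hseg hcur
  have h4 : m''.nat 4 = m.nat 4 + s.length := by rw [hnat 4 (by simp), hp.ptr]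
  have hVcard : V.card = s.length := by rw [← hV, List.toFinset_card_of_nodup hp.nodup]
  refine ⟨?_, ?_, ?_, ?_, ?_, ?_, ?_, ?_, ?_, ?_, ?_, ?_, ?_, ?_, ?_, ?_, ?_, ?_, ?_, ?_, ?_⟩
  · rw [hnat 0 (by simp), hp.nat0]
  · rw [hnat 1 (by simp), hp.nat1]
  · simp [hm'']
  · rw [hnat 14 (by simp), hp.nat14]
  · rw [← h.real0, ← hp.real0, hm'']
    simp
  · rw [harr 0 (by simp), harr 1 (by simp), harr 9 (by simp), hp.arr0, hp.arr1, hp.arr9]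
    exact h.host
  · exact ⟨σ, by rwa [harr 8 (by simp)]⟩
  · rw [harr 10 (by simp)]
    exact hp.stamp_le
  · rwa [harr 15 (by simp)]
  · rw [hnat 4 (by simp), harr 3 (by simp), harr 11 (by simp), harr 12 (by simp), harr 14 (by simp)]
    exact hp.bags
  · rw [hoff', h4]
  · intro j hj
    rw [h4]
    rcases Nat.le_succ_iff.1 hj with hj | rfl
    · rw [hoff j hj]
      exact (h.off_le j hj).trans (Nat.le_add_right _ _)
    · rw [hoff']
  · intro j hj
    rcases Nat.lt_succ_iff_lt_or_eq.1 hj with hj | rfl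
    · exact listOK_congr (hoff j hj.le) (hoff _ hj) (hold j hj) (h.listOK j hj)
    · exact listOK_of_nodup hseg hcur hp.nodup
  · intro j
    refine Fin.lastCases ?_ (fun j => ?_) j
    · rw [Fin.snoc_last, Fin.val_last, hlist]
    · rw [Fin.snoc_castSucc, Fin.val_castSucc, h.family j]
      exact (listAt_congr (hoff j j.2.le) (hoff _ j.2) (hold j j.2)).symm
  · intro u hu
    rw [h4] at hu
    rw [harr 13 (by simp)]
    by_cases hub : u < m.nat 4
    · obtain ⟨h1, h2, h3⟩ := h.owner u hub
      rw [hp.old13 u hub, hoff _ h1.le, hoff _ h1]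
      exact ⟨by omega, h2, h3⟩
    · obtain ⟨j, rfl⟩ := Nat.exists_eq_add_of_le (not_lt.1 hub)
      rw [hp.cur13 j (by omega), hoff', hoff i le_rfl, h.off]
      exact ⟨by omega, by omega, by omega⟩
  · intro j hj u hu1 hu2
    rw [harr 13 (by simp)]
    rcases Nat.lt_succ_iff_lt_or_eq.1 hj with hj | rfl
    · rw [hoff j hj.le] at hu1
      rw [hoff _ hj] at hu2
      rw [hp.old13 u (hu2.trans_le (h.off_le _ hj))]
      exact h.owner_eq j hj u hu1 hu2
    · rw [hoff j le_rfl, h.off] at hu1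
      rw [hoff'] at hu2
      obtain ⟨k, rfl⟩ := Nat.exists_eq_add_of_le hu1
      exact hp.cur13 k (by omega)
  · intro j
    refine Fin.lastCases ?_ (fun j => ?_) j
    · rw [Fin.snoc_last, ← hV]
      obtain ⟨x, hx⟩ := List.exists_mem_of_ne_nil s hne
      exact ⟨x, List.mem_toFinset.2 hx⟩
    · rw [Fin.snoc_castSucc]
      exact h.nonempty j
  · intro j
    refine Fin.lastCases ?_ (fun j => ?_) j
    · rw [Fin.snoc_last]
      exact hsubtree
    · rw [Fin.snoc_castSucc]
      exact h.subtree j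
  · intro x hx
    rw [harr 17 (by simp), hcount x hx, h.count x hx]
    simp only [Finset.card_filter, Fin.sum_univ_castSucc, Fin.snoc_castSucc, Fin.snoc_last]
  · rw [h4, h.ptr, Fin.sum_univ_castSucc]
    simp [hVcard]
  · rw [h4]
    exact ht

lemma connectInv_of_drawn {n : ℕ} [NeZero n] {T : SimpleGraph (Fin n)} {i base k : ℕ} {m₀ m : Mem}
    (hT : IsHost T (m₀.arr 0) (m₀.arr 1) (m₀.arr 9)) {s : List (Fin n)} {σ : Equiv.Perm (Fin n)}
    (h : Drawn n i base k m₀ s σ m) (hs : s ≠ []) (h7 : m.nat 7 = s.length) {t limit : ℕ}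
    (ht : t ≤ limit) :
    ConnectInv i base m₀ T (connectNodes T 0 s.toFinset) (m.arr 8) limit (m.nat 8) s m t := by
  have hlow : lowNodes (m₀.arr 9) (m.nat 8) s = s := by
    rw [lowNodes, List.filter_eq_self]
    intro x hx
    simpa using h.le_max x hx
  have hup : upTo T 0 (m.nat 8) s.toFinset = s.toFinset := by
    ext x
    rw [mem_upTo, hT.dist_eq, List.mem_toFinset]
    exact ⟨fun h => h.1, fun hx => ⟨hx, h.le_max x hx⟩⟩
  have hsup : (s.toFinset.sup fun x => T.dist 0 x) = m.nat 8 := by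
    refine le_antisymm (Finset.sup_le fun x hx => ?_) ?_
    · rw [hT.dist_eq]
      exact h.le_max x (List.mem_toFinset.1 hx)
    · obtain ⟨x, hx, hx8⟩ := h.max_mem hs
      rw [← hx8, ← hT.dist_eq]
      exact Finset.le_sup (f := fun x => T.dist 0 x) (List.mem_toFinset.2 hx)
  have hno : ∀ x ∈ s, ¬ m.nat 8 < m₀.arr 9 (x : Fin n) := fun x hx => not_lt.2 (h.le_max x hx)
  refine ⟨h.pushed, rfl, by rw [hlow, h7], by rw [hlow]; exact h.buckets, ?_, h.max_mem hs,
    fun x hx hd => absurd hd (hno x hx), fun x => ?_, rfl, by omega⟩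
  · rw [hup, connectNodes, hsup]
  · rw [if_neg fun hc => hno x hc.1 hc.2, h.arr17, Nat.add_zero]

/-- Sampling is linear in the number `k ≥ 1` of selected nodes, and connecting is linear in the size
of the subtree, which is at least `k`. So 300 steps per node also cover the constant terms. -/
lemma subtreeProg_spec {n : ℕ} [NeZero n] (lam : ℝ≥0) (hlam : 0 < lam) {T : SimpleGraph (Fin n)}
    {limit i : ℕ} {f : Fin i → Finset (Fin n)} {m : Mem} {t : ℕ}
    (h : GenInv lam T limit i f m t) :
    Sim subtreeProg (randomSubtree lam T 0) (fun V m' t' =>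
      GenInv lam T limit (i + 1) (Fin.snoc f V : Fin (i + 1) → Finset (Fin n)) m' (t' + 1))
      m (t + 1) := by
  rw [randomSubtree_eq]
  refine WP.seq_sim (WP.block ?_)
  simp only [after_succ, after_nil]
  refine Sim.seq (poissonProg_spec n lam hlam _ _ (by simp [h.nat0]) (by simp [h.nat1])
    (by simp [h.real0])) ?_
  rintro k m1 t1 ⟨g5, hk1, hkn, hf, ht1⟩
  have hnat : ∀ q, q ≠ 3 → q ≠ 5 → q ≠ 6 → q ≠ 11 → m1.nat q = m.nat q := by
    intro q h1 h2 h3 h4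
    rw [hf.nat q h2 h3 h4, Mem.setNat_nat_of_ne _ _ _ _ h1]
  have harr : m1.arr = m.arr := hf.arr
  have hp : Pushed n i (m.nat 4) m m1 [] := by
    refine ⟨?_, ?_, ?_, ?_, ?_, ?_, ?_, ?_, ?_, ?_, ?_, ?_, ?_, ?_, ?_, List.nodup_nil, ?_, ?_, ?_⟩
    · rw [hnat 0 (by simp) (by simp) (by simp) (by simp), h.nat0]
    · rw [hnat 1 (by simp) (by simp) (by simp) (by simp), h.nat1]
    · rw [hnat 2 (by simp) (by simp) (by simp) (by simp), h.nat2]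
    · rw [hf.nat 3 (by simp) (by simp) (by simp), Mem.setNat_nat, h.nat2]
    · rw [hnat 4 (by simp) (by simp) (by simp) (by simp)]
      rfl
    · rw [hnat 14 (by simp) (by simp) (by simp) (by simp), h.nat14]
    · rw [hf.real0, Mem.setNat_real]
    all_goals try rw [harr]
    · intro u _
      rfl
    · intro u _
      rfl
    · intro j hj
      simp at hj
    · intro j hj
      simp at hj
    · intro x
      have := h.stamp x
      simp
      omega
    · intro x
      have := h.stamp x
      omega
    · rw [hnat 4 (by simp) (by simp) (by simp) (by simp)]
      exact h.bags
  obtain ⟨σ, hσ⟩ := h.perm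
  refine Sim.seq (drawProg_spec hkn hp g5 (σ := σ) (by rwa [harr]) (by rw [harr]; exact h.buckets)
    (by rw [harr]) _) ?_
  rintro X m2 t2 ⟨s, σ', hd, rfl, hs, g7, ht2⟩
  have hsne : s ≠ [] := by
    rintro rfl
    simp at hs
    omega
  refine Sim.of_wp (WP.seq ((connectProg_spec h.host (connectInv_of_drawn h.host hd hsne
    (g7.trans hs.symm) (limit := t2 + 1 + 1) le_rfl)).mono ?_))
  rintro m3 t3 ⟨s', hp', hV, hb, hperm, hsub, hcount, ht3⟩
  have hsub' : s.toFinset ⊆ s'.toFinset := by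
    rw [hV]
    exact subset_connectLoop _ _ _ _ _
  have hlen : s.length ≤ s'.length := by
    have := Finset.card_le_card hsub'
    rwa [List.toFinset_card_of_nodup hd.pushed.nodup,
      List.toFinset_card_of_nodup hp'.nodup] at this
  refine WP.block ?_
  simp only [after_copy, after_store, after_nil]
  have ht := h.time
  refine h.snoc (σ := σ') hp' hV hb (by rw [hperm]; exact hd.perm) ?_ hsub hcount ?_ ?_
  · rintro rfl
    exact hsne (by simpa using hlen)
  · simp [hp'.nat3, hp'.ptr]
  · omega

lemma subtreesProg_spec {n : ℕ} [NeZero n] (lam : ℝ≥0) (hlam : 0 < lam) {T : SimpleGraph (Fin n)}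
    {limit : ℕ} {m : Mem} {t : ℕ}
    (h : GenInv lam T limit 0 Fin.elim0 (m.setNat 2 0) (t + 4)) :
    Sim subtreesProg (iidSamples (randomSubtree lam T 0) n)
      (fun f m' t' => GenInv lam T (limit + 1) n f m' t') m t := by
  refine WP.seq_sim (WP.block ?_)
  simp only [after_const, after_nil]
  refine Sim.iterate (A := fun j => Fin j → Finset (Fin n)) (iidSamples (randomSubtree lam T 0))
    (fun j f => (randomSubtree lam T 0).bind fun a => PMF.pure (Fin.snoc f a)) (fun j => rfl)
    (fun j f m t => GenInv lam T limit j f m t) n ?_ ?_ (a₀ := Fin.elim0) rfl h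
  · intro j hj f m t hI
    refine ⟨by simp [Test.holds, hI.nat0, hI.nat2, hj], ?_⟩
    refine Sim.map _ ((subtreeProg_spec lam hlam hI).mono ?_)
    intro V m' t' h'
    obtain ⟨h1, h2, h3, h4, h5, h6, h7, h8, h9, h10, h11, h12, h13, h14, h15, h16, h17, h18, h19, h20,
      h21⟩ := h'
    exact ⟨h1, h2, h3, h4, h5, h6, h7, h8, h9, h10, h11, h12, h13, h14, h15, h16, h17, h18, h19, h20,
      by omega⟩
  · intro f m t hI
    refine ⟨by simp [Test.holds, hI.nat0, hI.nat2], ?_⟩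
    obtain ⟨h1, h2, h3, h4, h5, h6, h7, h8, h9, h10, h11, h12, h13, h14, h15, h16, h17, h18, h19, h20,
      h21⟩ := hI
    exact ⟨h1, h2, h3, h4, h5, h6, h7, h8, h9, h10, h11, h12, h13, h14, h15, h16, h17, h18, h19, h20,
      by omega⟩

/-! ## The bags of the host tree -/

/-- The indices of the subtrees that contain the node `x`. -/
def bagNodes (n : ℕ) [NeZero n] (m : Mem) (x : ℕ) : List (Fin n) :=
  (positions (m.arr 3) (m.nat 4) x).map fun u => Fin.ofNat n (m.arr 13 u)

/-! ### Members, sizes and intersections of the bags -/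

section bags

variable {n : ℕ} [NeZero n] {lam : ℝ} {T : SimpleGraph (Fin n)} {limit : ℕ}
  {f : Fin n → Finset (Fin n)} {m : Mem} {t : ℕ}

lemma GenInv.val_owner (h : GenInv lam T limit n f m t) {u : ℕ} (hu : u < m.nat 4) :
    ((Fin.ofNat n (m.arr 13 u) : Fin n) : ℕ) = m.arr 13 u := by
  simp [Nat.mod_eq_of_lt (h.owner u hu).1]

lemma GenInv.mem_family (h : GenInv lam T limit n f m t) (x j : Fin n) :
    x ∈ f j ↔ ∃ u, m.arr 2 j ≤ u ∧ u < m.arr 2 (j + 1) ∧ m.arr 3 u = x := by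
  rw [h.family j]
  simp [listAt, and_assoc]

lemma GenInv.mem_bagNodes (h : GenInv lam T limit n f m t) (x j : Fin n) :
    j ∈ bagNodes n m x ↔ x ∈ f j := by
  rw [h.mem_family, bagNodes, List.mem_map]
  constructor
  · rintro ⟨u, hu, rfl⟩
    obtain ⟨h1, h2⟩ := mem_positions.1 hu
    obtain ⟨-, h3, h4⟩ := h.owner u h1
    rw [h.val_owner h1]
    exact ⟨u, h3, h4, h2⟩
  · rintro ⟨u, h1, h2, h3⟩
    have hu : u < m.nat 4 := h2.trans_le (h.off_le _ j.2)
    refine ⟨u, mem_positions.2 ⟨hu, h3⟩, Fin.ext ?_⟩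
    rw [h.val_owner hu, h.owner_eq j j.2 u h1 h2]

/-- Two positions of `x` with the same owner lie in the same list, whose entries are distinct. -/
lemma GenInv.nodup_bagNodes (h : GenInv lam T limit n f m t) (x : ℕ) : (bagNodes n m x).Nodup := by
  refine List.Nodup.map_on ?_ (nodup_positions _ _ _)
  intro u hu v hv huv
  obtain ⟨h1, h2⟩ := mem_positions.1 hu
  obtain ⟨h3, h4⟩ := mem_positions.1 hv
  have huv' := congrArg Fin.val huv
  rw [h.val_owner h1, h.val_owner h3] at huv'
  obtain ⟨h5, h6, h7⟩ := h.owner u h1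
  obtain ⟨h8, h9, h10⟩ := h.owner v h3
  rw [← huv'] at h9 h10
  exact (h.listOK _ h5).2 (Finset.mem_Ico.2 ⟨h6, h7⟩) (Finset.mem_Ico.2 ⟨h9, h10⟩) (h2.trans h4.symm)

/-- The set of the indices of the subtrees that contain the node `x`. -/
def bag (n : ℕ) [NeZero n] (m : Mem) (x : ℕ) : Finset (Fin n) := (bagNodes n m x).toFinset

lemma GenInv.mem_bag (h : GenInv lam T limit n f m t) (x j : Fin n) :
    j ∈ bag n m x ↔ x ∈ f j := by
  rw [bag, List.mem_toFinset, h.mem_bagNodes]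

lemma GenInv.card_bag (h : GenInv lam T limit n f m t) (x : ℕ) :
    (bag n m x).card = m.arr 14 x := by
  rw [bag, List.toFinset_card_of_nodup (h.nodup_bagNodes x), (h.bags x).2, bagNodes, List.length_map]

lemma GenInv.parent_lt (h : GenInv lam T limit n f m t) {x : ℕ} (hx : x < n) (h0 : x ≠ 0) :
    m.arr 1 (x - 1) < x := by
  have := h.host.le (x - 1) (by omega)
  omega

/-- An index lies in both bags iff its subtree contains the edge from `x` to the parent; having this
number at hand makes the inclusion tests take constant time. -/
lemma GenInv.card_inter_parent (h : GenInv lam T limit n f m t) {x : ℕ} (hx : x < n) (h0 : x ≠ 0) :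
    (bag n m x ∩ bag n m (m.arr 1 (x - 1))).card = m.arr 17 x := by
  rw [h.count ⟨x, hx⟩ h0]
  congr 1
  ext j
  have hp := h.host.parent_eq (x := ⟨x, hx⟩) h0
  dsimp only at hp
  rw [Finset.mem_inter, ← hp]
  simp [h.mem_bag ⟨x, hx⟩ j, h.mem_bag (bfsParent T 0 ⟨x, hx⟩) j]

/-- A subtree with a node before `x` does not have `x` as its top, so it contains the parent of `x`.
The node `y` need not be an ancestor. -/
lemma GenInv.mem_bag_parent (h : GenInv lam T limit n f m t) {x y : ℕ} (hx : x < n) (hy : y < x)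
    {v : Fin n} (hvy : v ∈ bag n m y) (hvx : v ∈ bag n m x) : v ∈ bag n m (m.arr 1 (x - 1)) := by
  have h0 : x ≠ 0 := by omega
  have hp := h.host.parent_eq (x := ⟨x, hx⟩) h0
  dsimp only at hp
  rw [← hp, h.mem_bag]
  exact h.subtree v _ ((h.mem_bag ⟨x, hx⟩ v).1 hvx) ⟨y, hy.trans hx⟩
    ((h.mem_bag ⟨y, hy.trans hx⟩ v).1 hvy) hy

lemma GenInv.isSubtree (h : GenInv lam T limit n f m t) (j : Fin n) :
    IsSubtree (fun x => m.arr 1 (x - 1)) {x | ∃ y ∈ f j, (y : ℕ) = x} := by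
  rintro x ⟨x, hx, rfl⟩ y ⟨y, hy, rfl⟩ hyx
  exact ⟨bfsParent T 0 x, h.subtree j x hx y hy hyx, h.host.parent_eq (by omega)⟩

/-- Double counting of the incidences between nodes and subtrees. -/
lemma GenInv.sum_card_bag (h : GenInv lam T limit n f m t) :
    ∑ x : Fin n, (bag n m x).card = ∑ j, (f j).card := by
  have h1 : ∀ x : Fin n, (bag n m x).card = ∑ j : Fin n, if x ∈ f j then 1 else 0 := by
    intro x
    rw [← Finset.card_filter]
    congr 1
    ext j
    simp [h.mem_bag]
  have h2 : ∀ j : Fin n, (f j).card = ∑ x : Fin n, if x ∈ f j then 1 else 0 := by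
    intro j
    rw [← Finset.card_filter]
    congr 1
    ext x
    simp
  simp only [h1, h2]
  exact Finset.sum_comm

end bags

/-! ## Computing the clique tree -/

/-- Computes the clique tree: the arrays `18` and `19` map nodes to cliques and cliques to nodes,
the arrays `6` and `7` list the edges, and register `3` counts the cliques. -/
def cliqueProg : Prog :=
  .seq (block [.const 2 1, .const 3 1, .store 18 1 1, .store 19 1 1])
    (.while (.lt 2 0) (.seq (block [.pred 13 2, .load 12 1 13, .load 10 18 12, .load 11 19 10,
      .load 11 14 11, .load 12 14 2, .load 13 17 2])
      (.seq (.ite (.eq 13 12) (block [.store 18 2 10]) (.ite (.eq 13 11)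
        (block [.store 18 2 10, .store 19 10 2])
        (block [.store 18 2 3, .store 19 3 2, .pred 13 3, .store 6 13 3, .store 7 13 10,
          .succ 3 3]))) (block [.succ 2 2]))))

/-- The state after the nodes below `x` have been processed. -/
structure CliqueInv (n : ℕ) [NeZero n] (m₀ : Mem) (limit x : ℕ) (m : Mem) (t : ℕ) : Prop where
  nat0 : m.nat 0 = n
  nat1 : m.nat 1 = 0
  nat2 : m.nat 2 = x
  arr : ∀ q, q ≠ 6 → q ≠ 7 → q ≠ 18 → q ≠ 19 → m.arr q = m₀.arr q
  pos : 0 < x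
  le : x ≤ n
  tree : PartialCliqueTree (bag n m₀) x (m.nat 3) (m.arr 18) (m.arr 19) (m.arr 7)
  child : ∀ j < m.nat 3 - 1, m.arr 6 j = j + 1
  time : t ≤ limit + 50 * x

lemma cliqueProg_spec {n : ℕ} [NeZero n] {lam : ℝ} {T : SimpleGraph (Fin n)} {limit₀ : ℕ}
    {f : Fin n → Finset (Fin n)} {m₀ : Mem} {t₀ : ℕ} (h : GenInv lam T limit₀ n f m₀ t₀) (t : ℕ) :
    WP cliqueProg (CliqueInv n m₀ (t + 50) n) m₀ t := by
  have hn := NeZero.pos n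
  refine WP.seq (WP.block ?_)
  simp only [after_const, after_store, after_nil]
  refine WP.while (ι := ℕ) (fun x m t' => CliqueInv n m₀ (t + 10) x m t') (fun x => n - x) ?_ ?_
    (i := 1) ?_
  · intro x m t' hI hB
    have hxn : x < n := by simpa [Test.holds, hI.nat0, hI.nat2] using hB
    have hx0 : x ≠ 0 := hI.pos.ne'
    have hpx := h.parent_lt hxn hx0
    set p := m₀.arr 1 (x - 1) with hp
    have hint : ∀ y < x, ∀ v, v ∈ bag n m₀ y → v ∈ bag n m₀ x → v ∈ bag n m₀ p :=
      fun y hy v h1 h2 => h.mem_bag_parent hxn hy h1 h2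
    have hce := h.card_inter_parent hxn hx0
    rw [← hp] at hce
    have e1 := hI.arr 1 (by simp) (by simp) (by simp) (by simp)
    have e14 := hI.arr 14 (by simp) (by simp) (by simp) (by simp)
    have e17 := hI.arr 17 (by simp) (by simp) (by simp) (by simp)
    have ht := hI.time
    refine WP.seq (WP.block ?_)
    simp only [after_pred, after_load, after_nil]
    set m1 : Mem := Mem.setNat (Mem.setNat _ 12 _) 13 _ with hm1
    have hnat : ∀ q, q ≠ 10 → q ≠ 11 → q ≠ 12 → q ≠ 13 → m1.nat q = m.nat q := by
      intro q h1 h2 h3 h4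
      simp [hm1, h1, h2, h3, h4]
    have harr : m1.arr = m.arr := by simp [hm1]
    have g10 : m1.nat 10 = m.arr 18 p := by simp [hm1, hI.nat2, e1, hp]
    have g11 : m1.nat 11 = (bag n m₀ (m.arr 19 (m.arr 18 p))).card := by
      simp [hm1, hI.nat2, e1, e14, hp, h.card_bag]
    have g12 : m1.nat 12 = (bag n m₀ x).card := by
      simp [hm1, hI.nat2, e14, h.card_bag]
    have g13 : m1.nat 13 = (bag n m₀ x ∩ bag n m₀ p).card := by
      simp [hm1, hI.nat2, e17, hce]
    have g0 := hnat 0 (by simp) (by simp) (by simp) (by simp)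
    have g1 := hnat 1 (by simp) (by simp) (by simp) (by simp)
    have g2 := hnat 2 (by simp) (by simp) (by simp) (by simp)
    have g3 := hnat 3 (by simp) (by simp) (by simp) (by simp)
    clear_value m1
    -- The three branches share the final increment of `x`.
    have hfin : ∀ (m2 : Mem) (t2 : ℕ), m2.nat 0 = n → m2.nat 1 = 0 → m2.nat 2 = x →
        (∀ q, q ≠ 6 → q ≠ 7 → q ≠ 18 → q ≠ 19 → m2.arr q = m.arr q) →
        PartialCliqueTree (bag n m₀) (x + 1) (m2.nat 3) (m2.arr 18) (m2.arr 19) (m2.arr 7) →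
        (∀ j < m2.nat 3 - 1, m2.arr 6 j = j + 1) → t2 ≤ t' + 46 →
        WP (block [.succ 2 2])
          (fun m' t' => ∃ x', n - x' < n - x ∧ CliqueInv n m₀ (t + 10) x' m' t') m2 t2 := by
      intro m2 t2 c0 c1 c2 ca ct cc ct2
      refine WP.block ?_
      simp only [after_succ, after_nil]
      refine ⟨x + 1, by omega, by simpa using c0, by simpa using c1, by simp [c2], ?_, by omega,
        by omega, by simpa using ct, by simpa using cc, by omega⟩
      intro q h1 h2 h3 h4
      rw [Mem.setNat_arr, ca q h1 h2 h3 h4, hI.arr q h1 h2 h3 h4]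
    have hskip : bag n m₀ x ⊆ bag n m₀ p ↔ m1.nat 13 = m1.nat 12 := by
      rw [g13, g12]
      constructor
      · intro hs
        rw [Finset.inter_eq_left.2 hs]
      · intro hc
        exact Finset.inter_eq_left.1 (Finset.eq_of_subset_of_card_le Finset.inter_subset_left hc.ge)
    have hrepl : bag n m₀ (m.arr 19 (m.arr 18 p)) ⊆ bag n m₀ x ↔ m1.nat 13 = m1.nat 11 := by
      -- By `hint`, the clique of `p` meets the bag of `x` only inside the bag of `p`. So the count
      -- for the edge to `p` decides this inclusion as well.
      have heq : bag n m₀ x ∩ bag n m₀ p = bag n m₀ x ∩ bag n m₀ (m.arr 19 (m.arr 18 p)) := by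
        ext v
        simp only [Finset.mem_inter]
        refine and_congr_right fun hv => ⟨fun hvp => hI.tree.subset p hpx hvp, fun hvz => ?_⟩
        exact hint _ (hI.tree.bot_lt _ (hI.tree.cls_lt p hpx)) v hvz hv
      rw [g13, g11, heq]
      constructor
      · intro hs
        rw [Finset.inter_eq_right.2 hs]
      · intro hc
        exact Finset.inter_eq_right.1
          (Finset.eq_of_subset_of_card_le Finset.inter_subset_right hc.ge)
    refine WP.seq (WP.ite (fun hB => WP.block ?_) fun hB => WP.ite (fun hB' => WP.block ?_)
      fun hB' => WP.block ?_)
    · have hsub := hskip.2 (by simpa [Test.holds] using hB)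
      simp only [after_store, after_nil]
      refine hfin _ _ (by simp [g0, hI.nat0]) (by simp [g1, hI.nat1]) (by simp [g2, hI.nat2]) ?_ ?_ ?_
        (by omega)
      · intro q h1 h2 h3 h4
        simp [harr, h3]
      · have := hI.tree.skip hpx hsub
        simpa [harr, g2, g3, g10, hI.nat2] using this
      · simpa [harr, g3] using hI.child
    · have hnot := hskip.not.2 (by simpa [Test.holds] using hB)
      have hsub := hrepl.2 (by simpa [Test.holds] using hB')
      simp only [after_store, after_nil]
      refine hfin _ _ (by simp [g0, hI.nat0]) (by simp [g1, hI.nat1]) (by simp [g2, hI.nat2]) ?_ ?_ ?_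
        (by omega)
      · intro q h1 h2 h3 h4
        simp [harr, h3, h4]
      · have := hI.tree.replace hpx hint hnot hsub
        simpa [harr, g2, g3, g10, hI.nat2] using this
      · simpa [harr, g3] using hI.child
    · have hnot := hskip.not.2 (by simpa [Test.holds] using hB)
      have hnot' := hrepl.not.2 (by simpa [Test.holds] using hB')
      simp only [after_store, after_pred, after_succ, after_nil]
      refine hfin _ _ (by simp [g0, hI.nat0]) (by simp [g1, hI.nat1]) (by simp [g2, hI.nat2]) ?_ ?_ ?_
        (by omega)
      · intro q h1 h2 h3 h4
        simp [harr, h1, h2, h3, h4]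
      · have := hI.tree.add hpx hint hnot hnot'
        simpa [harr, g2, g3, g10, hI.nat2] using this
      · have hq := hI.tree.pos
        intro j hj
        replace hj : j < m.nat 3 := by simpa [g3] using hj
        by_cases hjq : j = m.nat 3 - 1
        · simp [harr, g3, hjq]
          omega
        · simp [harr, g3, hjq]
          exact hI.child j (by omega)
  · intro x m t' hI hB
    have hxn : n ≤ x := by simpa [Test.holds, hI.nat0, hI.nat2] using hB
    obtain rfl : x = n := le_antisymm hI.le hxn
    obtain ⟨h1, h2, h3, h4, h5, h6, h7, h8, h9⟩ := hI
    exact ⟨h1, h2, h3, h4, h5, h6, h7, h8, by omega⟩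
  · refine ⟨by simp [h.nat0], by simp [h.nat1], by simp, ?_, by omega, by omega, ?_, ?_, by omega⟩
    · intro q h1 h2 h3 h4
      simp [h3, h4]
    · simp only [Mem.setArr_nat, Mem.setNat_nat]
      exact partialCliqueTree_one (by simp [h.nat1]) (by simp [h.nat1])
    · simp

/-! ## Listing the cliques -/

/-- Appends the owners of the positions in the linked list with head in register `9` to the
array `5`. -/
def listLoop : Prog :=
  .while (.ne 9 1) (block [.pred 13 9, .load 12 13 13, .store 5 4 12, .succ 4 4, .load 9 12 13])

/-- Lists the bags of the nodes in the array `19` in the arrays `4` and `5`. -/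
def listProg : Prog :=
  .seq (block [.const 2 0, .const 4 0, .store 4 1 1])
    (.seq (.while (.lt 2 3) (.seq (block [.load 9 19 2, .load 9 11 9])
      (.seq listLoop (block [.succ 2 2, .store 4 2 4])))) (block [.copy 0 3]))

/-- The effect of listing the owners of the positions `us`. -/
structure Listed (us : List ℕ) (m₀ m : Mem) : Prop where
  ptr : m.nat 4 = m₀.nat 4 + us.length
  nat : ∀ r, r ≠ 4 → r ≠ 9 → r ≠ 12 → r ≠ 13 → m.nat r = m₀.nat r
  arr : ∀ q, q ≠ 5 → m.arr q = m₀.arr q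
  old : ∀ u < m₀.nat 4, m.arr 5 u = m₀.arr 5 u
  new : ∀ j (h : j < us.length), m.arr 5 (m₀.nat 4 + j) = m₀.arr 13 us[j]

lemma listLoop_spec (us : List ℕ) {m : Mem} (t : ℕ) (h1 : m.nat 1 = 0)
    (h : Chain (m.arr 12) (m.nat 9) us) :
    WP listLoop (fun m' t' => Listed us m m' ∧ t' ≤ t + 1 + 12 * us.length) m t := by
  induction us generalizing m t with
  | nil =>
    refine Sim.while_false ?_ ⟨⟨by simp, by simp, by simp, by simp, by simp⟩, by simp⟩
    have : m.nat 9 = 0 := h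
    simp [Test.holds, h1, this]
  | cons u us ih =>
    obtain ⟨h9, hc⟩ := h
    have := Sim.while_true (T := .ne 9 1) (m := m) (t := t)
      (P := block [.pred 13 9, .load 12 13 13, .store 5 4 12, .succ 4 4, .load 9 12 13])
      (μ := PMF.pure ()) (ν := fun _ => PMF.pure ())
      (Q := fun _ m' t' => Listed (u :: us) m m' ∧ t' ≤ t + 1 + 12 * (u :: us).length)
      (Q' := fun _ m' t' => t' = t + 12 ∧ m'.nat 1 = 0 ∧ m'.nat 4 = m.nat 4 + 1 ∧
        (∀ r, r ≠ 4 → r ≠ 9 → r ≠ 12 → r ≠ 13 → m'.nat r = m.nat r) ∧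
        (∀ q, q ≠ 5 → m'.arr q = m.arr q) ∧
        m'.arr 5 = Function.update (m.arr 5) (m.nat 4) (m.arr 13 u) ∧
        m'.nat 9 = m.arr 12 u) ?_ ?_ ?_
    · rwa [PMF.pure_bind] at this
    · simp [Test.holds, h1, h9]
    · refine WP.block ?_
      simp only [after_pred, after_load, after_store, after_succ, after_nil]
      refine ⟨trivial, by simp [h1], by simp, ?_, ?_, by simp [h9], by simp [h9]⟩
      · intro r a b c d
        simp [a, b, c, d]
      · intro q hq
        simp [hq]
    · rintro - m' t' ⟨rfl, a1, a4, an, aa, a5, a9⟩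
      refine (ih (t + 12) a1 (by rw [a9, aa 12 (by simp)]; exact hc)).mono ?_
      rintro m'' t'' ⟨hl, ht⟩
      refine ⟨⟨by rw [hl.ptr, a4, List.length_cons]; omega, ?_, ?_, ?_, ?_⟩,
        by rw [List.length_cons]; omega⟩
      · intro r a b c d
        rw [hl.nat r a b c d, an r a b c d]
      · intro q hq
        rw [hl.arr q hq, aa q hq]
      · intro v hv
        rw [hl.old v (by omega), a5, Function.update_of_ne (by omega)]
      · intro j hj
        cases j with
        | zero => rw [Nat.add_zero, hl.old _ (by omega), a5, Function.update_self]; rfl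
        | succ j =>
          have := hl.new j (by simpa using hj)
          rw [a4, aa 13 (by simp)] at this
          rw [← add_assoc, add_right_comm, this]
          rfl

/-- The state after the bags of the first `a` nodes in the array `19` have been listed. -/
structure ListInv (n : ℕ) [NeZero n] (m₀ m₁ : Mem) (limit a : ℕ) (m : Mem) (t : ℕ) : Prop where
  nat1 : m.nat 1 = 0
  nat2 : m.nat 2 = a
  nat3 : m.nat 3 = m₁.nat 3
  arr : ∀ q, q ≠ 4 → q ≠ 5 → m.arr q = m₁.arr q
  le : a ≤ m₁.nat 3
  off : m.arr 4 a = m.nat 4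
  off_le : ∀ c ≤ a, m.arr 4 c ≤ m.nat 4
  off_succ : ∀ c < a, m.arr 4 (c + 1) = m.arr 4 c + (bagNodes n m₀ (m₁.arr 19 c)).length
  data : ∀ c < a, ∀ j (h : j < (bagNodes n m₀ (m₁.arr 19 c)).length),
    m.arr 5 (m.arr 4 c + j) = (bagNodes n m₀ (m₁.arr 19 c))[j]
  ptr : m.nat 4 = ∑ c ∈ Finset.range a, (bag n m₀ (m₁.arr 19 c)).card
  time : t ≤ limit + 20 * a + 12 * m.nat 4

/-- A bag is read off from the linked list of the positions of its node, with array `13` turning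
positions into indices. This takes 12 steps per entry and at most 20 more per clique. -/
lemma listProg_spec {n : ℕ} [NeZero n] {lam : ℝ} {T : SimpleGraph (Fin n)} {limit₀ : ℕ}
    {f : Fin n → Finset (Fin n)} {m₀ m₁ : Mem} {t₀ : ℕ} (h : GenInv lam T limit₀ n f m₀ t₀)
    (h1 : m₁.nat 1 = 0) (ha : ∀ q, q ≠ 6 → q ≠ 7 → q ≠ 18 → q ≠ 19 → m₁.arr q = m₀.arr q) (t : ℕ) :
    WP listProg (fun m' t' => m'.nat 0 = m₁.nat 3 ∧
      ListInv n m₀ m₁ (t + 20) (m₁.nat 3) m' t') m₁ t := by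
  refine WP.seq (WP.block ?_)
  simp only [after_const, after_store, after_nil]
  refine WP.seq (WP.while (ι := ℕ) (fun a m t' => ListInv n m₀ m₁ (t + 10) a m t')
    (fun a => m₁.nat 3 - a) ?_ ?_ (i := 0) ?_)
  · intro a m t' hI hB
    have han : a < m₁.nat 3 := by simpa [Test.holds, hI.nat2, hI.nat3] using hB
    set z := m₁.arr 19 a with hz
    have e19 := hI.arr 19 (by simp) (by simp)
    have e11 := (hI.arr 11 (by simp) (by simp)).trans (ha 11 (by simp) (by simp) (by simp) (by simp))
    have e12 := (hI.arr 12 (by simp) (by simp)).trans (ha 12 (by simp) (by simp) (by simp) (by simp))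
    have e13 := (hI.arr 13 (by simp) (by simp)).trans (ha 13 (by simp) (by simp) (by simp) (by simp))
    refine WP.seq (WP.block ?_)
    simp only [after_load, after_nil]
    refine WP.seq ((listLoop_spec (positions (m₀.arr 3) (m₀.nat 4) z) _ ?_ ?_).mono ?_)
    · simp [hI.nat1]
    · simpa [hI.nat2, e19, e11, e12, hz] using (h.bags z).1
    · rintro m' t'' ⟨hl, ht⟩
      have hlen : (bagNodes n m₀ z).length = (positions (m₀.arr 3) (m₀.nat 4) z).length := by
        rw [bagNodes, List.length_map]
      have hcard : (bag n m₀ z).card = (bagNodes n m₀ z).length :=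
        List.toFinset_card_of_nodup (h.nodup_bagNodes z)
      have l1 : m'.nat 1 = 0 := by
        rw [hl.nat 1 (by simp) (by simp) (by simp) (by simp)]; simp [hI.nat1]
      have l2 : m'.nat 2 = a := by
        rw [hl.nat 2 (by simp) (by simp) (by simp) (by simp)]; simp [hI.nat2]
      have l3 : m'.nat 3 = m₁.nat 3 := by
        rw [hl.nat 3 (by simp) (by simp) (by simp) (by simp)]; simp [hI.nat3]
      have l4 : m'.nat 4 = m.nat 4 + (bagNodes n m₀ z).length := by
        rw [hl.ptr, hlen]; simp
      have la : ∀ q, q ≠ 5 → m'.arr q = m.arr q := by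
        intro q hq
        rw [hl.arr q hq]; simp
      have lold : ∀ u < m.nat 4, m'.arr 5 u = m.arr 5 u := by
        intro u hu
        rw [hl.old u (by simpa using hu)]; simp
      have lnew : ∀ j (hj : j < (bagNodes n m₀ z).length),
          m'.arr 5 (m.nat 4 + j) = (bagNodes n m₀ z)[j] := by
        intro j hj
        have := hl.new j (by omega)
        simp only [Mem.setNat_arr, Mem.setNat_nat] at this
        have hu : (positions (m₀.arr 3) (m₀.nat 4) z)[j]'(by omega) < m₀.nat 4 :=
          (mem_positions.1 (List.getElem_mem _)).1
        rw [e13, ← h.val_owner hu] at this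
        simpa [bagNodes] using this
      have hoff := hI.off
      have htime := hI.time
      refine WP.block ?_
      simp only [after_succ, after_store, after_nil]
      refine ⟨a + 1, by omega, by simp [l1], by simp [l2], by simp [l3], ?_, han, by simp [l2], ?_, ?_,
        ?_, ?_, ?_⟩
      · intro q h4 h5
        simp [h4, la q h5, hI.arr q h4 h5]
      · intro c hc
        by_cases hca : c = a + 1
        · simp [hca, l2]
        · have := hI.off_le c (by omega)
          simp [l2, hca, la 4, l4]
          omega
      · intro c hc
        by_cases hca : c = a
        · simp [hca, l2, la 4, l4, hoff, hz]
        · simp [l2, hca, show c ≠ a + 1 by omega, la 4]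
          exact hI.off_succ c (by omega)
      · intro c hc j hj
        by_cases hca : c = a
        · subst hca
          simpa [l2, la 4, hoff] using lnew j hj
        · have := hI.data c (by omega) j hj
          have h6 := hI.off_succ c (by omega)
          have h7 := hI.off_le (c + 1) (by omega)
          simp only [l2, Mem.setNat_arr, Mem.setNat_nat, Mem.setArr_arr]
          simp [show c ≠ a + 1 by omega, la 4]
          rw [lold _ (by omega), this]
      · simp only [Mem.setArr_nat]
        rw [show (m'.setNat 2 (m'.nat 2 + 1)).nat 4 = m'.nat 4 by simp, l4, hI.ptr, Finset.sum_range_succ, ← hz, hcard]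
      · simp only [Mem.setArr_nat]
        rw [show (m'.setNat 2 (m'.nat 2 + 1)).nat 4 = m'.nat 4 by simp, l4, hlen]
        omega
  · intro a m t' hI hB
    have han : m₁.nat 3 ≤ a := by simpa [Test.holds, hI.nat2, hI.nat3] using hB
    obtain rfl : a = m₁.nat 3 := le_antisymm hI.le han
    refine WP.block ?_
    simp only [after_copy, after_nil]
    obtain ⟨i1, i2, i3, i4, i5, i6, i7, i8, i9, i10, i11⟩ := hI
    exact ⟨by simp [i3], by simpa using i1, by simpa using i2, by simpa using i3, by simpa using i4,
      i5, by simpa using i6, by simpa using i7, by simpa using i8, by simpa using i9,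
      by simpa using i10, by rw [show (m.setNat 0 (m.nat 3)).nat 4 = m.nat 4 by simp]; omega⟩
  · refine ⟨by simp [h1], by simp, by simp, ?_, by omega, by simp [h1], ?_, by simp, by simp, by simp,
      by omega⟩
    · intro q h4 h5
      simp [h4]
    · intro c hc
      obtain rfl : c = 0 := by omega
      simp [h1]

/-! ## The output -/

lemma HostInv.genInv {k : ℕ} {lam : ℝ} {T : SimpleGraph (Fin (k + 1))} {m : Mem} {t : ℕ}
    (h : HostInv (k + 1) lam k T m t) :
    GenInv lam T (20 * k + 12) 0 Fin.elim0 (m.setNat 2 0) (t + 4) := by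
  constructor <;> try simp [h.nat0, h.nat1, h.nat4, h.nat14, h.real0, h.arr2, h.arr10, h.arr15,
    h.arr17]
  · exact h.host
  · exact ⟨1, fun x => by simpa using h.perm x (by omega)⟩
  · rw [h.arr11, h.arr14]
    exact bags_zero
  · have := h.time
    omega

/-- The state after the output has been computed. -/
structure OutInv {n : ℕ} [NeZero n] (T : SimpleGraph (Fin n)) (F : Fin n → Finset (Fin n))
    (m : Mem) (t : ℕ) : Prop where
  hostTree : m.hostTree n = T
  subtree : m.subtree n = F
  isOutput : m.IsOutput n
  time : t ≤ 500 * ∑ i, (F i).card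

/-- Cliques represented by the same node coincide by the antichain property. This bounds their
number by `n` and their total size by that of all bags. -/
lemma PartialCliqueTree.bot_injOn {V : Type} {B : ℕ → Finset V} {x q : ℕ} {cls bot cp : ℕ → ℕ}
    (h : PartialCliqueTree B x q cls bot cp) : Set.InjOn bot (Finset.range q : Set ℕ) := by
  intro a ha b hb hab
  exact h.antichain a (by simpa using ha) b (by simpa using hb) (by rw [hab])

lemma PartialCliqueTree.image_bot_subset {V : Type} {B : ℕ → Finset V} {x q : ℕ}
    {cls bot cp : ℕ → ℕ} (h : PartialCliqueTree B x q cls bot cp) :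
    (Finset.range q).image bot ⊆ Finset.range x := by
  intro y hy
  obtain ⟨a, ha, rfl⟩ := Finset.mem_image.1 hy
  simpa using h.bot_lt a (by simpa using ha)

lemma output_spec {n : ℕ} [NeZero n] {lam : ℝ} {T : SimpleGraph (Fin n)}
    {F : Fin n → Finset (Fin n)} {m₀ : Mem} {t₀ : ℕ} (h : GenInv lam T (20 * n + 12) n F m₀ t₀)
    (t : ℕ) (ht : t ≤ t₀ + 10) : WP (.seq cliqueProg listProg) (OutInv T F) m₀ t := by
  refine WP.seq ((cliqueProg_spec h _).mono fun m₁ t₁ hC => ?_)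
  refine (listProg_spec h hC.nat1 hC.arr t₁).mono ?_
  rintro m t₂ ⟨hq, hL⟩
  have hn := NeZero.pos n
  have harr : ∀ q, q ≠ 4 → q ≠ 5 → q ≠ 6 → q ≠ 7 → q ≠ 18 → q ≠ 19 → m.arr q = m₀.arr q := by
    intro q h4 h5 h6 h7 h8 h9
    rw [hL.arr q h4 h5, hC.arr q h6 h7 h8 h9]
  have hsub : m.subtree n = F := by
    funext j
    rw [Mem.subtree, harr 2 (by simp) (by simp) (by simp) (by simp) (by simp) (by simp),
      harr 3 (by simp) (by simp) (by simp) (by simp) (by simp) (by simp), h.family j]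
  refine ⟨?_, hsub, ⟨?_, ?_, ?_⟩, ?_⟩
  · rw [Mem.hostTree, harr 0 (by simp) (by simp) (by simp) (by simp) (by simp) (by simp),
      harr 1 (by simp) (by simp) (by simp) (by simp) (by simp) (by simp), h.host.eq]
  · rw [harr 2 (by simp) (by simp) (by simp) (by simp) (by simp) (by simp),
      harr 3 (by simp) (by simp) (by simp) (by simp) (by simp) (by simp)]
    exact h.listOK
  · rw [hq]
    intro a ha
    exact listOK_of_nodup (hL.off_succ a ha) (hL.data a ha) (h.nodup_bagNodes _)
  · have hT := PartialCliqueTree.isCliqueTree (n := n) (par := fun x => m₀.arr 1 (x - 1)) (F := F)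
      (fun x hx h0 => h.parent_lt hx h0) h.isSubtree h.nonempty h.mem_bag hC.tree hC.child
    rw [hsub, hq, hL.arr 6 (by simp) (by simp), hL.arr 7 (by simp) (by simp)]
    convert hT using 1
    funext a
    exact listAt_eq_toFinset (hL.off_succ a a.2) (hL.data a a.2)
  · have hle : ∑ c ∈ Finset.range (m₁.nat 3), (bag n m₀ (m₁.arr 19 c)).card ≤
        ∑ i, (F i).card := by
      rw [← h.sum_card_bag, Fin.sum_univ_eq_sum_range fun x => (bag n m₀ x).card,
        ← Finset.sum_image (f := fun x => (bag n m₀ x).card) hC.tree.bot_injOn]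
      exact Finset.sum_le_sum_of_subset hC.tree.image_bot_subset
    have hqn : m₁.nat 3 ≤ n := by
      have := Finset.card_le_card hC.tree.image_bot_subset
      rwa [Finset.card_image_of_injOn hC.tree.bot_injOn, Finset.card_range, Finset.card_range]
        at this
    -- No subtree is empty. With `S` the sum on the right, the phases add up to at most `312 S + 90
    -- n + 93`, which is below `500 S` because `1 ≤ n ≤ S`.
    have hcard : n ≤ ∑ i, (F i).card := by
      have := Finset.sum_le_sum fun (i : Fin n) (_ : i ∈ Finset.univ) =>
        Finset.one_le_card.2 (h.nonempty i)
      simpa using this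
    have h1 := hL.time
    have h2 := hL.ptr
    have h3 := hC.time
    have h4 := h.time
    have h5 := h.ptr
    omega

/-- The program for ChordalGen with ConnectingNodes. -/
def chordalProg : Prog := .seq hostProg (.seq subtreesProg (.seq cliqueProg listProg))

lemma chordalProg_spec (n : ℕ) [NeZero n] (lam : ℝ≥0) (hlam : 0 < lam) :
    Sim chordalProg (chordalGen n lam) (fun a m t => OutInv a.1 a.2 m t)
      ⟨Function.update 0 0 n, 0, Function.update 0 0 (lam : ℝ)⟩ 0 := by
  obtain ⟨k, rfl⟩ : ∃ k, n = k + 1 := ⟨n - 1, by have := NeZero.pos n; omega⟩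
  refine Sim.seq (hostProg_spec k lam) fun T m t hT => ?_
  have hG : GenInv (lam : ℝ) T (20 * k + 13) 0 Fin.elim0 (m.setNat 2 0) (t + 1 + 4) := by
    obtain ⟨h1, h2, h3, h4, h5, h6, h7, h8, h9, h10, h11, h12, h13, h14, h15, h16, h17, h18, h19, h20,
      h21⟩ := hT.genInv
    exact ⟨h1, h2, h3, h4, h5, h6, h7, h8, h9, h10, h11, h12, h13, h14, h15, h16, h17, h18, h19, h20,
      by omega⟩
  refine Sim.seq (subtreesProg_spec lam hlam hG) fun F m' t' hF => Sim.of_wp ?_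
  refine output_spec (lam := lam) (t₀ := t') ?_ t' (by omega)
  obtain ⟨h1, h2, h3, h4, h5, h6, h7, h8, h9, h10, h11, h12, h13, h14, h15, h16, h17, h18, h19, h20,
    h21⟩ := hF
  exact ⟨h1, h2, h3, h4, h5, h6, h7, h8, h9, h10, h11, h12, h13, h14, h15, h16, h17, h18, h19, h20,
    by omega⟩

theorem corollary9 :
    ∃ (P : Prog) (C : ℕ), ∀ (n : ℕ) [NeZero n] (lam : ℝ≥0), 0 < lam →
      ∃ t : ℕ,
        (∀ c ∈ ((Config.init P n lam).run t).support,
          c.todo = [] ∧ c.mem.IsOutput n ∧ c.clock ≤ C * ∑ i : Fin n, (c.mem.subtree n i).card) ∧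
        ((Config.init P n lam).run t).map
          (fun c => (c.mem.hostTree n, fun i => c.mem.subtree n i)) = chordalGen n lam := by
  refine ⟨chordalProg, 500, fun n _ lam hlam => ?_⟩
  -- With nothing left to execute afterwards, `ρ` couples the abstract law, its first marginal, with
  -- the law of the final memory and clock.
  obtain ⟨t, ρ, hρ, hrun, hR⟩ := chordalProg_spec n lam hlam [] _ PMF.pure
    (fun a m t => OutInv a.1 a.2 m t) fun a m t h => Halts.done h
  rw [PMF.bind_pure] at hρ
  refine ⟨t, ?_, ?_⟩
  · intro c hc
    rw [Config.init, hrun, PMF.support_map] at hc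
    obtain ⟨x, hx, rfl⟩ := hc
    have h := hR x hx
    refine ⟨rfl, h.isOutput, ?_⟩
    simpa only [h.subtree] using h.time
  · rw [Config.init, hrun, PMF.map_comp, ← hρ]
    -- On the support of `ρ` the output is equal to the abstract outcome, so their laws agree.
    refine PMF.bind_congr_support _ fun x hx => ?_
    have h := hR x hx
    simp only [Function.comp_apply, h.hostTree, h.subtree]
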